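/- Let $(R,\mathfrak m,k)$ be an excellent local normal domain with fraction field $K$, and let $\mathcal R_{\mathfrak m}$ be the set of Rees valuations of $\mathfrak m$, i.e. the discrete valuations $\nu$ of $K$, normalized to have value group $\mathbb Z$, whose valuation rings are the degree-zero parts of the homogeneous localizations of $A=\overline{R[\mathfrak m T,T^{-1}]}$ (the integral closure of the extended Rees algebra in $K(T)$) at the associated primes of $T^{-1}A$. For a finitely generated $R$-module $M\neq 0$ of Krull dimension $d$ let $e_{\mathfrak m}(M)=\lim_{n\to\infty} d!\,\mathrm{length}_R(M/\mathfrak m^nM)/n^d$, and for $0\ne f\in R$ let $\mathrm{ord}_{\mathfrak m}(f)=\max\{n\mid f\in\mathfrak m^n\}$. For an ideal $I$, let $\overline{I}$ denote its integral closure, i.e. the set of $x\in R$ with $x^t+a_1x^{t-1}+\cdots+a_t=0$ for some $t\ge 1$ and $a_i\in I^i$. Suppose that $B\ge 0$ is an integer such that $\overline{\mathfrak m^{n+B}}\subseteq\mathfrak m^n$ for all integers $n\ge 0$. (1) If $C\ge 0$ is an integer such that $e_{\mathfrak m}(R/fR)\le C\,\mathrm{ord}_{\mathfrak m}(f)$ for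 all $0\ne f\in\mathfrak m$, then for all pairs of distinct Rees valuations $\nu_1\neq\nu_2$ in $\mathcal R_{\mathfrak m}$ and all $0\neq f\in\mathfrak m$, $$\nu_1(f)\le (C-1)\,\nu_2(f).$$ (2) Assume $B\ge 1$. If $E\ge 0$ is an integer such that $\nu_1(g)\le E\,\nu_2(g)$ for all $\nu_1,\nu_2\in\mathcal R_{\mathfrak m}$ and all $0\ne g\in\mathfrak m$, then for all $0\ne f\in\mathfrak m$, $$e_{\mathfrak m}(R/fR)\le 2BE\,e_{\mathfrak m}(R)^2\,\mathrm{ord}_{\mathfrak m}(f).$$ -/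

import Mathlib

open scoped TensorProduct WithZero Nat

universe u v

noncomputable section

/-! ### Excellent rings -/

/-- A Noetherian algebra `A` over a field `k` is geometrically regular if `L ⊗ₖ A` is a regular
ring for every finite field extension `L` of `k`. -/
def IsGeometricallyRegular (k : Type u) (A : Type v) [Field k] [CommRing A] [Algebra k A] : Prop :=
  ∀ (L : Type u) [Field L] [Algebra k L] [FiniteDimensional k L], IsRegularRing (L ⊗[k] A)

/-- All formal fibres of a local ring, i.e. the fibres of the map to its completion, are
geometrically regular. -/
def HasGeometricallyRegularFormalFibres (A : Type u) [CommRing A] [IsLocalRing A] : Prop :=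
  ∀ (q : Ideal A) [q.IsPrime], IsGeometricallyRegular q.ResidueField
    (q.ResidueField ⊗[A] AdicCompletion (IsLocalRing.maximalIdeal A) A)

/-- The condition on formal fibres in Grothendieck's definition of a G-ring. -/
def IsGrothendieckRing (R : Type u) [CommRing R] : Prop :=
  ∀ (p : Ideal R) [p.IsPrime], HasGeometricallyRegularFormalFibres (Localization.AtPrime p)

/-- The condition J-2: the regular locus of every finitely generated algebra is open. -/
def IsJTwoRing (R : Type u) [CommRing R] : Prop :=
  ∀ (S : Type u) [CommRing S] [Algebra R S] [Algebra.FiniteType R S],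
    IsOpen {p : PrimeSpectrum S | IsRegularLocalRing (Localization.AtPrime p.asIdeal)}

/-- Catenarity, for Noetherian rings: any two saturated chains of prime ideals with the same end
points have the same length. -/
def IsCatenaryRing (S : Type u) [CommRing S] : Prop :=
  ∀ s t : RelSeries {x : PrimeSpectrum S × PrimeSpectrum S | x.1 ⋖ x.2},
    s.head = t.head → s.last = t.last → s.length = t.length

/-- Every finitely generated algebra is catenary. -/
def IsUniversallyCatenaryRing (R : Type u) [CommRing R] : Prop :=
  ∀ (S : Type u) [CommRing S] [Algebra R S] [Algebra.FiniteType R S], IsCatenaryRing S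

/-- Excellent rings: Noetherian, universally catenary, G-ring, J-2. -/
structure IsExcellentRing (R : Type u) [CommRing R] : Prop where
  isNoetherianRing : IsNoetherianRing R
  isUniversallyCatenaryRing : IsUniversallyCatenaryRing R
  isGrothendieckRing : IsGrothendieckRing R
  isJTwoRing : IsJTwoRing R

/-! ### Integral closure of ideals, order, multiplicity -/

section Ideals

variable {R : Type u} [CommRing R]

/-- The integral closure of the ideal `I`: all `x` with
`x ^ t + a 1 * x ^ (t - 1) + ⋯ + a t = 0` for some `t ≥ 1` and `a i ∈ I ^ i`. -/
def idealIntegralClosure (I : Ideal R) : Set R :=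
  {x | ∃ t : ℕ, 1 ≤ t ∧ ∃ a : ℕ → R, (∀ i ∈ Finset.Icc 1 t, a i ∈ I ^ i) ∧
    x ^ t + ∑ i ∈ Finset.Icc 1 t, a i * x ^ (t - i) = 0}

/-- The `I`-adic order `max {n | f ∈ I ^ n}`; the set is bounded if `R` is a Noetherian domain,
`I ≠ R` and `f ≠ 0`. -/
def idealOrder (I : Ideal R) (f : R) : ℕ :=
  sSup {n : ℕ | f ∈ I ^ n}

/-- The Hilbert–Samuel multiplicity `lim d! * length (M / I ^ n M) / n ^ d` of `M` with respect
to `I`, where `d` is the Krull dimension of `M`. -/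
def hilbertSamuelMultiplicity (I : Ideal R) (M : Type u) [AddCommGroup M] [Module R M] : ℝ :=
  let d : ℕ := ((Module.supportDim R M).unbotD 0).toNat
  Filter.limUnder Filter.atTop fun n : ℕ =>
    (d ! : ℝ) * ((Module.length R (M ⧸ (I ^ n • ⊤ : Submodule R M))).toNat : ℝ) / (n : ℝ) ^ d

end Ideals

/-! ### Rees valuations -/

section Rees

/-- The associated primes of the principal ideal generated by `a`. -/
def associatedPrimesOfElement {A : Type u} [CommRing A] (a : A) : Set (Ideal A) :=
  associatedPrimes A (A ⧸ Ideal.span {a})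

variable {R : Type u} [CommRing R] (K : Type v) [Field K] [Algebra R K] (I : Ideal R)

/-- The extended Rees algebra `R[IT, T⁻¹]`, as a subalgebra of `K(T)`. -/
def extendedReesAlgebra : Subalgebra R (RatFunc K) :=
  Algebra.adjoin R
    (insert (RatFunc.X)⁻¹ ((fun a : R => RatFunc.C (algebraMap R K a) * RatFunc.X) '' (I : Set R)))

/-- The integral closure of `R[IT, T⁻¹]` in `K(T)`. -/
def normalizedExtendedReesAlgebra : Subalgebra (extendedReesAlgebra K I) (RatFunc K) :=
  integralClosure (extendedReesAlgebra K I) (RatFunc K)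

/-- The element `T⁻¹` of the normalized extended Rees algebra. -/
def reesTInv : normalizedExtendedReesAlgebra K I :=
  algebraMap (extendedReesAlgebra K I) (normalizedExtendedReesAlgebra K I)
    ⟨(RatFunc.X)⁻¹, Algebra.subset_adjoin (Set.mem_insert _ _)⟩

/-- The exceptional primes: the associated primes of the ideal generated by `T⁻¹` in the normalized
extended Rees algebra. -/
def exceptionalPrimes : Set (Ideal (normalizedExtendedReesAlgebra K I)) :=
  associatedPrimesOfElement (reesTInv K I)

variable {K}

/-- The degree zero part of the homogeneous localization of the normalized extended Rees algebra
at `Q`: all fractions `aTⁿ / bTⁿ` with `aTⁿ` and `bTⁿ` in the algebra and `bTⁿ ∉ Q`. -/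
def reesHomogeneousLocalization (Q : Ideal (normalizedExtendedReesAlgebra K I)) : Set K :=
  {x | ∃ (n : ℤ) (a b : K), ∃ _ : RatFunc.C a * RatFunc.X ^ n ∈ normalizedExtendedReesAlgebra K I,
    ∃ hb : RatFunc.C b * RatFunc.X ^ n ∈ normalizedExtendedReesAlgebra K I,
      (⟨RatFunc.C b * RatFunc.X ^ n, hb⟩ : normalizedExtendedReesAlgebra K I) ∉ Q ∧ x = a / b}

/-- `ν` is a Rees valuation of `I`: it is a discrete valuation of `K` with value group `ℤ`, and its
valuation ring is the homogeneous localization of the normalized extended Rees algebra at an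
exceptional prime. -/
def IsReesValuation (ν : Valuation K ℤᵐ⁰) : Prop :=
  Function.Surjective ν ∧
    ∃ Q ∈ exceptionalPrimes K I, {x : K | ν x ≤ 1} = reesHomogeneousLocalization I Q

/-- The additive value `ν(f) ∈ ℤ` of a nonzero element `f` of `R`. -/
def addValue (ν : Valuation K ℤᵐ⁰) (f : R) : ℤ :=
  -WithZero.log (ν (algebraMap R K f))

end Rees

end

/-!
Let `I n` be the integral closure of `𝔪 ^ n`. The hypothesis `I (n + B) ⊆ 𝔪 ^ n` says that the
filtration `I` differs from the `𝔪`-adic one by a bounded shift, so that multiplicities can be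
computed with `I` in place of the powers of `𝔪`.

*The normalized extended Rees algebra.* An element of `K(T)` integral over `R[𝔪 T, T⁻¹]` is a
Laurent polynomial over `K`. Its lowest term is almost integral over the Noetherian ring
`R[𝔪 T, T⁻¹]`, hence integral; splitting off lowest terms shows that the integral closure is
graded (`single_coeff_mem_normalized`). So it is the extended Rees algebra `A = ⨁ I n T ^ n` of
the filtration `I` (`normalizedEquiv`). Multiplication by `T ^ (-B)` embeds it into `R[𝔪 T, T⁻¹]`,
whence it is a Noetherian normal domain of finite type over `R`
(`IdealFiltration.IsCommensurable.isNoetherianRing_and_finiteType`).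

*Rees valuations.* The localization of `A` at an associated prime `Q i` of `T⁻¹` is a discrete
valuation ring (`exists_isEssentialValuation`), its valuation restricts to a Rees valuation `ν i`
of `K`, and all Rees valuations arise in this way (`isReesValuation_baseValuation`,
`exists_eq_baseValuation`). If `a i` is the order of `T⁻¹` at `Q i`, then `r` lies in `I n` if and
only if `n * a i ≤ ν i r` for all `i`, because divisibility by `T ^ (-n)` in `A` is tested at the
`Q i` (`IdealFiltration.mem_of_forall_val_le`).

*Multiplicities.* The Hilbert function of `A / Q i` is eventually polynomial
(`IsNoetherianPair.evPoly`, a form of the Hilbert–Serre theorem), and it has degree exactly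
`d = dim R - 1`. The degree is at most `d` by comparison with the length of `R / 𝔪 ^ n`. It is at
least `d` because it drops by at least one at each step of a chain of homogeneous primes, while,
`R` being universally catenary, every saturated chain from `0` through `Q i` to the maximal
homogeneous ideal of `A` has length at least `dim R + 1`
(`IdealFiltration.IsCommensurable.not_evPoly`). So the normalized leading coefficient `δ i` is a
positive integer. Counting lengths in steps which raise the value at one valuation by one gives
`e(R / f) = ∑ i, δ i * ν i f` (`ValuativeFiltration.tendsto_colength_span_sup`) and
`e(R) = ∑ i, δ i * a i` (`ValuativeFiltration.tendsto_colength_pow`).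

*Conclusion.* Let `n = ord f`. For distinct `ν 1`, `ν 2` one has
`ν 1 f + ν 2 f ≤ e(R / f) ≤ C * n ≤ C * ν 2 f`, which is the first inequality. For the second,
`f ∉ 𝔪 ^ (n + 1)` yields some `j` with `ν j f ≤ (n + 1 + B) * a j - 1`, so that, with
`D = ∑ i, δ i`, `e(R / f) ≤ E * D * ν j f ≤ E * D * ((n + 1 + B) * a j - 1)`, and this is at most
`2 * B * E * n * (D + a j - 1) ^ 2`, where `D + a j - 1 ≤ ∑ i, δ i * a i = e(R)`.
-/

section

open Filter Topology IsLocalRing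

/-! ### Eventually polynomial sequences -/

/-- The sequence `f` agrees for large arguments with a polynomial of degree `< k`, expressed by
the vanishing of the `k`-th iterated difference of `f` for large arguments. -/
def EvPoly : ℕ → (ℕ → ℤ) → Prop
  | 0, f => ∀ᶠ n in atTop, f n = 0
  | k + 1, f => EvPoly k fun n => f (n + 1) - f n

namespace EvPoly

lemma congr {k : ℕ} {f g : ℕ → ℤ} (hf : EvPoly k f) (h : ∀ᶠ n in atTop, f n = g n) :
    EvPoly k g := by
  induction k generalizing f g with
  | zero =>
    filter_upwards [hf, h] with n h1 h2
    rw [← h2, h1]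
  | succ k ih =>
    refine ih (f := fun n => f (n + 1) - f n) hf ?_
    filter_upwards [h, (tendsto_add_atTop_nat 1).eventually h] with n h1 h2
    rw [h1, h2]

lemma zero (k : ℕ) : EvPoly k fun _ => 0 := by
  induction k with
  | zero => exact Eventually.of_forall fun _ => rfl
  | succ k ih => simpa [EvPoly] using ih

lemma add {k : ℕ} {f g : ℕ → ℤ} (hf : EvPoly k f) (hg : EvPoly k g) :
    EvPoly k fun n => f n + g n := by
  induction k generalizing f g with
  | zero =>
    filter_upwards [hf, hg] with n h1 h2
    rw [h1, h2, add_zero]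
  | succ k ih =>
    exact (ih (f := fun n => f (n + 1) - f n) (g := fun n => g (n + 1) - g n) hf hg).congr
      (Eventually.of_forall fun n => by ring)

lemma neg {k : ℕ} {f : ℕ → ℤ} (hf : EvPoly k f) : EvPoly k fun n => - f n := by
  induction k generalizing f with
  | zero =>
    filter_upwards [hf] with n h1
    rw [h1, neg_zero]
  | succ k ih =>
    exact (ih (f := fun n => f (n + 1) - f n) hf).congr (Eventually.of_forall fun n => by ring)

lemma sub {k : ℕ} {f g : ℕ → ℤ} (hf : EvPoly k f) (hg : EvPoly k g) :
    EvPoly k fun n => f n - g n :=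
  (hf.add hg.neg).congr (Eventually.of_forall fun n => by ring)

lemma shift {k : ℕ} {f : ℕ → ℤ} (hf : EvPoly k f) (s : ℕ) : EvPoly k fun n => f (n + s) := by
  induction k generalizing f with
  | zero => exact (tendsto_add_atTop_nat s).eventually hf
  | succ k ih =>
    exact (ih (f := fun n => f (n + 1) - f n) hf).congr
      (Eventually.of_forall fun n => by simp only [add_right_comm])

lemma succ {k : ℕ} {f : ℕ → ℤ} (hf : EvPoly k f) : EvPoly (k + 1) f :=
  (hf.shift 1).sub hf

lemma mono {k l : ℕ} {f : ℕ → ℤ} (hf : EvPoly k f) (h : k ≤ l) : EvPoly l f := by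
  induction h with
  | refl => exact hf
  | step _ ih => exact ih.succ

lemma shift_sub {k : ℕ} {f : ℕ → ℤ} (hf : EvPoly (k + 1) f) (s : ℕ) :
    EvPoly k fun n => f (n + s) - f n := by
  induction s with
  | zero => simpa using zero k
  | succ s ih =>
    have h : EvPoly k fun n => f (n + 1) - f n := hf
    exact ((h.shift s).add ih).congr (Eventually.of_forall fun n => by
      simp only [add_assoc]; ring)

end EvPoly

/-- A case of the Stolz–Cesàro theorem: if `g n / n ^ k` tends to `L`, then
`(∑ j < n, g j) / n ^ (k + 1)` tends to `L / (k + 1)`. -/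
lemma tendsto_sum_range_div_pow {g : ℕ → ℝ} {k : ℕ} {L : ℝ}
    (hg : Tendsto (fun n : ℕ => g n / (n : ℝ) ^ k) atTop (𝓝 L)) :
    Tendsto (fun n : ℕ => (∑ j ∈ Finset.range n, g j) / (n : ℝ) ^ (k + 1)) atTop
      (𝓝 (L / (k + 1))) := by
  -- compare with the telescoping sum of `b n = (n + 1) ^ (k + 1) - n ^ (k + 1)`
  set b : ℕ → ℝ := fun n => ((n : ℝ) + 1) ^ (k + 1) - (n : ℝ) ^ (k + 1) with hb
  have hsum : ∀ n, ∑ j ∈ Finset.range n, b j = (n : ℝ) ^ (k + 1) := by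
    intro n
    have := Finset.sum_range_sub (fun j : ℕ => (j : ℝ) ^ (k + 1)) n
    simpa [hb] using this
  have hbk : Tendsto (fun n : ℕ => b n / (n : ℝ) ^ k) atTop (𝓝 ((k : ℝ) + 1)) := by
    have hd : HasDerivAt (fun x : ℝ => x ^ (k + 1)) ((k : ℝ) + 1) 1 := by
      simpa using hasDerivAt_pow (k + 1) (1 : ℝ)
    have h1 := (hasDerivAt_iff_tendsto_slope_zero.mp hd)
    have h2 : Tendsto (fun n : ℕ => ((n : ℝ))⁻¹) atTop (𝓝[≠] 0) := by
      refine tendsto_nhdsWithin_iff.mpr ⟨tendsto_inv_atTop_nhds_zero_nat, ?_⟩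
      filter_upwards [eventually_gt_atTop 0] with n hn
      have : (n : ℝ) ≠ 0 := by exact_mod_cast hn.ne'
      simpa using this
    refine (h1.comp h2).congr' ?_
    filter_upwards [eventually_gt_atTop 0] with n hn
    have hn' : (n : ℝ) ≠ 0 := by exact_mod_cast hn.ne'
    simp only [Function.comp, hb, smul_eq_mul, inv_inv, one_pow]
    have : (1 + (n : ℝ)⁻¹) = ((n : ℝ) + 1) / n := by field_simp
    rw [this, div_pow]
    field_simp
    ring
  have hk : (0 : ℝ) < (k : ℝ) + 1 := by positivity
  have hlit : (fun n => g n - L / (k + 1) * b n) =o[atTop] b := by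
    have hq : Tendsto (fun n => g n / b n) atTop (𝓝 (L / (k + 1))) := by
      refine (hg.div hbk hk.ne').congr' ?_
      filter_upwards [eventually_gt_atTop 0] with n hn
      have hn' : (n : ℝ) ≠ 0 := by exact_mod_cast hn.ne'
      exact div_div_div_cancel_right₀ (pow_ne_zero _ hn') _ _
    have hbpos : ∀ n, b n ≠ 0 := by
      intro n
      have : (n : ℝ) ^ (k + 1) < ((n : ℝ) + 1) ^ (k + 1) :=
        pow_lt_pow_left₀ (by linarith) (by positivity) (by omega)
      simp only [hb]; linarith
    refine (Asymptotics.isLittleO_iff_tendsto (fun n h => absurd h (hbpos n))).mpr ?_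
    have := hq.sub_const (L / (k + 1))
    rw [sub_self] at this
    refine this.congr fun n => ?_
    field_simp [hbpos n]
  have hbnn : (0 : ℕ → ℝ) ≤ b := by
    intro n
    have : (n : ℝ) ^ (k + 1) ≤ ((n : ℝ) + 1) ^ (k + 1) :=
      pow_le_pow_left₀ (by positivity) (by linarith) _
    simp only [hb, Pi.zero_apply]; linarith
  have htop : Tendsto (fun n => ∑ i ∈ Finset.range n, b i) atTop atTop := by
    simp only [hsum]
    exact (tendsto_pow_atTop (by omega)).comp tendsto_natCast_atTop_atTop
  have h3 := hlit.sum_range hbnn htop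
  simp only [Finset.sum_sub_distrib, ← Finset.mul_sum, hsum] at h3
  have h4 := h3.tendsto_div_nhds_zero.add_const (L / ((k : ℝ) + 1))
  rw [zero_add] at h4
  refine h4.congr' ?_
  filter_upwards [eventually_gt_atTop 0] with n hn
  have hn' : (n : ℝ) ^ (k + 1) ≠ 0 := pow_ne_zero _ (by exact_mod_cast hn.ne')
  field_simp
  ring

/-- Shifting the argument does not change the limit of `g n / n ^ k`. -/
lemma tendsto_shift_div_pow {g : ℕ → ℝ} {k : ℕ} {L : ℝ} (s : ℕ)
    (hg : Tendsto (fun n : ℕ => g n / (n : ℝ) ^ k) atTop (𝓝 L)) :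
    Tendsto (fun n : ℕ => g (n + s) / (n : ℝ) ^ k) atTop (𝓝 L) := by
  have h1 := hg.comp (tendsto_add_atTop_nat s)
  have h2 : Tendsto (fun n : ℕ => (((n + s : ℕ) : ℝ) / n) ^ k) atTop (𝓝 1) := by
    have : Tendsto (fun n : ℕ => ((n + s : ℕ) : ℝ) / n) atTop (𝓝 1) := by
      have := (tendsto_const_div_atTop_nhds_zero_nat (s : ℝ)).const_add 1
      rw [add_zero] at this
      refine this.congr' ?_
      filter_upwards [eventually_gt_atTop 0] with n hn
      have hn' : (n : ℝ) ≠ 0 := by exact_mod_cast hn.ne'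
      push_cast
      field_simp
    simpa using this.pow k
  have h3 := h1.mul h2
  rw [mul_one] at h3
  refine h3.congr' ?_
  filter_upwards [eventually_gt_atTop 0] with n hn
  have hn' : (n : ℝ) ≠ 0 := by exact_mod_cast hn.ne'
  have hn2 : ((n + s : ℕ) : ℝ) ≠ 0 := by
    have : 0 < n + s := by omega
    exact_mod_cast this.ne'
  simp only [Function.comp]
  rw [div_pow]
  field_simp

/-- The converse to `tendsto_shift_div_pow`. -/
lemma tendsto_of_shift_div_pow {g : ℕ → ℝ} {k : ℕ} {L : ℝ} (s : ℕ)
    (hg : Tendsto (fun n : ℕ => g (n + s) / (n : ℝ) ^ k) atTop (𝓝 L)) :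
    Tendsto (fun n : ℕ => g n / (n : ℝ) ^ k) atTop (𝓝 L) := by
  rw [← tendsto_add_atTop_iff_nat s]
  have h2 : Tendsto (fun n : ℕ => ((n : ℝ) / (n + s : ℕ)) ^ k) atTop (𝓝 1) := by
    have h := tendsto_shift_div_pow (g := fun n => (n : ℝ) ^ k) (k := k) (L := 1) s (by
      refine tendsto_const_nhds.congr' ?_
      filter_upwards [eventually_gt_atTop 0] with n hn
      have hn' : (n : ℝ) ≠ 0 := by exact_mod_cast hn.ne'
      field_simp)
    simpa [div_pow] using h.inv₀ one_ne_zero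
  have h3 := hg.mul h2
  rw [mul_one] at h3
  refine h3.congr' ?_
  filter_upwards [eventually_gt_atTop 0] with n hn
  have hn' : (n : ℝ) ≠ 0 := by exact_mod_cast hn.ne'
  have hn2 : ((n + s : ℕ) : ℝ) ≠ 0 := by
    have : 0 < n + s := by omega
    exact_mod_cast this.ne'
  rw [div_pow]
  field_simp

namespace EvPoly

/-- A polynomial sequence of degree at most `k` has an integral normalized leading coefficient,
and if that vanishes the degree is smaller than `k`. -/
lemma exists_tendsto {k : ℕ} {f : ℕ → ℤ} (hf : EvPoly (k + 1) f) :
    ∃ c : ℤ, Tendsto (fun n : ℕ => ((f n : ℤ) : ℝ) / (n : ℝ) ^ k) atTop (𝓝 ((c : ℝ) / k !)) ∧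
      (c = 0 → EvPoly k f) := by
  induction k generalizing f with
  | zero =>
    have hf' : ∀ᶠ n in atTop, f (n + 1) - f n = 0 := hf
    obtain ⟨N, hN⟩ := eventually_atTop.mp hf'
    have hc : ∀ n ≥ N, f n = f N := by
      intro n hn
      induction n, hn using Nat.le_induction with
      | base => rfl
      | succ n hn ih => rw [← ih]; linarith [hN n hn]
    refine ⟨f N, ?_, fun h => ?_⟩
    · refine tendsto_const_nhds.congr' ?_
      filter_upwards [eventually_ge_atTop N] with n hn
      simp [hc n hn]
    · filter_upwards [eventually_ge_atTop N] with n hn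
      rw [hc n hn, h]
  | succ k ih =>
    obtain ⟨c, hc, hc0⟩ := ih (f := fun n => f (n + 1) - f n) hf
    refine ⟨c, ?_, hc0⟩
    have h1 := tendsto_sum_range_div_pow hc
    have h2 : ∀ n : ℕ, ∑ j ∈ Finset.range n, (((f (j + 1) - f j : ℤ)) : ℝ) = f n - f 0 := by
      intro n
      have := Finset.sum_range_sub (fun j => ((f j : ℤ) : ℝ)) n
      rw [← this]
      refine Finset.sum_congr rfl fun j _ => ?_
      push_cast; ring
    simp only [h2] at h1
    have h3 : Tendsto (fun n : ℕ => ((f 0 : ℤ) : ℝ) / (n : ℝ) ^ (k + 1)) atTop (𝓝 0) :=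
      tendsto_const_nhds.div_atTop ((tendsto_pow_atTop (by omega)).comp tendsto_natCast_atTop_atTop)
    have h4 := h1.add h3
    rw [add_zero, div_div] at h4
    have h5 : ((k ! : ℕ) : ℝ) * ((k : ℝ) + 1) = ((k + 1) ! : ℕ) := by
      rw [Nat.factorial_succ]; push_cast; ring
    rw [h5] at h4
    refine h4.congr fun n => ?_
    rw [← add_div]; congr 1; ring

lemma exists_le_pow {k : ℕ} {f : ℕ → ℤ} (hf : EvPoly (k + 1) f) :
    ∃ C : ℝ, ∀ᶠ n : ℕ in atTop, ((f n : ℤ) : ℝ) ≤ C * (n : ℝ) ^ k := by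
  obtain ⟨c, hc, -⟩ := hf.exists_tendsto
  refine ⟨c / k ! + 1, ?_⟩
  filter_upwards [hc.eventually (gt_mem_nhds (lt_add_one _)), eventually_gt_atTop 0] with n h hn
  have hn' : (0 : ℝ) < (n : ℝ) ^ k := pow_pos (by exact_mod_cast hn) k
  exact ((div_lt_iff₀ hn').mp h).le

/-- A nonnegative polynomial sequence that is `O(n ^ d)` has degree at most `d`. -/
lemma of_le_pow {k d : ℕ} {f : ℕ → ℤ} (hf : EvPoly k f) (h0 : ∀ᶠ n in atTop, 0 ≤ f n) {C : ℝ}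
    (hC : ∀ᶠ n : ℕ in atTop, ((f n : ℤ) : ℝ) ≤ C * (n : ℝ) ^ d) : EvPoly (d + 1) f := by
  induction k with
  | zero => exact hf.mono (by omega)
  | succ k ih =>
    rcases Nat.lt_or_ge d k with hk | hk
    · obtain ⟨c, hc, hc0⟩ := hf.exists_tendsto
      refine ih (hc0 ?_)
      have h1 : Tendsto (fun n : ℕ => ((f n : ℤ) : ℝ) / (n : ℝ) ^ k) atTop (𝓝 0) := by
        have h2 : Tendsto (fun n : ℕ => |C| / (n : ℝ)) atTop (𝓝 0) :=
          tendsto_const_div_atTop_nhds_zero_nat _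
        refine tendsto_of_tendsto_of_tendsto_of_le_of_le' tendsto_const_nhds h2 ?_ ?_
        · filter_upwards [h0] with n h
          have : (0 : ℝ) ≤ f n := by exact_mod_cast h
          positivity
        · filter_upwards [hC, eventually_ge_atTop 1] with n h hn
          have hn1 : (1 : ℝ) ≤ n := by exact_mod_cast hn
          have hn' : (0 : ℝ) < n := by linarith
          rw [div_le_div_iff₀ (by positivity) hn']
          calc (f n : ℝ) * n ≤ C * (n : ℝ) ^ d * n := by gcongr
            _ = C * (n : ℝ) ^ (d + 1) := by ring
            _ ≤ |C| * (n : ℝ) ^ (d + 1) := by gcongr; exact le_abs_self C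
            _ ≤ |C| * (n : ℝ) ^ k := by gcongr; exact hk
      have h3 := tendsto_nhds_unique hc h1
      have h4 : ((k ! : ℕ) : ℝ) ≠ 0 := by exact_mod_cast Nat.factorial_ne_zero k
      rw [div_eq_zero_iff] at h3
      exact_mod_cast h3.resolve_right h4
    · exact hf.mono (by omega)

/-- A polynomial sequence between `0` and a polynomial sequence of degree `< j` has degree
`< j`. -/
lemma of_le {k j : ℕ} {f g : ℕ → ℤ} (hf : EvPoly k f) (hg : EvPoly j g)
    (h0 : ∀ᶠ n in atTop, 0 ≤ f n) (h : ∀ᶠ n in atTop, f n ≤ g n) : EvPoly j f := by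
  cases j with
  | zero =>
    have hg' : ∀ᶠ n in atTop, g n = 0 := hg
    filter_upwards [hg', h0, h] with n h1 h2 h3
    omega
  | succ j =>
    obtain ⟨C, hC⟩ := hg.exists_le_pow
    refine hf.of_le_pow h0 (C := C) ?_
    filter_upwards [hC, h] with n h1 h2
    exact le_trans (by exact_mod_cast h2) h1

/-- The summation of a polynomial sequence. -/
lemma sum_range {k : ℕ} {f : ℕ → ℤ} (hf : EvPoly k f) :
    EvPoly (k + 1) fun n => ∑ j ∈ Finset.range n, f j :=
  hf.congr (Eventually.of_forall fun n => by
    simp only [Finset.sum_range_succ]; ring)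

lemma of_shift {k : ℕ} {f : ℕ → ℤ} (s : ℕ) (hf : EvPoly k fun n => f (n + s)) : EvPoly k f := by
  induction k generalizing f with
  | zero =>
    have h : Tendsto (fun n => f (n + s)) atTop (pure 0) := tendsto_pure.mpr hf
    exact tendsto_pure.mp ((tendsto_add_atTop_iff_nat s).mp h)
  | succ k ih =>
    exact ih (f := fun n => f (n + 1) - f n)
      (EvPoly.congr (k := k) hf (Eventually.of_forall fun n => by simp only [add_right_comm]))

end EvPoly

/-! ### Colengths of ideals -/

section Colength

variable {R : Type u} [CommRing R]

/-- The length of `R ⧸ J` as an integer, with value `0` if the length is infinite. -/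
noncomputable def colength (J : Ideal R) : ℤ := ((Module.length R (R ⧸ J)).toNat : ℤ)

lemma colength_top : colength (⊤ : Ideal R) = 0 := by
  simp [colength]

lemma length_quotient_eq_add {U V : Ideal R} (h : V ≤ U) :
    Module.length R (R ⧸ V) =
      Module.length R (U ⧸ V.submoduleOf U) + Module.length R (R ⧸ U) := by
  refine Module.length_eq_add_of_exact (Submodule.mapQ (V.submoduleOf U) V U.subtype le_rfl)
    (Submodule.factor h) ?_ (Submodule.factor_surjective h) ?_
  · rw [← LinearMap.ker_eq_bot, LinearMap.ker_eq_bot']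
    intro y hy
    obtain ⟨y, rfl⟩ := Submodule.mkQ_surjective _ y
    have h1 : (y : R) ∈ V := (Submodule.Quotient.mk_eq_zero V).mp hy
    exact (Submodule.Quotient.mk_eq_zero _).mpr h1
  · intro y
    obtain ⟨y, rfl⟩ := Submodule.mkQ_surjective _ y
    constructor
    · intro hy
      have h1 : y ∈ U := (Submodule.Quotient.mk_eq_zero U).mp hy
      exact ⟨Submodule.mkQ _ ⟨y, h1⟩, rfl⟩
    · rintro ⟨z, hz⟩
      obtain ⟨z, rfl⟩ := Submodule.mkQ_surjective _ z
      rw [← hz]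
      exact (Submodule.Quotient.mk_eq_zero U).mpr z.2

lemma length_quotient_ne_top_of_le {U V : Ideal R} (h : V ≤ U)
    (hV : Module.length R (R ⧸ V) ≠ ⊤) : Module.length R (R ⧸ U) ≠ ⊤ := by
  rw [length_quotient_eq_add h] at hV
  exact fun h => hV (by simp [h])

lemma length_submoduleOf_eq {U V : Ideal R} (h : V ≤ U) (hV : Module.length R (R ⧸ V) ≠ ⊤) :
    Module.length R (U ⧸ V.submoduleOf U) ≠ ⊤ ∧
      ((Module.length R (U ⧸ V.submoduleOf U)).toNat : ℤ) = colength V - colength U := by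
  have h1 := length_quotient_eq_add h
  have hU := length_quotient_ne_top_of_le h hV
  have h2 : Module.length R (U ⧸ V.submoduleOf U) ≠ ⊤ := fun h2 => hV (by rw [h1, h2]; simp)
  refine ⟨h2, ?_⟩
  simp only [colength]
  rw [h1, ENat.toNat_add h2 hU]
  push_cast; ring

lemma colength_anti {U V : Ideal R} (h : V ≤ U) (hV : Module.length R (R ⧸ V) ≠ ⊤) :
    colength U ≤ colength V := by
  have := (length_submoduleOf_eq h hV).2
  omega

lemma colength_eq_imp_eq {U V : Ideal R} (h : V ≤ U) (hV : Module.length R (R ⧸ V) ≠ ⊤)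
    (heq : colength U = colength V) : U = V := by
  obtain ⟨h1, h2⟩ := length_submoduleOf_eq h hV
  rw [heq, sub_self] at h2
  have h3 : Module.length R (U ⧸ V.submoduleOf U) = 0 := by
    have h4 : (Module.length R (U ⧸ V.submoduleOf U)).toNat = 0 := by exact_mod_cast h2
    exact ((ENat.toNat_eq_zero).mp h4).resolve_right h1
  rw [Module.length_eq_zero_iff, Submodule.Quotient.subsingleton_iff] at h3
  refine le_antisymm (fun y hy => ?_) h
  have : (⟨y, hy⟩ : U) ∈ V.submoduleOf U := by rw [h3]; trivial
  exact this

/-- Multiplication by `x`, as a map between subquotients of `R`. -/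
noncomputable def mulSubquotient {U U' W V : Ideal R} (x : R) (hUW : ∀ u ∈ U, x * u ∈ W)
    (hUV : ∀ u ∈ U', x * u ∈ V) : (U ⧸ U'.submoduleOf U) →ₗ[R] (W ⧸ V.submoduleOf W) :=
  Submodule.mapQ _ _ ((LinearMap.lsmul R R x).restrict hUW) fun u hu => hUV u hu

lemma mulSubquotient_injective {U U' W V : Ideal R} {x : R} (hUW : ∀ u ∈ U, x * u ∈ W)
    (hUV : ∀ u ∈ U', x * u ∈ V) (hinj : ∀ u ∈ U, x * u ∈ V → u ∈ U') :
    Function.Injective (mulSubquotient x hUW hUV) := by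
  rw [← LinearMap.ker_eq_bot, LinearMap.ker_eq_bot']
  intro y hy
  obtain ⟨y, rfl⟩ := Submodule.mkQ_surjective _ y
  have h1 : x * (y : R) ∈ V := (Submodule.Quotient.mk_eq_zero (V.submoduleOf W)).mp hy
  have h2 : (y : R) ∈ U' := hinj _ y.2 h1
  exact (Submodule.Quotient.mk_eq_zero _).mpr h2

/-- If multiplication by `x` embeds `U / U'` into `W / V`, then the length of the former is at
most that of the latter. -/
lemma colength_sub_le_of_mul {U U' W V : Ideal R} (x : R) (hU : U' ≤ U) (hW : V ≤ W)
    (hU' : Module.length R (R ⧸ U') ≠ ⊤) (hV : Module.length R (R ⧸ V) ≠ ⊤)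
    (hUW : ∀ u ∈ U, x * u ∈ W) (hUV : ∀ u ∈ U', x * u ∈ V)
    (hinj : ∀ u ∈ U, x * u ∈ V → u ∈ U') :
    colength U' - colength U ≤ colength V - colength W := by
  obtain ⟨h1, h2⟩ := length_submoduleOf_eq hU hU'
  obtain ⟨h3, h4⟩ := length_submoduleOf_eq hW hV
  rw [← h2, ← h4]
  exact_mod_cast ENat.toNat_le_toNat
    (Module.length_le_of_injective _ (mulSubquotient_injective hUW hUV hinj)) h3

/-- Multiplication by `x` induces an isomorphism `U / (U ∩ (V : x)) ≅ (V + x U) / V`. -/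
lemma colength_sub_eq_of_mul {U U' W V : Ideal R} (x : R)
    (hU' : Module.length R (R ⧸ U') ≠ ⊤) (hV : Module.length R (R ⧸ V) ≠ ⊤)
    (hU'iff : ∀ u, u ∈ U' ↔ u ∈ U ∧ x * u ∈ V) (hW : ∀ w, w ∈ W ↔ ∃ v ∈ V, ∃ u ∈ U, w = v + x * u) :
    colength U' - colength U = colength V - colength W := by
  have hU : U' ≤ U := fun u hu => ((hU'iff u).mp hu).1
  have hVW : V ≤ W := fun v hv => (hW v).mpr ⟨v, hv, 0, U.zero_mem, by simp⟩
  have hUW : ∀ u ∈ U, x * u ∈ W := fun u hu => (hW _).mpr ⟨0, V.zero_mem, u, hu, by simp⟩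
  have hUV : ∀ u ∈ U', x * u ∈ V := fun u hu => ((hU'iff u).mp hu).2
  obtain ⟨h1, h2⟩ := length_submoduleOf_eq hU hU'
  obtain ⟨h3, h4⟩ := length_submoduleOf_eq hVW hV
  rw [← h2, ← h4]
  have hinj := mulSubquotient_injective hUW hUV fun u h1 h2 => (hU'iff u).mpr ⟨h1, h2⟩
  have hsurj : Function.Surjective (mulSubquotient x hUW hUV) := by
    intro y
    obtain ⟨⟨y, hy⟩, rfl⟩ := Submodule.mkQ_surjective _ y
    obtain ⟨v, hv, u, hu, rfl⟩ := (hW y).mp hy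
    refine ⟨Submodule.mkQ _ ⟨u, hu⟩, ?_⟩
    have h5 : x * u - (v + x * u) ∈ V := by
      rw [show x * u - (v + x * u) = -v by ring]
      exact V.neg_mem hv
    exact (Submodule.Quotient.eq (V.submoduleOf W)).mpr h5
  rw [LinearEquiv.length_eq (LinearEquiv.ofBijective _ ⟨hinj, hsurj⟩)]

end Colength

/-! ### The Hilbert–Serre theorem for pairs of graded families of ideals -/

section Hilbert

variable {R : Type u} [CommRing R]

/-- The pair of families `V ≤ U` of ideals, regarded as the graded module `⨁ U n / V n` over a
polynomial ring whose variables act as the elements of `xs` raising the degree by one, satisfies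
the following finiteness condition: each graded submodule `⨁ W n / V n` is generated in bounded
degrees. -/
def IsNoetherianPair (xs : List R) (U V : ℕ → Ideal R) : Prop :=
  ∀ W : ℕ → Ideal R, (∀ n, V n ≤ W n) → (∀ n, W n ≤ U n) →
    (∀ x ∈ xs, ∀ n, ∀ w ∈ W n, x * w ∈ W (n + 1)) →
    ∀ᶠ n in atTop, W (n + 1) ≤ V (n + 1) ⊔ Ideal.span {x | x ∈ xs} * W n

lemma mem_colonPart {U V : ℕ → Ideal R} {x : R} {n : ℕ} {u : R} :
    u ∈ U n ⊓ (V (n + 1)).colon {x} ↔ u ∈ U n ∧ x * u ∈ V (n + 1) := by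
  simp [Submodule.mem_colon_singleton, mul_comm]

/-- Hilbert–Serre: the Hilbert function of a graded module generated over a polynomial ring in `r`
variables is eventually a polynomial of degree `< r`. The proof compares kernel and cokernel of
the last variable. -/
theorem IsNoetherianPair.evPoly {xs : List R} {U V : ℕ → Ideal R} (hN : IsNoetherianPair xs U V)
    (hVU : ∀ n, V n ≤ U n) (hfin : ∀ n, Module.length R (R ⧸ V n) ≠ ⊤)
    (hU : ∀ x ∈ xs, ∀ n, ∀ w ∈ U n, x * w ∈ U (n + 1))
    (hV : ∀ x ∈ xs, ∀ n, ∀ w ∈ V n, x * w ∈ V (n + 1)) :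
    EvPoly xs.length fun n => colength (V n) - colength (U n) := by
  induction xs generalizing U V with
  | nil =>
    have h := hN U hVU (fun _ => le_rfl) hU
    have h' : ∀ᶠ n in atTop, colength (V (n + 1)) - colength (U (n + 1)) = 0 := by
      filter_upwards [h] with n hn
      have : U (n + 1) = V (n + 1) := by
        refine le_antisymm ?_ (hVU _)
        simpa using hn
      rw [this, sub_self]
    exact EvPoly.of_shift (k := 0) 1 h'
  | cons x xs ih =>
    -- the kernel and the cokernel of multiplication by `x`
    set U' : ℕ → Ideal R := fun n => U n ⊓ (V (n + 1)).colon {x} with hU'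
    set V'' : ℕ → Ideal R := fun n => match n with
      | 0 => V 0
      | n + 1 => V (n + 1) ⊔ Ideal.span {x} * U n with hV''
    have hxU : ∀ n, ∀ w ∈ U n, x * w ∈ U (n + 1) := hU x (by simp)
    have hxV : ∀ n, ∀ w ∈ V n, x * w ∈ V (n + 1) := hV x (by simp)
    have hUxs : ∀ y ∈ xs, ∀ n, ∀ w ∈ U n, y * w ∈ U (n + 1) := fun y hy => hU y (by simp [hy])
    have hVxs : ∀ y ∈ xs, ∀ n, ∀ w ∈ V n, y * w ∈ V (n + 1) := fun y hy => hV y (by simp [hy])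
    have hspan : Ideal.span {y | y ∈ x :: xs} = Ideal.span {x} ⊔ Ideal.span {y | y ∈ xs} := by
      rw [← Ideal.span_union]; congr 1; ext y; simp
    have hVV'' : ∀ n, V n ≤ V'' n := by
      intro n
      cases n with
      | zero => exact le_rfl
      | succ n => exact le_sup_left
    have hVU' : ∀ n, V n ≤ U' n := fun n v hv => mem_colonPart.mpr ⟨hVU n hv, hxV n v hv⟩
    have memV'' : ∀ n w, w ∈ V'' (n + 1) ↔ ∃ v ∈ V (n + 1), ∃ u ∈ U n, w = v + x * u := by
      intro n w
      simp only [hV'', Submodule.mem_sup, Ideal.mem_span_singleton_mul]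
      constructor
      · rintro ⟨v, hv, _, ⟨u, hu, rfl⟩, rfl⟩
        exact ⟨v, hv, u, hu, rfl⟩
      · rintro ⟨v, hv, u, hu, rfl⟩
        exact ⟨v, hv, _, ⟨u, hu, rfl⟩, rfl⟩
    have h1 : EvPoly xs.length fun n => colength (V n) - colength (U' n) := by
      refine ih ?_ hVU' hfin ?_ hVxs
      · intro W hVW hWU' hW
        refine (hN W hVW (fun n => (hWU' n).trans inf_le_left) ?_).mono fun n hn => ?_
        · intro y hy n w hw
          rcases List.mem_cons.mp hy with rfl | hy
          · exact hVW _ (mem_colonPart.mp (hWU' n hw)).2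
          · exact hW y hy n w hw
        · refine hn.trans ?_
          rw [hspan, Ideal.sup_mul, ← sup_assoc]
          refine sup_le_sup_right (sup_le le_rfl ?_) _
          rw [Ideal.span_singleton_mul_le_iff]
          exact fun w hw => (mem_colonPart.mp (hWU' n hw)).2
      · intro y hy n w hw
        obtain ⟨hw1, hw2⟩ := mem_colonPart.mp hw
        refine mem_colonPart.mpr ⟨hUxs y hy n w hw1, ?_⟩
        rw [mul_left_comm]
        exact hVxs y hy _ _ hw2
    have h2 : EvPoly xs.length fun n => colength (V'' n) - colength (U n) := by
      refine ih ?_ ?_ (fun n => length_quotient_ne_top_of_le (hVV'' n) (hfin n)) hUxs ?_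
      · intro W hVW hWU hW
        have hWx : ∀ n, ∀ w ∈ W n, x * w ∈ V'' (n + 1) := fun n w hw =>
          (memV'' n _).mpr ⟨0, (V (n + 1)).zero_mem, w, hWU n hw, by simp⟩
        refine (hN W (fun n => (hVV'' n).trans (hVW n)) hWU ?_).mono fun n hn => ?_
        · intro y hy n w hw
          rcases List.mem_cons.mp hy with rfl | hy
          · exact hVW _ (hWx n w hw)
          · exact hW y hy n w hw
        · refine hn.trans ?_
          rw [hspan, Ideal.sup_mul, ← sup_assoc]
          refine sup_le_sup_right (sup_le (hVV'' _) ?_) _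
          rw [Ideal.span_singleton_mul_le_iff]
          exact fun w hw => hWx n w hw
      · intro n
        cases n with
        | zero => exact hVU 0
        | succ n =>
          intro w hw
          obtain ⟨v, hv, u, hu, rfl⟩ := (memV'' n w).mp hw
          exact add_mem (hVU _ hv) (hxU n u hu)
      · intro y hy n w hw
        cases n with
        | zero => exact hVV'' _ (hVxs y hy 0 w hw)
        | succ n =>
          obtain ⟨v, hv, u, hu, rfl⟩ := (memV'' n w).mp hw
          refine (memV'' _ _).mpr ⟨y * v, hVxs y hy _ _ hv, y * u, hUxs y hy _ _ hu, by ring⟩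
    have h3 : ∀ n, colength (U' n) - colength (U n) =
        colength (V (n + 1)) - colength (V'' (n + 1)) := fun n =>
      colength_sub_eq_of_mul x (length_quotient_ne_top_of_le (hVU' n) (hfin n)) (hfin _)
        (fun u => mem_colonPart) (memV'' n)
    have h4 := (h2.shift 1).sub h1
    refine EvPoly.congr (k := xs.length) h4 (Eventually.of_forall fun n => ?_)
    have := h3 n
    simp only
    linarith

end Hilbert

/-! ### Hilbert functions in local rings -/

section Local

variable {R : Type u} [CommRing R] [IsNoetherianRing R]

/-- If `U` lies in a stable `J`-filtration and `U (n + 1) ≤ V n`, then each intermediate family `W` is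
itself a `J`-filtration, stable by the Artin–Rees lemma. -/
lemma isNoetherianPair_of_stable {J : Ideal R} {F : J.Filtration R} (hF : F.Stable) {xs : List R}
    (hxs : Ideal.span {x | x ∈ xs} = J) {U V : ℕ → Ideal R} (hUF : ∀ n, U n ≤ F.N n)
    (hUV : ∀ n, U (n + 1) ≤ V n) : IsNoetherianPair xs U V := by
  intro W hVW hWU hW
  let G : J.Filtration R :=
    { N := W
      mono := fun i => (hWU _).trans ((hUV i).trans (hVW i))
      smul_le := fun i => by
        rw [← hxs, smul_eq_mul, Ideal.mul_le]
        intro r hr s hs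
        have : Ideal.span {x | x ∈ xs} ≤ (W (i + 1)).colon {s} :=
          Ideal.span_le.mpr fun x hx => Submodule.mem_colon_singleton.mpr (hW x hx i s hs)
        exact Submodule.mem_colon_singleton.mp (this hr) }
  have hG : G.Stable := hF.of_le fun n => (hWU n).trans (hUF n)
  obtain ⟨n₀, hn₀⟩ := hG
  filter_upwards [eventually_ge_atTop n₀] with n hn
  refine le_trans (le_of_eq ?_) le_sup_right
  rw [hxs]
  exact (hn₀ n hn).symm

lemma exists_list_span (J : Ideal R) : ∃ xs : List R, Ideal.span {x | x ∈ xs} = J := by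
  obtain ⟨s, hs⟩ := (IsNoetherian.noetherian J : J.FG)
  exact ⟨s.toList, by simpa using hs⟩

variable [IsLocalRing R]

lemma length_quotient_ne_top_of_pow_le {J : Ideal R} {n : ℕ} (h : maximalIdeal R ^ n ≤ J) :
    Module.length R (R ⧸ J) ≠ ⊤ := by
  have h1 : IsArtinianRing (R ⧸ J) := by
    by_cases hJ : J = ⊤
    · have : Subsingleton (R ⧸ J) := Ideal.Quotient.subsingleton_iff.mpr hJ
      infer_instance
    have : Nontrivial (R ⧸ J) := Ideal.Quotient.nontrivial_iff.mpr hJ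
    have := IsLocalRing.of_surjective' (Ideal.Quotient.mk J) Ideal.Quotient.mk_surjective
    have := IsLocalHom.of_surjective (Ideal.Quotient.mk J) Ideal.Quotient.mk_surjective
    have hmap : (maximalIdeal R).map (Ideal.Quotient.mk J) = maximalIdeal (R ⧸ J) := by
      ext x
      obtain ⟨x, rfl⟩ := Ideal.Quotient.mk_surjective x
      simp [sup_eq_left.mpr (le_maximalIdeal hJ)]
    refine (isArtinianRing_iff_isNilpotent_maximalIdeal (R ⧸ J)).mpr ⟨n, ?_⟩
    rw [← hmap, ← Ideal.map_pow, Ideal.zero_eq_bot, Ideal.map_eq_bot_iff_le_ker, Ideal.mk_ker]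
    exact h
  rw [Module.length_eq_of_surjective (R := R ⧸ J) Ideal.Quotient.mk_surjective]
  exact Module.length_ne_top

/-- In a local ring of dimension `d`, the length of `R ⧸ 𝔪 ^ n` is `O(n ^ d)`: this is clear for
the powers of an ideal generated by a system of parameters, which contain powers of `𝔪`. -/
lemma exists_colength_pow_le {d : ℕ} (hd : ringKrullDim R = d) :
    ∃ C : ℝ, ∀ᶠ n : ℕ in atTop,
      ((colength (maximalIdeal R ^ n) : ℤ) : ℝ) ≤ C * (n : ℝ) ^ d := by
  obtain ⟨s, hs, hcard⟩ := (maximalIdeal R).exists_finset_card_eq_height_of_isNoetherianRing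
  have hcard' : s.card = d := by
    have := maximalIdeal_height_eq_ringKrullDim (R := R)
    rw [hd, ← hcard] at this
    exact_mod_cast this
  set J : Ideal R := Ideal.span (s : Set R) with hJ
  have hrad : maximalIdeal R ≤ J.radical := by
    rw [Ideal.radical_eq_sInf]
    refine le_sInf fun P hP => ?_
    exact hs.2 ⟨hP.2, hP.1⟩ (le_maximalIdeal hP.2.ne_top)
  obtain ⟨N, hN⟩ := Ideal.exists_pow_le_of_le_radical_of_fg hrad (IsNoetherian.noetherian _)
  have hfin : ∀ n, Module.length R (R ⧸ J ^ n) ≠ ⊤ := fun n =>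
    length_quotient_ne_top_of_pow_le (n := N * n) (by
      rw [pow_mul]; exact Ideal.pow_right_mono hN n)
  have hspan : Ideal.span {x | x ∈ s.toList} = J := by simp [hJ]
  have hmem : ∀ x ∈ s.toList, x ∈ J := fun x hx => Ideal.subset_span (by simpa using hx)
  have hpair : IsNoetherianPair s.toList (fun n => J ^ n) (fun n => J ^ (n + 1)) :=
    isNoetherianPair_of_stable (F := J.stableFiltration ⊤) (J.stableFiltration_stable ⊤) hspan
      (fun n => by simp) (fun n => le_rfl)
  have h1 := hpair.evPoly (fun n => Ideal.pow_le_pow_right n.le_succ) (fun n => hfin _)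
    (fun x hx n w hw => by rw [pow_succ']; exact Ideal.mul_mem_mul (hmem x hx) hw)
    (fun x hx n w hw => by rw [pow_succ']; exact Ideal.mul_mem_mul (hmem x hx) hw)
  have h2 : EvPoly (d + 1) fun n => colength (J ^ n) := by
    have h3 := EvPoly.sum_range h1
    rw [Finset.length_toList, hcard'] at h3
    refine EvPoly.congr h3 (Eventually.of_forall fun n => ?_)
    rw [Finset.sum_range_sub (fun n => colength (J ^ n)) n]
    simp [colength_top]
  obtain ⟨C, hC⟩ := h2.exists_le_pow
  refine ⟨C, ?_⟩
  filter_upwards [hC] with n hn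
  refine le_trans ?_ hn
  have hJm : J ≤ maximalIdeal R := hs.1.2
  exact_mod_cast colength_anti (Ideal.pow_right_mono hJm n) (hfin n)

end Local

/-! ### Filtrations defined by finitely many valuations -/

section Exp

lemma mul_le_exp_add {x y : ℤᵐ⁰} {p q : ℤ} (hx : x ≤ WithZero.exp p) (hy : y ≤ WithZero.exp q) :
    x * y ≤ WithZero.exp (p + q) := by
  rw [WithZero.exp_add]
  exact mul_le_mul' hx hy

lemma le_exp_sub_of_mul_le {x y : ℤᵐ⁰} {p q : ℤ} (hx : x = WithZero.exp p)
    (h : x * y ≤ WithZero.exp q) : y ≤ WithZero.exp (q - p) := by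
  have h1 := mul_le_exp_add (x := WithZero.exp (-p)) le_rfl h
  rw [hx, ← mul_assoc, ← WithZero.exp_add, neg_add_cancel, WithZero.exp_zero, one_mul] at h1
  rwa [show q - p = -p + q by ring]

lemma pow_le_exp_mul {x : ℤᵐ⁰} {p : ℤ} (n : ℕ) (hx : x ≤ WithZero.exp p) :
    x ^ n ≤ WithZero.exp (n * p) := by
  have := pow_le_pow_left' hx n
  rwa [← WithZero.exp_nsmul, nsmul_eq_mul] at this

lemma pow_eq_exp_mul {x : ℤᵐ⁰} {p : ℤ} (n : ℕ) (hx : x = WithZero.exp p) :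
    x ^ n = WithZero.exp (n * p) := by
  rw [hx, ← WithZero.exp_nsmul, nsmul_eq_mul]

end Exp

/-- The `J`-adic filtration shifted by `B`. -/
def shiftedFiltration {R : Type u} [CommRing R] (J : Ideal R) (B : ℕ) : J.Filtration R where
  N n := J ^ (n - B)
  mono n := Ideal.pow_le_pow_right (by omega)
  smul_le n := by
    rw [smul_eq_mul, ← pow_succ']
    exact Ideal.pow_le_pow_right (by omega)

lemma shiftedFiltration_stable {R : Type u} [CommRing R] (J : Ideal R) (B : ℕ) :
    (shiftedFiltration J B).Stable := by
  refine ⟨B, fun n hn => ?_⟩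
  change J • J ^ (n - B) = J ^ (n + 1 - B)
  rw [smul_eq_mul, ← pow_succ', show n - B + 1 = n + 1 - B by omega]

/-- Finitely many valuations `w i` with weights `a i` on a local ring `R`, such that the filtration
by the ideals `{r | ∀ i, w i r ≤ exp (-(n * a i))}` lies between the `𝔪`-adic filtration and a
shift of it. In degree `s`, the excess of an element of the `s`-th step at `w i` is the difference
between its value and the forced value `s * a i`; the last two conditions say that each `w i` is
normalized and can be told from the others by the excess. -/
structure ValuativeFiltration (R : Type u) [CommRing R] [IsLocalRing R] (ι : Type*) where
  /-- the valuations -/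
  w : ι → Valuation R ℤᵐ⁰
  /-- the weights -/
  a : ι → ℕ
  /-- the shift -/
  B : ℕ
  a_pos : ∀ i, 0 < a i
  ne_zero : ∀ i {r}, r ≠ 0 → w i r ≠ 0
  of_mem_pow : ∀ (n : ℕ), ∀ r ∈ maximalIdeal R ^ n, ∀ i, w i r ≤ WithZero.exp (-(n * a i : ℤ))
  mem_pow : ∀ (n : ℕ) (r : R), (∀ i, w i r ≤ WithZero.exp (-(((n + B : ℕ) : ℤ) * a i))) →
    r ∈ maximalIdeal R ^ n
  /-- a form of some degree `s` has the least possible positive excess at `w i` -/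
  exists_uniformizer : ∀ i, ∃ (s : ℕ) (r : R), w i r = WithZero.exp (-(s * a i : ℤ) - 1) ∧
    ∀ k, w k r ≤ WithZero.exp (-(s * a k : ℤ))
  /-- a form of some degree `s` has excess zero at `w i` and positive excess elsewhere -/
  exists_separating : ∀ i, ∃ (s : ℕ) (r : R), w i r = WithZero.exp (-(s * a i : ℤ)) ∧
    ∀ k ≠ i, w k r ≤ WithZero.exp (-(s * a k : ℤ) - 1)

namespace ValuativeFiltration

variable {R : Type u} [CommRing R] [IsLocalRing R] {ι : Type*} (D : ValuativeFiltration R ι)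

lemma w_le_one (i : ι) (r : R) : D.w i r ≤ 1 := by
  have := D.of_mem_pow 0 r (by simp) i
  simpa using this

/-- The ideal of elements whose value at `w k` is at least `n * a k - c k`, for all `k`. -/
def ideal (n : ℕ) (c : ι → ℕ) : Ideal R where
  carrier := {r | ∀ k, D.w k r ≤ WithZero.exp (-(n * D.a k : ℤ) + c k)}
  zero_mem' := fun k => by simp
  add_mem' := fun {x y} hx hy k => (D.w k).map_add_le (hx k) (hy k)
  smul_mem' := fun s r hr k => by
    have h := mul_le_mul' (D.w_le_one k s) (hr k)
    rwa [one_mul, ← map_mul] at h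

lemma mem_ideal {n : ℕ} {c : ι → ℕ} {r : R} :
    r ∈ D.ideal n c ↔ ∀ k, D.w k r ≤ WithZero.exp (-(n * D.a k : ℤ) + c k) := Iff.rfl

lemma mem_ideal_zero {n : ℕ} {r : R} :
    r ∈ D.ideal n 0 ↔ ∀ k, D.w k r ≤ WithZero.exp (-(n * D.a k : ℤ)) := by
  simp [mem_ideal]

/-- The elements of the `n`-th step of the filtration whose value at `w i` exceeds `n * a i`. -/
def specialIdeal (i : ι) (n : ℕ) : Ideal R where
  carrier := {r | r ∈ D.ideal n 0 ∧ D.w i r ≤ WithZero.exp (-(n * D.a i : ℤ) - 1)}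
  zero_mem' := ⟨zero_mem _, by simp⟩
  add_mem' := fun {x y} hx hy => ⟨add_mem hx.1 hy.1, (D.w i).map_add_le hx.2 hy.2⟩
  smul_mem' := fun s r hr => ⟨Ideal.mul_mem_left _ s hr.1, by
    have h := mul_le_mul' (D.w_le_one i s) hr.2
    rwa [one_mul, ← map_mul] at h⟩

lemma mem_specialIdeal {i : ι} {n : ℕ} {r : R} :
    r ∈ D.specialIdeal i n ↔
      r ∈ D.ideal n 0 ∧ D.w i r ≤ WithZero.exp (-(n * D.a i : ℤ) - 1) := Iff.rfl

lemma ideal_mono {n : ℕ} {c c' : ι → ℕ} (h : c ≤ c') : D.ideal n c ≤ D.ideal n c' := by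
  intro r hr k
  refine (hr k).trans (WithZero.exp_le_exp.mpr ?_)
  have : c k ≤ c' k := h k
  omega

lemma pow_le_ideal (n : ℕ) (c : ι → ℕ) : maximalIdeal R ^ n ≤ D.ideal n c :=
  fun r hr => D.ideal_mono (fun _ => Nat.zero_le _) (D.mem_ideal_zero.mpr (D.of_mem_pow n r hr))

lemma specialIdeal_le (i : ι) (n : ℕ) : D.specialIdeal i n ≤ D.ideal n 0 := fun _ hr => hr.1

lemma ideal_succ_le_specialIdeal (i : ι) (n : ℕ) : D.ideal (n + 1) 0 ≤ D.specialIdeal i n := by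
  intro r hr
  rw [mem_ideal_zero] at hr
  have key : ∀ k, ((n + 1 : ℕ) : ℤ) * D.a k ≥ n * D.a k + 1 := by
    intro k
    have := D.a_pos k
    push_cast
    nlinarith
  refine ⟨D.mem_ideal_zero.mpr fun k => (hr k).trans (WithZero.exp_le_exp.mpr ?_),
    (hr i).trans (WithZero.exp_le_exp.mpr ?_)⟩
  · linarith [key k]
  · linarith [key i]

lemma ideal_zero_zero : D.ideal 0 0 = ⊤ := by
  rw [eq_top_iff]
  intro r _
  rw [mem_ideal_zero]
  intro k
  simpa using D.w_le_one k r

/-- Elements with prescribed value at `w i` and large values at the other valuations, up to the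
values forced by the degree `s`. -/
lemma exists_approx [Fintype ι] (i : ι) (l : ℤ) (c : ℕ) : ∃ (s : ℕ) (r : R),
    D.w i r = WithZero.exp (-(s * D.a i : ℤ) - l) ∧
      ∀ k ≠ i, D.w k r ≤ WithZero.exp (-(s * D.a k : ℤ) - c) := by
  obtain ⟨t, y, hy, hyk⟩ := D.exists_uniformizer i
  obtain ⟨q, z, hz, hzk⟩ := D.exists_separating i
  -- `y ^ e * z ^ N` is regarded in a degree larger by `b` than the natural one
  set b : ℕ := l.natAbs with hb
  have he : 0 ≤ l + b * D.a i := by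
    have h1 : (1 : ℤ) ≤ D.a i := by exact_mod_cast D.a_pos i
    have h2 : -l ≤ (b : ℤ) := by omega
    nlinarith [Int.natCast_nonneg b]
  obtain ⟨e, he'⟩ := Int.eq_ofNat_of_zero_le he
  set N : ℕ := c + b * ∑ k, D.a k with hN
  refine ⟨t * e + N * q + b, y ^ e * z ^ N, ?_, fun k hk => ?_⟩
  · rw [map_mul, map_pow, map_pow, pow_eq_exp_mul e hy, pow_eq_exp_mul N hz, ← WithZero.exp_add]
    congr 1
    push_cast
    linear_combination he'
  · rw [map_mul, map_pow, map_pow]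
    refine (mul_le_exp_add (pow_le_exp_mul e (hyk k)) (pow_le_exp_mul N (hzk k hk))).trans ?_
    rw [WithZero.exp_le_exp]
    have h1 : D.a k ≤ ∑ k, D.a k := Finset.single_le_sum (fun _ _ => Nat.zero_le _) (Finset.mem_univ k)
    have h2 : (c : ℤ) + b * D.a k ≤ N := by
      rw [hN]; push_cast
      have : (D.a k : ℤ) ≤ ∑ k, (D.a k : ℤ) := by exact_mod_cast h1
      nlinarith [Int.natCast_nonneg b]
    push_cast
    linarith

lemma ideal_le_pow (n : ℕ) : D.ideal (n + D.B) 0 ≤ maximalIdeal R ^ n :=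
  fun r hr => D.mem_pow n r (D.mem_ideal_zero.mp hr)

lemma mul_mem_ideal {x : R} (hx : x ∈ maximalIdeal R) {n : ℕ} {c : ι → ℕ} {r : R}
    (hr : r ∈ D.ideal n c) : x * r ∈ D.ideal (n + 1) c := by
  intro k
  have h1 := D.of_mem_pow 1 x (by simpa using hx) k
  rw [map_mul]
  refine (mul_le_exp_add h1 (hr k)).trans (le_of_eq ?_)
  congr 1; push_cast; ring

variable [IsNoetherianRing R]

lemma length_ideal_ne_top (n : ℕ) (c : ι → ℕ) : Module.length R (R ⧸ D.ideal n c) ≠ ⊤ :=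
  length_quotient_ne_top_of_pow_le (D.pow_le_ideal n c)

lemma length_specialIdeal_ne_top (i : ι) (n : ℕ) :
    Module.length R (R ⧸ D.specialIdeal i n) ≠ ⊤ :=
  length_quotient_ne_top_of_le (D.ideal_succ_le_specialIdeal i n) (D.length_ideal_ne_top _ _)

/-- The Hilbert function of the domain, a quotient of the associated graded ring of the filtration,
that belongs to `w i`: the length of the `n`-th step modulo the elements of positive excess. -/
noncomputable def hilbertFun (i : ι) (n : ℕ) : ℤ :=
  colength (D.specialIdeal i n) - colength (D.ideal n 0)

lemma hilbertFun_nonneg (i : ι) (n : ℕ) : 0 ≤ D.hilbertFun i n :=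
  sub_nonneg.mpr (colength_anti (D.specialIdeal_le i n) (D.length_specialIdeal_ne_top i n))

/-- The Hilbert function belonging to `w i` is eventually a polynomial of degree less than the
dimension of `R`, since its sums are bounded by the length of `R ⧸ 𝔪 ^ n`. -/
lemma evPoly_hilbertFun {d : ℕ} (hd : ringKrullDim R = d) (i : ι) :
    EvPoly d (D.hilbertFun i) := by
  obtain ⟨xs, hxs⟩ := exists_list_span (maximalIdeal R)
  have hmem : ∀ x ∈ xs, x ∈ maximalIdeal R := fun x hx => by
    rw [← hxs]; exact Ideal.subset_span hx
  have hpair : IsNoetherianPair xs (fun n => D.ideal n 0) (D.specialIdeal i) := by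
    refine isNoetherianPair_of_stable (shiftedFiltration_stable (maximalIdeal R) D.B) hxs
      (fun n => ?_) (D.ideal_succ_le_specialIdeal i)
    change D.ideal n 0 ≤ maximalIdeal R ^ (n - D.B)
    rcases Nat.lt_or_ge n D.B with h | h
    · rw [Nat.sub_eq_zero_of_le h.le, pow_zero, Ideal.one_eq_top]; exact le_top
    · obtain ⟨k, rfl⟩ := Nat.exists_eq_add_of_le' h
      rw [Nat.add_sub_cancel]
      exact D.ideal_le_pow k
  have h1 : EvPoly xs.length (D.hilbertFun i) :=
    hpair.evPoly (D.specialIdeal_le i) (D.length_specialIdeal_ne_top i)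
      (fun x hx n r hr => D.mul_mem_ideal (hmem x hx) hr)
      (fun x hx n r hr => ⟨D.mul_mem_ideal (hmem x hx) hr.1, by
        have h1 := D.of_mem_pow 1 x (by simpa using hmem x hx) i
        rw [map_mul]
        refine (mul_le_exp_add h1 hr.2).trans (le_of_eq ?_)
        congr 1; push_cast; ring⟩)
  -- the sums of the Hilbert function are bounded by the colengths of the powers of `𝔪`
  obtain ⟨C, hC⟩ := exists_colength_pow_le hd
  have h2 : ∀ n, ∑ j ∈ Finset.range n, D.hilbertFun i j ≤ colength (maximalIdeal R ^ n) := by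
    intro n
    calc ∑ j ∈ Finset.range n, D.hilbertFun i j
        ≤ ∑ j ∈ Finset.range n, (colength (D.ideal (j + 1) 0) - colength (D.ideal j 0)) := by
          refine Finset.sum_le_sum fun j _ => sub_le_sub_right ?_ _
          exact colength_anti (D.ideal_succ_le_specialIdeal i j) (D.length_ideal_ne_top _ _)
      _ = colength (D.ideal n 0) := by
          rw [Finset.sum_range_sub (fun j => colength (D.ideal j 0)), ideal_zero_zero,
            colength_top, sub_zero]
      _ ≤ colength (maximalIdeal R ^ n) :=
          colength_anti (D.pow_le_ideal n 0) (length_quotient_ne_top_of_pow_le le_rfl)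
  have h3 : EvPoly (d + 1) fun n => ∑ j ∈ Finset.range n, D.hilbertFun i j := by
    refine h1.sum_range.of_le_pow
      (Eventually.of_forall fun n => Finset.sum_nonneg fun j _ => D.hilbertFun_nonneg i j)
      (C := C) ?_
    filter_upwards [hC] with n hn
    exact le_trans (by exact_mod_cast h2 n) hn
  exact EvPoly.congr (k := d) h3 (Eventually.of_forall fun n => by
    simp only [Finset.sum_range_succ]; ring)

end ValuativeFiltration

namespace ValuativeFiltration

variable {R : Type u} [CommRing R] [IsLocalRing R] {ι : Type*} (D : ValuativeFiltration R ι)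

lemma mem_ideal_add_single [DecidableEq ι] {n : ℕ} {c : ι → ℕ} {i : ι} {r : R} :
    r ∈ D.ideal n (c + Pi.single i 1) ↔
      D.w i r ≤ WithZero.exp (-(n * D.a i : ℤ) + c i + 1) ∧
        ∀ k ≠ i, D.w k r ≤ WithZero.exp (-(n * D.a k : ℤ) + c k) := by
  rw [mem_ideal]
  constructor
  · intro h
    refine ⟨by simpa [add_assoc] using h i, fun k hk => by simpa [Pi.single_eq_of_ne hk] using h k⟩
  · rintro ⟨h1, h2⟩ k
    rcases eq_or_ne k i with rfl | hk
    · simpa [add_assoc] using h1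
    · simpa [Pi.single_eq_of_ne hk] using h2 k hk

variable [IsNoetherianRing R]

/-- The degree of `w i`: the normalized leading coefficient of its Hilbert function. -/
lemma exists_degree {d : ℕ} (hd : ringKrullDim R = (d + 1 : ℕ)) (i : ι)
    (hpos : ¬ EvPoly d (D.hilbertFun i)) :
    ∃ δ : ℤ, 1 ≤ δ ∧ Tendsto (fun n : ℕ => ((D.hilbertFun i n : ℤ) : ℝ) / (n : ℝ) ^ d) atTop
      (𝓝 ((δ : ℝ) / d !)) := by
  obtain ⟨δ, h1, h2⟩ := (D.evPoly_hilbertFun hd i).exists_tendsto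
  refine ⟨δ, ?_, h1⟩
  have h3 : (0 : ℝ) ≤ (δ : ℝ) / d ! := by
    refine ge_of_tendsto h1 (Eventually.of_forall fun n => ?_)
    have : (0 : ℝ) ≤ D.hilbertFun i n := by exact_mod_cast D.hilbertFun_nonneg i n
    positivity
  have h4 : (0 : ℝ) < d ! := by exact_mod_cast Nat.factorial_pos d
  have h5 : (0 : ℝ) ≤ δ := by
    rw [le_div_iff₀ h4] at h3
    simpa using h3
  have h6 : 0 ≤ δ := by exact_mod_cast h5
  have h7 : δ ≠ 0 := fun h => hpos (h2 h)
  omega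

variable [Fintype ι] [DecidableEq ι]

/-- The graded module of the quotients of `D.ideal n (c + Pi.single i 1)` by `D.ideal n c` has rank
one over the graded ring whose Hilbert function is `D.hilbertFun i`: each of the two embeds into a
shift of the other, so their Hilbert functions have the same leading term. -/
lemma tendsto_colength_step {d : ℕ} {i : ι} {L : ℝ}
    (hL : Tendsto (fun n : ℕ => ((D.hilbertFun i n : ℤ) : ℝ) / (n : ℝ) ^ d) atTop (𝓝 L))
    (c : ι → ℕ) :
    Tendsto (fun n : ℕ => ((colength (D.ideal n c) - colength (D.ideal n (c + Pi.single i 1)) : ℤ)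
      : ℝ) / (n : ℝ) ^ d) atTop (𝓝 L) := by
  set g : ℕ → ℤ := fun n => colength (D.ideal n c) - colength (D.ideal n (c + Pi.single i 1))
    with hg
  have hmono : ∀ n, D.ideal n c ≤ D.ideal n (c + Pi.single i 1) := fun n =>
    D.ideal_mono (le_add_of_nonneg_right (by simp))
  obtain ⟨s, u, hu, huk⟩ := D.exists_approx i (-(c i : ℤ) - 1) 0
  obtain ⟨t, v, hv, hvk⟩ := D.exists_approx i ((c i : ℤ) + 1) (∑ k, c k)
  -- multiplication by `u` sends `D.ideal n 0` to `D.ideal (n + s) (c + Pi.single i 1)`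
  have h1 : ∀ n, D.hilbertFun i n ≤ g (n + s) := by
    intro n
    refine colength_sub_le_of_mul u (D.specialIdeal_le i n) (hmono _)
      (D.length_specialIdeal_ne_top i n) (D.length_ideal_ne_top _ _) ?_ ?_ ?_
    · intro r hr
      rw [mem_ideal_zero] at hr
      refine (D.mem_ideal_add_single).mpr ⟨?_, fun k hk => ?_⟩
      · rw [map_mul]
        refine (mul_le_exp_add hu.le (hr i)).trans (WithZero.exp_le_exp.mpr ?_)
        push_cast; linarith
      · rw [map_mul]
        refine (mul_le_exp_add (huk k hk) (hr k)).trans (WithZero.exp_le_exp.mpr ?_)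
        push_cast; linarith [Int.natCast_nonneg (c k)]
    · intro r hr k
      obtain ⟨hr0, hri⟩ := hr
      rw [mem_ideal_zero] at hr0
      rw [map_mul]
      rcases eq_or_ne k i with rfl | hk
      · refine (mul_le_exp_add hu.le hri).trans (WithZero.exp_le_exp.mpr ?_)
        push_cast; linarith
      · refine (mul_le_exp_add (huk k hk) (hr0 k)).trans (WithZero.exp_le_exp.mpr ?_)
        push_cast; linarith [Int.natCast_nonneg (c k)]
    · intro r hr hur
      refine ⟨hr, ?_⟩
      have h := hur i
      rw [map_mul] at h
      refine (le_exp_sub_of_mul_le hu h).trans (WithZero.exp_le_exp.mpr ?_)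
      push_cast; linarith
  -- multiplication by `v` sends `D.ideal n (c + Pi.single i 1)` to `D.ideal (n + t) 0`
  have h2 : ∀ n, g n ≤ D.hilbertFun i (n + t) := by
    intro n
    have hck : ∀ k, (c k : ℤ) ≤ ((∑ k, c k : ℕ) : ℤ) := fun k => by
      exact_mod_cast Finset.single_le_sum (fun _ _ => Nat.zero_le _) (Finset.mem_univ k)
    have hU : ∀ r ∈ D.ideal n (c + Pi.single i 1), v * r ∈ D.ideal (n + t) 0 := by
      intro r hr
      obtain ⟨hri, hrk⟩ := (D.mem_ideal_add_single).mp hr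
      rw [mem_ideal_zero]
      intro k
      rw [map_mul]
      rcases eq_or_ne k i with rfl | hk
      · refine (mul_le_exp_add hv.le hri).trans (WithZero.exp_le_exp.mpr ?_)
        push_cast; linarith
      · refine (mul_le_exp_add (hvk k hk) (hrk k hk)).trans (WithZero.exp_le_exp.mpr ?_)
        have := hck k
        push_cast at this ⊢; linarith
    refine colength_sub_le_of_mul v (hmono _) (D.specialIdeal_le i _) (D.length_ideal_ne_top _ _)
      (D.length_specialIdeal_ne_top i _) hU ?_ ?_
    · intro r hr
      refine ⟨hU r (hmono n hr), ?_⟩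
      rw [map_mul]
      refine (mul_le_exp_add hv.le (hr i)).trans (WithZero.exp_le_exp.mpr ?_)
      push_cast; linarith
    · rintro r hr ⟨-, hvr⟩ k
      rcases eq_or_ne k i with rfl | hk
      · rw [map_mul] at hvr
        refine (le_exp_sub_of_mul_le hv hvr).trans (WithZero.exp_le_exp.mpr ?_)
        push_cast; linarith
      · exact ((D.mem_ideal_add_single).mp hr).2 k hk
  refine tendsto_of_shift_div_pow (g := fun n => (g n : ℝ)) s ?_
  refine tendsto_of_tendsto_of_tendsto_of_le_of_le hL
    (tendsto_shift_div_pow (g := fun n => (D.hilbertFun i n : ℝ)) (s + t) hL) ?_ ?_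
  · intro n
    have : (D.hilbertFun i n : ℝ) ≤ g (n + s) := by exact_mod_cast h1 n
    simp only
    gcongr
  · intro n
    have : (g (n + s) : ℝ) ≤ D.hilbertFun i (n + (s + t)) := by
      rw [← add_assoc]; exact_mod_cast h2 (n + s)
    simp only
    gcongr

/-- Lowering the value required at `w i` by `c i`, for all `i`, changes the colength asymptotically by
the sum of the `c i`, weighted by the degrees. -/
lemma tendsto_colength_sub {d : ℕ} {δ : ι → ℤ}
    (hδ : ∀ i, Tendsto (fun n : ℕ => ((D.hilbertFun i n : ℤ) : ℝ) / (n : ℝ) ^ d) atTop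
      (𝓝 ((δ i : ℝ) / d !))) (c : ι → ℕ) :
    Tendsto (fun n : ℕ => ((colength (D.ideal n 0) - colength (D.ideal n c) : ℤ) : ℝ) /
      (n : ℝ) ^ d) atTop (𝓝 ((∑ i, (δ i : ℝ) * c i) / d !)) := by
  -- raise the components of `c` from zero, one unit at a time
  have key : ∀ s : Multiset ι,
      Tendsto (fun n : ℕ => ((colength (D.ideal n 0) -
        colength (D.ideal n fun k => s.count k) : ℤ) : ℝ) / (n : ℝ) ^ d) atTop
        (𝓝 ((∑ i, (δ i : ℝ) * s.count i) / d !)) := by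
    intro s
    induction s using Multiset.induction_on with
    | empty =>
      have : (fun k : ι => (0 : Multiset ι).count k) = 0 := by ext; simp
      simp only [this]
      simp
    | cons j s ih =>
      have hc : (fun k : ι => (j ::ₘ s).count k) = (fun k => s.count k) + Pi.single j 1 := by
        ext k
        rw [Pi.add_apply, Multiset.count_cons, Pi.single_apply]
      have h := ih.add (D.tendsto_colength_step (hδ j) fun k => s.count k)
      rw [← hc, ← add_div] at h
      have hs : ∑ i, (δ i : ℝ) * (j ::ₘ s).count i = ∑ i, (δ i : ℝ) * s.count i + δ j := by
        have : ∀ i, (δ i : ℝ) * (j ::ₘ s).count i =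
            δ i * s.count i + if i = j then (δ i : ℝ) else 0 := by
          intro i
          rw [Multiset.count_cons]
          split_ifs <;> push_cast <;> ring
        simp [this, Finset.sum_add_distrib]
      rw [hs]
      refine h.congr fun n => ?_
      rw [← add_div]
      push_cast
      ring
  have h := key (Finsupp.toMultiset (Finsupp.equivFunOnFinite.symm c))
  simpa [Finsupp.count_toMultiset] using h

/-- The asymptotic length of `R ⧸ (f, 𝔪 ^ n)`. Multiplication by `f` identifies the quotient of `R`
by `D.ideal n c`, where `c` collects the values of `f`, with the quotient of `(f) + D.ideal n 0` by
`D.ideal n 0`. -/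
theorem tendsto_colength_span_sup {d : ℕ} {δ : ι → ℤ}
    (hδ : ∀ i, Tendsto (fun n : ℕ => ((D.hilbertFun i n : ℤ) : ℝ) / (n : ℝ) ^ d) atTop
      (𝓝 ((δ i : ℝ) / d !))) {f : R} {c : ι → ℕ}
    (hf : ∀ i, D.w i f = WithZero.exp (-(c i : ℤ))) :
    Tendsto (fun n : ℕ => ((colength (Ideal.span {f} ⊔ maximalIdeal R ^ n) : ℤ) : ℝ) /
      (n : ℝ) ^ d) atTop (𝓝 ((∑ i, (δ i : ℝ) * c i) / d !)) := by
  have h1 : ∀ n, colength (Ideal.span {f} ⊔ D.ideal n 0) =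
      colength (D.ideal n 0) - colength (D.ideal n c) := by
    intro n
    have := colength_sub_eq_of_mul (U := ⊤) (U' := D.ideal n c) (V := D.ideal n 0)
      (W := Ideal.span {f} ⊔ D.ideal n 0) f (D.length_ideal_ne_top _ _) (D.length_ideal_ne_top _ _)
      (fun r => by
        rw [mem_ideal_zero, mem_ideal]
        simp only [Submodule.mem_top, true_and, map_mul]
        refine forall_congr' fun k => ⟨fun h => ?_, fun h => ?_⟩
        · refine (mul_le_exp_add (hf k).le h).trans (WithZero.exp_le_exp.mpr ?_)
          linarith
        · refine (le_exp_sub_of_mul_le (hf k) h).trans (WithZero.exp_le_exp.mpr ?_)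
          linarith)
      (fun r => by
        rw [sup_comm, Submodule.mem_sup]
        simp only [Ideal.mem_span_singleton']
        constructor
        · rintro ⟨v, hv, _, ⟨u, rfl⟩, rfl⟩
          exact ⟨v, hv, u, trivial, by ring⟩
        · rintro ⟨v, hv, u, -, rfl⟩
          exact ⟨v, hv, _, ⟨u, rfl⟩, by ring⟩)
    rw [colength_top] at this
    linarith
  have h2 := D.tendsto_colength_sub hδ c
  simp only [← h1] at h2
  refine tendsto_of_tendsto_of_tendsto_of_le_of_le h2
    (tendsto_shift_div_pow (g := fun n => (colength (Ideal.span {f} ⊔ D.ideal n 0) : ℝ)) D.B h2)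
    ?_ ?_
  · intro n
    have : (colength (Ideal.span {f} ⊔ D.ideal n 0) : ℝ) ≤
        colength (Ideal.span {f} ⊔ maximalIdeal R ^ n) := by
      exact_mod_cast colength_anti (sup_le_sup_left (D.pow_le_ideal n 0) _)
        (length_quotient_ne_top_of_pow_le (n := n) le_sup_right)
    simp only
    gcongr
  · intro n
    have : (colength (Ideal.span {f} ⊔ maximalIdeal R ^ n) : ℝ) ≤
        colength (Ideal.span {f} ⊔ D.ideal (n + D.B) 0) := by
      exact_mod_cast colength_anti (sup_le_sup_left (D.ideal_le_pow n) _)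
        (length_quotient_ne_top_of_le le_sup_right (D.length_ideal_ne_top _ _))
    simp only
    gcongr

/-- The asymptotic length of `R ⧸ 𝔪 ^ n`: passing from one step of the filtration to the next
changes all values by the weights. -/
theorem tendsto_colength_pow {d : ℕ} {δ : ι → ℤ}
    (hδ : ∀ i, Tendsto (fun n : ℕ => ((D.hilbertFun i n : ℤ) : ℝ) / (n : ℝ) ^ d) atTop
      (𝓝 ((δ i : ℝ) / d !))) :
    Tendsto (fun n : ℕ => ((colength (maximalIdeal R ^ n) : ℤ) : ℝ) / (n : ℝ) ^ (d + 1)) atTop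
      (𝓝 ((∑ i, (δ i : ℝ) * D.a i) / (d + 1) !)) := by
  have h1 : ∀ n, D.ideal (n + 1) D.a = D.ideal n 0 := by
    intro n
    ext r
    rw [mem_ideal, mem_ideal_zero]
    refine forall_congr' fun k => ?_
    rw [show -(((n + 1 : ℕ) : ℤ) * D.a k) + D.a k = -(n * D.a k : ℤ) by push_cast; ring]
  have h2 := tendsto_shift_div_pow 1 (D.tendsto_colength_sub hδ D.a)
  simp only [h1] at h2
  have h3 := tendsto_sum_range_div_pow h2
  have h4 : ∀ n : ℕ, ∑ j ∈ Finset.range n, ((colength (D.ideal (j + 1) 0) -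
      colength (D.ideal j 0) : ℤ) : ℝ) = colength (D.ideal n 0) := by
    intro n
    rw [← Int.cast_sum, Finset.sum_range_sub (fun j => colength (D.ideal j 0)), ideal_zero_zero,
      colength_top, sub_zero]
  have h5 : ((d ! : ℕ) : ℝ) * ((d : ℝ) + 1) = ((d + 1) ! : ℕ) := by
    rw [Nat.factorial_succ]; push_cast; ring
  simp only [h4] at h3
  rw [div_div, h5] at h3
  refine tendsto_of_tendsto_of_tendsto_of_le_of_le h3
    (tendsto_shift_div_pow (g := fun n => (colength (D.ideal n 0) : ℝ)) D.B h3) ?_ ?_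
  · intro n
    have : (colength (D.ideal n 0) : ℝ) ≤ colength (maximalIdeal R ^ n) := by
      exact_mod_cast colength_anti (D.pow_le_ideal n 0) (length_quotient_ne_top_of_pow_le le_rfl)
    simp only
    gcongr
  · intro n
    have : (colength (maximalIdeal R ^ n) : ℝ) ≤ colength (D.ideal (n + D.B) 0) := by
      exact_mod_cast colength_anti (D.ideal_le_pow n) (D.length_ideal_ne_top _ _)
    simp only
    gcongr

end ValuativeFiltration

/-! ### Extended Rees algebras of filtrations -/

/-- A multiplicative filtration of a ring by ideals, indexed by `ℤ` and equal to the whole ring in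
degrees `≤ 0`. -/
structure IdealFiltration (R : Type u) [CommRing R] where
  /-- the members of the filtration -/
  I : ℤ → Ideal R
  eq_top : ∀ n ≤ 0, I n = ⊤
  mul_mem : ∀ {m n : ℤ} {x y : R}, x ∈ I m → y ∈ I n → x * y ∈ I (m + n)

/-- The filtration by the powers of an ideal. -/
def adicFiltration {R : Type u} [CommRing R] (J : Ideal R) : IdealFiltration R where
  I n := J ^ n.toNat
  eq_top n hn := by simp [Int.toNat_of_nonpos hn]
  mul_mem {m n x y} hx hy := by
    have h := Ideal.mul_mem_mul hx hy
    rw [← pow_add] at h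
    exact Ideal.pow_le_pow_right (show (m + n).toNat ≤ m.toNat + n.toNat by omega) h

namespace IdealFiltration

open LaurentPolynomial AddMonoidAlgebra

variable {R : Type u} [CommRing R] (F : IdealFiltration R)

/-- The extended Rees algebra `⨁ F.I n T ^ n` of a filtration, as a subalgebra of the Laurent
polynomials. -/
noncomputable def rees : Subalgebra R R[T;T⁻¹] where
  carrier := {p | ∀ n, p.coeff n ∈ F.I n}
  mul_mem' := fun {p q} hp hq n => by
    classical
    rw [AddMonoidAlgebra.coeff_mul]
    refine sum_mem fun i _ => sum_mem fun j _ => ?_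
    dsimp only
    split_ifs with h
    · rw [← h]; exact F.mul_mem (hp i) (hq j)
    · exact zero_mem _
  add_mem' := fun {p q} hp hq n => by
    rw [AddMonoidAlgebra.coeff_add]
    exact add_mem (hp n) (hq n)
  algebraMap_mem' := fun r n => by
    rw [← LaurentPolynomial.C_eq_algebraMap, LaurentPolynomial.C_apply]
    split_ifs with h
    · rw [F.eq_top n h.le]; trivial
    · exact zero_mem _

lemma mem_rees {p : R[T;T⁻¹]} : p ∈ F.rees ↔ ∀ n, p.coeff n ∈ F.I n := Iff.rfl

lemma single_mem_rees {n : ℤ} {r : R} : (single n r : R[T;T⁻¹]) ∈ F.rees ↔ r ∈ F.I n := by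
  rw [mem_rees]
  constructor
  · intro h
    have := h n
    rwa [AddMonoidAlgebra.coeff_single, Finsupp.single_eq_same] at this
  · intro h k
    rw [AddMonoidAlgebra.coeff_single, Finsupp.single_apply]
    split_ifs with hk
    · rwa [← hk]
    · exact zero_mem _

/-- The element `r T ^ n` of the extended Rees algebra. -/
noncomputable def mono (n : ℤ) (r : R) (hr : r ∈ F.I n) : F.rees :=
  ⟨single n r, F.single_mem_rees.mpr hr⟩

lemma coeff_mono_same {n : ℤ} {r : R} (hr : r ∈ F.I n) : (F.mono n r hr).1.coeff n = r := by
  rw [mono, AddMonoidAlgebra.coeff_single, Finsupp.single_eq_same]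

lemma coeff_mono_of_ne {n k : ℤ} {r : R} (hr : r ∈ F.I n) (h : k ≠ n) :
    (F.mono n r hr).1.coeff k = 0 := by
  rw [mono, AddMonoidAlgebra.coeff_single, Finsupp.single_eq_of_ne h]

/-- The component in degree `n`. -/
noncomputable def comp (n : ℤ) (p : F.rees) : F.rees := F.mono n (p.1.coeff n) (p.2 n)

lemma mono_mul_mono {m n : ℤ} {r s : R} (hr : r ∈ F.I m) (hs : s ∈ F.I n) :
    F.mono m r hr * F.mono n s hs = F.mono (m + n) (r * s) (F.mul_mem hr hs) :=
  Subtype.ext (single_mul_single _ _ _ _)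

lemma mono_add {n : ℤ} {r s : R} (hr : r ∈ F.I n) (hs : s ∈ F.I n) :
    F.mono n (r + s) (add_mem hr hs) = F.mono n r hr + F.mono n s hs :=
  Subtype.ext (single_add _ _ _)

lemma mono_zero {n : ℤ} (h : (0 : R) ∈ F.I n := zero_mem _) : F.mono n 0 h = 0 :=
  Subtype.ext (single_zero _)

lemma mono_eq_zero_iff {n : ℤ} {r : R} (hr : r ∈ F.I n) : F.mono n r hr = 0 ↔ r = 0 := by
  constructor
  · intro h
    rw [← F.coeff_mono_same hr, h]
    rfl
  · rintro rfl
    exact F.mono_zero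

/-- The element `T⁻¹` of the extended Rees algebra. -/
noncomputable def tInv : F.rees := F.mono (-1) 1 (by rw [F.eq_top _ (by norm_num)]; trivial)

lemma mem_zero (r : R) {n : ℤ} (h : n ≤ 0) : r ∈ F.I n := by
  rw [F.eq_top n h]; trivial

lemma sum_comp (p : F.rees) : ∑ n ∈ p.1.coeff.support, F.comp n p = p := by
  apply Subtype.ext
  rw [AddSubmonoidClass.coe_finsetSum]
  exact AddMonoidAlgebra.sum_coeff_single p.1

lemma tInv_mul_mono {n : ℤ} {r : R} (hr : r ∈ F.I (n + 1)) (hr' : r ∈ F.I n) :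
    F.tInv * F.mono (n + 1) r hr = F.mono n r hr' := by
  rw [tInv, mono_mul_mono]
  apply Subtype.ext
  simp [mono]

lemma anti {m n : ℤ} (h : m ≤ n) : F.I n ≤ F.I m := by
  intro r hr
  have := F.mul_mem (F.mem_zero 1 (n := m - n) (by omega)) hr
  simpa using this

/-! ### The grading -/

/-- The homogeneous component of degree `n` of the extended Rees algebra. -/
noncomputable def gradedPiece (n : ℤ) : Submodule R F.rees where
  carrier := {p | ∀ k ≠ n, p.1.coeff k = 0}
  zero_mem' := fun k _ => by simp
  add_mem' := fun {p q} hp hq k hk => by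
    change (p.1 + q.1).coeff k = 0
    rw [AddMonoidAlgebra.coeff_add, Finsupp.add_apply, hp k hk, hq k hk, add_zero]
  smul_mem' := fun r p hp k hk => by
    change (r • p.1).coeff k = 0
    rw [AddMonoidAlgebra.coeff_smul_apply, hp k hk, smul_zero]

lemma mono_mem_gradedPiece {n : ℤ} {r : R} (hr : r ∈ F.I n) : F.mono n r hr ∈ F.gradedPiece n := by
  exact fun k hk => F.coeff_mono_of_ne hr hk

lemma eq_mono_of_mem_gradedPiece {n : ℤ} {p : F.rees} (hp : p ∈ F.gradedPiece n) :
    p = F.comp n p := by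
  apply Subtype.ext
  apply LaurentPolynomial.ext
  intro k
  rcases eq_or_ne k n with rfl | hk
  · exact (F.coeff_mono_same _).symm
  · rw [hp k hk]
    exact (F.coeff_mono_of_ne _ hk).symm

instance : SetLike.GradedMonoid F.gradedPiece where
  one_mem := by
    have h : (1 : F.rees) = F.mono 0 1 (F.mem_zero 1 le_rfl) := rfl
    rw [h]
    exact F.mono_mem_gradedPiece _
  mul_mem := fun i j p q hp hq => by
    rw [F.eq_mono_of_mem_gradedPiece hp, F.eq_mono_of_mem_gradedPiece hq, comp, comp, mono_mul_mono]
    exact F.mono_mem_gradedPiece _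

lemma coeff_coeAddMonoidHom (x : DirectSum ℤ fun n => F.gradedPiece n) (n : ℤ) :
    (DirectSum.coeAddMonoidHom F.gradedPiece x).1.coeff n = (x n).1.1.coeff n := by
  induction x using DirectSum.induction_on with
  | zero => simp
  | of i y =>
    rw [DirectSum.coeAddMonoidHom_of]
    rcases eq_or_ne i n with rfl | hi
    · rw [DirectSum.of_eq_same]
    · rw [DirectSum.of_eq_of_ne _ _ _ hi.symm]
      simpa using y.2 n hi.symm
  | add x y hx hy =>
    rw [map_add, DirectSum.add_apply]
    change (_ + _ : R[T;T⁻¹]).coeff n = (_ + _ : R[T;T⁻¹]).coeff n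
    rw [AddMonoidAlgebra.coeff_add, AddMonoidAlgebra.coeff_add, Finsupp.add_apply,
      Finsupp.add_apply, hx, hy]

lemma isInternal_gradedPiece : DirectSum.IsInternal F.gradedPiece := by
  constructor
  · intro x y hxy
    ext n : 1
    apply Subtype.ext
    rw [F.eq_mono_of_mem_gradedPiece (x n).2, F.eq_mono_of_mem_gradedPiece (y n).2]
    unfold comp
    congr 1
    rw [← F.coeff_coeAddMonoidHom x n, ← F.coeff_coeAddMonoidHom y n]
    exact congrArg (fun p : F.rees => p.1.coeff n) hxy
  · intro p
    refine ⟨∑ n ∈ p.1.coeff.support,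
      DirectSum.of (fun n => F.gradedPiece n) n ⟨F.comp n p, F.mono_mem_gradedPiece _⟩, ?_⟩
    rw [map_sum]
    simp only [DirectSum.coeAddMonoidHom_of]
    exact F.sum_comp p

noncomputable instance : GradedRing F.gradedPiece where
  __ := F.isInternal_gradedPiece.chooseDecomposition

lemma decompose_eq_comp (p : F.rees) (n : ℤ) :
    (DirectSum.decompose F.gradedPiece p n : F.rees) = F.comp n p := by
  have h := F.coeff_coeAddMonoidHom (DirectSum.decompose F.gradedPiece p) n
  have h2 : DirectSum.coeAddMonoidHom F.gradedPiece (DirectSum.decompose F.gradedPiece p) = p :=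
    DirectSum.Decomposition.left_inv p
  rw [h2] at h
  rw [F.eq_mono_of_mem_gradedPiece (DirectSum.decompose F.gradedPiece p n).2]
  unfold comp
  congr 1
  exact h.symm

lemma isHomogeneous_iff {P : Ideal F.rees} :
    P.IsHomogeneous F.gradedPiece ↔ ∀ p ∈ P, ∀ n, F.comp n p ∈ P := by
  constructor
  · intro h p hp n
    rw [← decompose_eq_comp]
    exact h n hp
  · intro h n p hp
    rw [decompose_eq_comp]
    exact h p hp n

end IdealFiltration

namespace IdealFiltration

open LaurentPolynomial AddMonoidAlgebra

variable {R : Type u} [CommRing R] (F : IdealFiltration R)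

/-! ### Finiteness of extended Rees algebras -/

/-- The extended Rees algebra of an ideal `J` is `R[J T, T⁻¹]`. -/
lemma rees_adicFiltration (J : Ideal R) {s : Set R} (hs : Ideal.span s = J) :
    (adicFiltration J).rees =
      Algebra.adjoin R (insert (single (-1) 1) ((fun a => (single 1 a : R[T;T⁻¹])) '' s)) := by
  set S := Algebra.adjoin R
    (insert (single (-1) 1) ((fun a => (single 1 a : R[T;T⁻¹])) '' s)) with hS
  apply le_antisymm
  · have hsub : insert (single (-1) 1) ((fun a => (single 1 a : R[T;T⁻¹])) '' s) ⊆ (S : Set _) :=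
      Algebra.subset_adjoin
    have hone : ∀ a ∈ J, (single 1 a : R[T;T⁻¹]) ∈ S := by
      intro a ha
      rw [← hs] at ha
      refine Submodule.span_induction (fun x hx => hsub (Set.mem_insert_of_mem _ ⟨x, hx, rfl⟩)) ?_
        (fun x y _ _ hx hy => ?_) (fun r x _ hx => ?_) ha
      · rw [single_zero]; exact zero_mem S
      · rw [single_add]; exact add_mem hx hy
      · have := S.smul_mem hx r
        rwa [smul_single] at this
    have hpow : ∀ (k : ℕ), ∀ a ∈ J ^ k, (single (k : ℤ) a : R[T;T⁻¹]) ∈ S := by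
      intro k
      induction k with
      | zero => intro a _; exact S.algebraMap_mem a
      | succ k ih =>
        intro a ha
        rw [pow_succ] at ha
        refine Submodule.mul_induction_on ha (fun x hx y hy => ?_) (fun x y hx hy => ?_)
        · have := S.mul_mem (ih x hx) (hone y hy)
          rw [single_mul_single] at this
          exact_mod_cast this
        · rw [single_add]; exact add_mem hx hy
    have hneg : ∀ (k : ℕ) (a : R), (single (-(k : ℤ)) a : R[T;T⁻¹]) ∈ S := by
      intro k
      induction k with
      | zero => intro a; exact S.algebraMap_mem a
      | succ k ih =>
        intro a
        have := S.mul_mem (ih a) (hsub (Set.mem_insert _ _))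
        rw [single_mul_single, mul_one] at this
        rwa [show -((k + 1 : ℕ) : ℤ) = -(k : ℤ) + -1 by push_cast; ring]
    intro p hp
    rw [← AddMonoidAlgebra.sum_coeff_single p]
    refine Subalgebra.sum_mem _ fun n _ => ?_
    have hn := hp n
    rcases le_or_gt 0 n with h | h
    · obtain ⟨k, rfl⟩ := Int.eq_ofNat_of_zero_le h
      exact hpow k _ hn
    · obtain ⟨k, hk⟩ := Int.eq_ofNat_of_zero_le (show 0 ≤ -n by omega)
      rw [show n = -(k : ℤ) by omega]
      exact hneg k _
  · refine Algebra.adjoin_le ?_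
    rintro _ (rfl | ⟨a, ha, rfl⟩)
    · exact (single_mem_rees _).mpr (mem_zero _ _ (by norm_num))
    · refine (single_mem_rees _).mpr ?_
      change a ∈ J ^ (1 : ℤ).toNat
      rw [Int.toNat_one, pow_one, ← hs]
      exact Ideal.subset_span ha

lemma rees_adicFiltration_fg [IsNoetherianRing R] (J : Ideal R) : (adicFiltration J).rees.FG := by
  obtain ⟨s, hs⟩ := (IsNoetherian.noetherian J : J.FG)
  rw [rees_adicFiltration J hs, Subalgebra.fg_def]
  exact ⟨_, (s.finite_toSet.image _).insert _, rfl⟩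

/-- The filtration `F` lies between the `J`-adic filtration and a shift of it. -/
structure IsCommensurable (J : Ideal R) (B : ℕ) : Prop where
  pow_le : ∀ n : ℕ, J ^ n ≤ F.I n
  le_pow : ∀ n : ℕ, F.I (n + B : ℕ) ≤ J ^ n

variable {F} {J : Ideal R} {B : ℕ}

lemma IsCommensurable.rees_le (h : F.IsCommensurable J B) : (adicFiltration J).rees ≤ F.rees := by
  intro p hp n
  rcases le_or_gt 0 n with hn | hn
  · obtain ⟨k, rfl⟩ := Int.eq_ofNat_of_zero_le hn
    exact h.pow_le k (hp k)
  · exact F.mem_zero _ hn.le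

lemma IsCommensurable.shift_mem (h : F.IsCommensurable J B) {p : R[T;T⁻¹]} (hp : p ∈ F.rees) :
    single (-(B : ℤ)) 1 * p ∈ (adicFiltration J).rees := by
  rw [← AddMonoidAlgebra.sum_coeff_single p, Finsupp.sum, Finset.mul_sum]
  refine Subalgebra.sum_mem _ fun n _ => ?_
  rw [single_mul_single, one_mul, single_mem_rees]
  have hn := hp n
  rcases le_or_gt 0 (-(B : ℤ) + n) with hn' | hn'
  · obtain ⟨k, hk⟩ := Int.eq_ofNat_of_zero_le hn'
    rw [hk]
    rw [show n = ((k + B : ℕ) : ℤ) by push_cast; omega] at hn ⊢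
    exact h.le_pow k hn
  · exact mem_zero _ _ hn'.le

/-- The extended Rees algebra of `F` is a finite module over that of `J`, being isomorphic to a
submodule of it. -/
lemma IsCommensurable.isNoetherianRing_and_finiteType [IsNoetherianRing R]
    (h : F.IsCommensurable J B) : IsNoetherianRing F.rees ∧ Algebra.FiniteType R F.rees := by
  let S := (adicFiltration J).rees
  have hfg : Algebra.FiniteType R S := S.fg_iff_finiteType.mp (rees_adicFiltration_fg J)
  have hS : IsNoetherianRing S := Algebra.FiniteType.isNoetherianRing R S
  let _ : Algebra S F.rees := (Subalgebra.inclusion h.rees_le).toRingHom.toAlgebra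
  have hsmul : ∀ (a : S) (p : F.rees), ((a • p : F.rees) : R[T;T⁻¹]) = a.1 * p.1 := fun a p => rfl
  have : IsScalarTower R S F.rees := IsScalarTower.of_algebraMap_eq fun r => rfl
  let f : F.rees →ₗ[S] S :=
    { toFun := fun p => ⟨single (-(B : ℤ)) 1 * p.1, h.shift_mem p.2⟩
      map_add' := fun p q => Subtype.ext (mul_add _ _ _)
      map_smul' := fun a p => Subtype.ext (by
        change single (-(B : ℤ)) 1 * (a • p : F.rees).1 = a.1 * (single (-(B : ℤ)) 1 * p.1)
        rw [hsmul, mul_left_comm]) }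
  have hf : Function.Injective f := by
    intro p q hpq
    have h1 : single (-(B : ℤ)) 1 * p.1 = single (-(B : ℤ)) 1 * q.1 := congrArg Subtype.val hpq
    have h2 := congrArg (fun x => (single (B : ℤ) 1 : R[T;T⁻¹]) * x) h1
    simp only [← mul_assoc, single_mul_single, add_neg_cancel, one_mul] at h2
    refine Subtype.ext ?_
    simpa [← AddMonoidAlgebra.one_def] using h2
  have hN : IsNoetherian S F.rees := isNoetherian_of_injective f hf
  have hft : Algebra.FiniteType S F.rees := inferInstance
  exact ⟨isNoetherian_of_tower S hN, Algebra.FiniteType.trans hfg hft⟩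

end IdealFiltration

/-! ### Saturated chains of homogeneous primes and growth -/

/-- An element of finite height `n` is the end of a saturated chain of length `n` starting at the
least element. -/
lemma exists_relSeries_covBy_of_height_eq {α : Type*} [PartialOrder α] [OrderBot α] {n : ℕ} {x : α}
    (hx : Order.height x = n) :
    ∃ s : RelSeries {x : α × α | x.1 ⋖ x.2}, s.head = ⊥ ∧ s.last = x ∧ s.length = n := by
  induction n generalizing x with
  | zero =>
    rw [Nat.cast_zero, Order.height_eq_zero, isMin_iff_eq_bot] at hx
    exact ⟨RelSeries.singleton _ ⊥, rfl, hx.symm, rfl⟩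
  | succ n ih =>
    have hfin : Order.height x < ⊤ := by rw [hx]; exact ENat.natCast_lt_top _
    obtain ⟨y, hyx, hy⟩ := (Order.coe_lt_height_iff (n := n) hfin).mp (by
      rw [hx]; exact_mod_cast n.lt_succ_self)
    have hcov : y ⋖ x := by
      refine ⟨hyx, fun z hyz hzx => ?_⟩
      have h1 := Order.height_add_one_le hyz
      have h2 := Order.height_add_one_le hzx
      rw [hy] at h1
      rw [hx] at h2
      have h3 := (add_le_add_left h1 1).trans h2
      have h4 : n + 1 + 1 ≤ n + 1 := by exact_mod_cast h3
      omega
    obtain ⟨s, hs1, hs2, hs3⟩ := ih hy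
    refine ⟨s.snoc x (by rw [hs2]; exact hcov), by simpa using hs1, by simp, by simp [hs3]⟩

/-- In a Noetherian ring, a prime `P'` minimal over the sum of a smaller prime `P` and a principal
ideal covers `P`. -/
lemma covBy_of_mem_minimalPrimes_sup_span {A : Type u} [CommRing A] [IsNoetherianRing A]
    {P P' : PrimeSpectrum A} {x : A} (hlt : P < P')
    (h : P'.asIdeal ∈ (P.asIdeal ⊔ Ideal.span {x}).minimalPrimes) : P ⋖ P' := by
  refine ⟨hlt, fun P'' h1 h2 => ?_⟩
  have hht := Ideal.map_height_le_one_of_mem_minimalPrimes h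
  let f := Ideal.Quotient.mk P.asIdeal
  have hf : Function.Surjective f := Ideal.Quotient.mk_surjective
  have hker : RingHom.ker f = P.asIdeal := Ideal.mk_ker
  have hle1 : P.asIdeal ≤ P''.asIdeal := h1.le
  have hle2 : P.asIdeal ≤ P'.asIdeal := hlt.le
  have hp1 : (P''.asIdeal.map f).IsPrime := Ideal.map_isPrime_of_surjective hf (hker.trans_le hle1)
  have hp2 : (P'.asIdeal.map f).IsPrime := Ideal.map_isPrime_of_surjective hf (hker.trans_le hle2)
  have hcomap : ∀ {I : Ideal A}, P.asIdeal ≤ I → (I.map f).comap f = I := fun {I} hI => by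
    rw [Ideal.comap_map_of_surjective f hf, ← RingHom.ker_eq_comap_bot, hker, sup_eq_left.mpr hI]
  have hlt2 : P''.asIdeal.map f < P'.asIdeal.map f := by
    refine lt_of_le_of_ne (Ideal.map_mono h2.le) fun heq => h2.ne ?_
    have := congrArg (Ideal.comap f) heq
    rw [hcomap hle1, hcomap hle2] at this
    exact PrimeSpectrum.ext this
  have h3 := Ideal.height_add_one_le_of_lt_of_isPrime hlt2
  have h4 : (P''.asIdeal.map f).height = 0 := by
    have : (P''.asIdeal.map f).height + 1 ≤ 1 := h3.trans hht
    have h5 : (P''.asIdeal.map f).height + 1 ≤ 0 + 1 := by simpa using this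
    exact nonpos_iff_eq_zero.mp ((ENat.add_le_add_iff_right ENat.one_ne_top).mp h5)
  have h5 : P''.asIdeal.map f = ⊥ := Ideal.height_eq_zero_iff_eq_bot.mp h4
  have h6 := hcomap hle1
  rw [h5, ← RingHom.ker_eq_comap_bot, hker] at h6
  exact h1.ne (PrimeSpectrum.ext h6)

namespace IdealFiltration

open LaurentPolynomial AddMonoidAlgebra

variable {R : Type u} [CommRing R] (F : IdealFiltration R)

/-- The ideal of coefficients in degree `n` of the ideal `P` of the extended Rees algebra. -/
noncomputable def part (P : Ideal F.rees) (n : ℤ) : Ideal R where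
  carrier := {r | ∃ h : r ∈ F.I n, F.mono n r h ∈ P}
  zero_mem' := ⟨zero_mem _, by rw [mono_zero]; exact zero_mem _⟩
  add_mem' := fun {x y} ⟨hx, hx'⟩ ⟨hy, hy'⟩ =>
    ⟨add_mem hx hy, by rw [mono_add (hr := hx) (hs := hy)]; exact add_mem hx' hy'⟩
  smul_mem' := fun r x ⟨hx, hx'⟩ => ⟨Ideal.mul_mem_left _ _ hx, by
    have h := P.mul_mem_left (F.mono 0 r (F.mem_zero r le_rfl)) hx'
    rw [mono_mul_mono] at h
    convert h using 2
    · rw [zero_add]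
    · rfl⟩

variable {F}

lemma mem_part {P : Ideal F.rees} {n : ℤ} {r : R} :
    r ∈ F.part P n ↔ ∃ h : r ∈ F.I n, F.mono n r h ∈ P := Iff.rfl

lemma part_le (P : Ideal F.rees) (n : ℤ) : F.part P n ≤ F.I n := fun _ hr => hr.1

lemma le_part {P : Ideal F.rees} (hP : F.tInv ∈ P) (n : ℤ) : F.I (n + 1) ≤ F.part P n := by
  intro r hr
  have hr' : r ∈ F.I n := F.anti (by omega) hr
  refine ⟨hr', ?_⟩
  rw [← F.tInv_mul_mono hr hr']
  exact P.mul_mem_right _ hP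

lemma mul_mem_part {P : Ideal F.rees} {m n : ℤ} {x r : R} (hx : x ∈ F.I m) (hr : r ∈ F.part P n) :
    x * r ∈ F.part P (m + n) := by
  refine ⟨F.mul_mem hx hr.1, ?_⟩
  rw [← F.mono_mul_mono hx hr.1]
  exact P.mul_mem_left _ hr.2

end IdealFiltration

namespace IdealFiltration

open LaurentPolynomial AddMonoidAlgebra

variable {R : Type u} [CommRing R] {F : IdealFiltration R}

/-- The power comes with the membership that is needed to write it as a monomial. -/
lemma mono_pow {n : ℤ} {r : R} (hr : r ∈ F.I n) (k : ℕ) :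
    ∃ h : r ^ k ∈ F.I (k * n), F.mono n r hr ^ k = F.mono (k * n) (r ^ k) h := by
  have h : ((F.mono n r hr ^ k : F.rees) : R[T;T⁻¹]) = single (k * n) (r ^ k) := by
    rw [SubmonoidClass.coe_pow, mono, single_pow, nsmul_eq_mul]
  exact ⟨F.single_mem_rees.mp (h ▸ (F.mono n r hr ^ k).2), Subtype.ext h⟩

variable [IsLocalRing R]

/-- The coefficient in degree zero, modulo the maximal ideal. It is multiplicative because a product
of coefficients in degrees `i` and `-i` is in the maximal ideal for `i ≠ 0`. -/
noncomputable def toResidueField (F : IdealFiltration R) (hI : F.I 1 ≤ maximalIdeal R) :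
    F.rees →+* ResidueField R where
  toFun p := residue R (p.1.coeff 0)
  map_one' := by
    have h : ((1 : F.rees) : R[T;T⁻¹]).coeff 0 = 1 := F.coeff_mono_same (F.mem_zero 1 le_rfl)
    rw [h, map_one]
  map_zero' := by simp
  map_add' p q := by
    change residue R ((p.1 + q.1).coeff 0) = _
    rw [AddMonoidAlgebra.coeff_add, Finsupp.add_apply, map_add]
  map_mul' p q := by
    classical
    have hpos : ∀ (n : ℤ) (r : R), 0 < n → r ∈ F.I n → residue R r = 0 := fun n r hn hr =>
      (residue_eq_zero_iff r).mpr (hI (F.anti (by omega) hr))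
    change residue R ((p.1 * q.1).coeff 0) = _
    rw [AddMonoidAlgebra.coeff_mul, Finsupp.sum, map_sum, Finset.sum_eq_single 0]
    · rw [Finsupp.sum, map_sum, Finset.sum_eq_single 0]
      · simp
      · intro j _ hj
        simp [hj]
      · intro h
        rw [Finsupp.notMem_support_iff] at h
        simp [h]
    · intro i _ hi
      rw [Finsupp.sum, map_sum]
      refine Finset.sum_eq_zero fun j _ => ?_
      split_ifs with h
      · rw [map_mul]
        rcases lt_or_gt_of_ne hi with hi | hi
        · rw [hpos j _ (by omega) (q.2 j), mul_zero]
        · rw [hpos i _ hi (p.2 i), zero_mul]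
      · exact map_zero _
    · intro h
      rw [Finsupp.notMem_support_iff] at h
      simp [h]

/-- The homogeneous ideal of elements of the extended Rees algebra whose coefficient in degree
zero lies in the maximal ideal. -/
noncomputable def maxIdeal (F : IdealFiltration R) (hI : F.I 1 ≤ maximalIdeal R) :
    PrimeSpectrum F.rees := ⟨RingHom.ker (F.toResidueField hI), RingHom.ker_isPrime _⟩

lemma mem_maxIdeal {hI : F.I 1 ≤ maximalIdeal R} {p : F.rees} :
    p ∈ (F.maxIdeal hI).asIdeal ↔ p.1.coeff 0 ∈ maximalIdeal R :=
  (RingHom.mem_ker (f := F.toResidueField hI)).trans (residue_eq_zero_iff _)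

lemma tInv_mem_maxIdeal {hI : F.I 1 ≤ maximalIdeal R} : F.tInv ∈ (F.maxIdeal hI).asIdeal := by
  rw [mem_maxIdeal, tInv, F.coeff_mono_of_ne _ (by norm_num)]
  exact zero_mem _

lemma isHomogeneous_maxIdeal {hI : F.I 1 ≤ maximalIdeal R} :
    (F.maxIdeal hI).asIdeal.IsHomogeneous F.gradedPiece := by
  rw [isHomogeneous_iff]
  intro p hp n
  rw [mem_maxIdeal] at hp ⊢
  unfold comp
  rcases eq_or_ne n 0 with rfl | hn
  · rwa [coeff_mono_same]
  · rw [F.coeff_mono_of_ne _ hn.symm]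
    exact zero_mem _

lemma le_maxIdeal {hI : F.I 1 ≤ maximalIdeal R} {P : PrimeSpectrum F.rees}
    (hP : P.asIdeal.IsHomogeneous F.gradedPiece) : P ≤ F.maxIdeal hI := by
  intro p hp
  rw [mem_maxIdeal]
  by_contra hu
  obtain ⟨u, hu'⟩ := not_not.mp ((mem_maximalIdeal _).not.mp hu)
  have h := P.asIdeal.mul_mem_left (F.mono 0 (↑u⁻¹ : R) (F.mem_zero _ le_rfl))
    (F.isHomogeneous_iff.mp hP p hp 0)
  rw [comp, mono_mul_mono] at h
  refine P.2.ne_top ((Ideal.eq_top_iff_one _).mpr ?_)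
  convert h using 1
  apply Subtype.ext
  simp only [mono, ← hu', Units.inv_mul, zero_add]
  rfl

/-- Two homogeneous primes containing `T⁻¹` differ in a positive degree. -/
lemma exists_mem_part_notMem_part {hI : F.I 1 ≤ maximalIdeal R} (hI' : maximalIdeal R ≤ F.I 1)
    {P P' : PrimeSpectrum F.rees}
    (hP' : P'.asIdeal.IsHomogeneous F.gradedPiece) (hT : F.tInv ∈ P.asIdeal) (h : P < P') :
    ∃ (e : ℕ) (a : R), 0 < e ∧ a ∈ F.part P'.asIdeal e ∧ a ∉ F.part P.asIdeal e := by
  obtain ⟨p, hp', hp⟩ := SetLike.exists_of_lt (show P.asIdeal < P'.asIdeal from h)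
  obtain ⟨n, hn⟩ : ∃ n, F.comp n p ∉ P.asIdeal := by
    by_contra! hall
    exact hp (F.sum_comp p ▸ Ideal.sum_mem _ fun n _ => hall n)
  have hn' := F.isHomogeneous_iff.mp hP' p hp' n
  have hpos : 0 < n := by
    by_contra! hle
    have h1 : p.1.coeff n ∈ F.I (n + 1) := by
      rcases hle.lt_or_eq with hlt | rfl
      · exact F.mem_zero _ (by omega)
      · exact hI' (mem_maxIdeal.mp (le_maxIdeal (hI := hI) hP' hp'))
    refine hn ?_
    rw [comp, ← F.tInv_mul_mono h1]
    exact P.asIdeal.mul_mem_right _ hT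
  obtain ⟨e, rfl⟩ := Int.eq_ofNat_of_zero_le hpos.le
  exact ⟨e, p.1.coeff e, by exact_mod_cast hpos, ⟨_, hn'⟩, fun h => hn h.2⟩

/-! ### Hilbert functions of homogeneous primes -/

/-- The Hilbert function of the quotient of the extended Rees algebra by `P`, for a homogeneous
prime `P` containing `T⁻¹`. -/
noncomputable def hilbertFun (F : IdealFiltration R) (P : PrimeSpectrum F.rees) (n : ℕ) : ℤ :=
  colength (F.part P.asIdeal n) - colength (F.I n)

variable [IsNoetherianRing R] {B : ℕ}

lemma IsCommensurable.length_ne_top (h : F.IsCommensurable (maximalIdeal R) B) (n : ℕ) :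
    Module.length R (R ⧸ F.I n) ≠ ⊤ := length_quotient_ne_top_of_pow_le (h.pow_le n)

lemma IsCommensurable.length_part_ne_top (h : F.IsCommensurable (maximalIdeal R) B)
    {P : PrimeSpectrum F.rees} (hT : F.tInv ∈ P.asIdeal) (n : ℕ) :
    Module.length R (R ⧸ F.part P.asIdeal n) ≠ ⊤ :=
  length_quotient_ne_top_of_le (le_part hT n) (by exact_mod_cast h.length_ne_top (n + 1))

lemma IsCommensurable.hilbertFun_nonneg (h : F.IsCommensurable (maximalIdeal R) B)
    {P : PrimeSpectrum F.rees} (hT : F.tInv ∈ P.asIdeal) (n : ℕ) : 0 ≤ F.hilbertFun P n :=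
  sub_nonneg.mpr (colength_anti (part_le _ _) (h.length_part_ne_top hT n))

lemma IsCommensurable.exists_evPoly (h : F.IsCommensurable (maximalIdeal R) B)
    {P : PrimeSpectrum F.rees} (hT : F.tInv ∈ P.asIdeal) : ∃ k, EvPoly k (F.hilbertFun P) := by
  obtain ⟨xs, hxs⟩ := exists_list_span (maximalIdeal R)
  have hx : ∀ x ∈ xs, x ∈ F.I 1 := fun x hx => by
    refine h.pow_le 1 ?_
    rw [pow_one, ← hxs]
    exact Ideal.subset_span hx
  refine ⟨xs.length, IsNoetherianPair.evPoly (U := fun n => F.I n)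
    (V := fun n => F.part P.asIdeal n)
    (isNoetherianPair_of_stable (shiftedFiltration_stable (maximalIdeal R) B) hxs ?_ ?_)
    (fun n => part_le _ _) (h.length_part_ne_top hT) ?_ ?_⟩
  · intro n
    change F.I n ≤ maximalIdeal R ^ (n - B)
    rcases Nat.lt_or_ge n B with hn | hn
    · rw [Nat.sub_eq_zero_of_le hn.le, pow_zero, Ideal.one_eq_top]; exact le_top
    · obtain ⟨k, rfl⟩ := Nat.exists_eq_add_of_le' hn
      rw [Nat.add_sub_cancel]
      exact h.le_pow k
  · intro n
    exact_mod_cast le_part hT n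
  · intro x hxx n w hw
    have := F.mul_mem (hx x hxx) hw
    rwa [add_comm] at this
  · intro x hxx n w hw
    have := mul_mem_part (hx x hxx) hw
    rwa [add_comm] at this

/-- Multiplication by `a` embeds the quotient by `P` into `P' / P`. -/
lemma IsCommensurable.hilbertFun_add_le (h : F.IsCommensurable (maximalIdeal R) B)
    {P P' : PrimeSpectrum F.rees} (hT : F.tInv ∈ P.asIdeal) (hle : P ≤ P') {e : ℕ} {a : R}
    (ha' : a ∈ F.part P'.asIdeal e) (ha : a ∉ F.part P.asIdeal e) (n : ℕ) :
    F.hilbertFun P n + F.hilbertFun P' (n + e) ≤ F.hilbertFun P (n + e) := by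
  have key := colength_sub_le_of_mul (U := F.I n) (U' := F.part P.asIdeal n)
    (W := F.part P'.asIdeal (n + e : ℕ)) (V := F.part P.asIdeal (n + e : ℕ)) a (part_le _ _)
    (fun r hr => ⟨hr.1, hle hr.2⟩) (h.length_part_ne_top hT n) (h.length_part_ne_top hT _)
    (fun u hu => by
      have := mul_mem_part hu ha'
      rw [mul_comm] at this
      exact_mod_cast this)
    (fun u hu => by
      have := mul_mem_part ha'.1 hu
      rw [add_comm] at this
      exact_mod_cast this)
    (fun u hu hau => by
      refine ⟨hu, (P.2.mem_or_mem (x := F.mono e a ha'.1) ?_).resolve_left fun hc => ha ⟨_, hc⟩⟩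
      rw [mono_mul_mono]
      have h2 := hau.2
      convert h2 using 2
      push_cast
      ring)
  unfold hilbertFun
  push_cast at key ⊢
  linarith

/-- Along a strict inclusion of homogeneous primes containing `T⁻¹` the degree of the Hilbert function
drops by at least one, since the Hilbert function of the larger prime is bounded by a difference of
values of that of the smaller prime. -/
lemma IsCommensurable.evPoly_of_lt (h : F.IsCommensurable (maximalIdeal R) B)
    (hI : F.I 1 ≤ maximalIdeal R) {P P' : PrimeSpectrum F.rees}
    (hP' : P'.asIdeal.IsHomogeneous F.gradedPiece) (hT : F.tInv ∈ P.asIdeal) (hlt : P < P') {j : ℕ}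
    (hj : EvPoly (j + 1) (F.hilbertFun P)) : EvPoly j (F.hilbertFun P') := by
  have hI' : maximalIdeal R ≤ F.I 1 := by simpa using h.pow_le 1
  obtain ⟨e, a, -, ha', ha⟩ := exists_mem_part_notMem_part (hI := hI) hI' hP' hT hlt
  obtain ⟨k, hk⟩ := h.exists_evPoly (hlt.le hT)
  refine EvPoly.of_shift e (EvPoly.of_le (hk.shift e) (hj.shift_sub e)
    (Eventually.of_forall fun n => h.hilbertFun_nonneg (hlt.le hT) _)
    (Eventually.of_forall fun n => ?_))
  have := h.hilbertFun_add_le hT hlt.le ha' ha n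
  linarith

/-- A homogeneous prime below the maximal one misses all powers of some element of positive degree. -/
lemma IsCommensurable.not_evPoly_zero (h : F.IsCommensurable (maximalIdeal R) B)
    (hI : F.I 1 ≤ maximalIdeal R) {P : PrimeSpectrum F.rees} (hT : F.tInv ∈ P.asIdeal)
    (hlt : P < F.maxIdeal hI) : ¬ EvPoly 0 (F.hilbertFun P) := by
  intro h0
  have hI' : maximalIdeal R ≤ F.I 1 := by simpa using h.pow_le 1
  obtain ⟨e, a, he, ha', ha⟩ :=
    exists_mem_part_notMem_part (hI := hI) hI' isHomogeneous_maxIdeal hT hlt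
  obtain ⟨N, hN⟩ := eventually_atTop.mp (show ∀ᶠ n in atTop, F.hilbertFun P n = 0 from h0)
  have h1 := hN ((N + 1) * e) (by nlinarith)
  have h2 := colength_eq_imp_eq (part_le P.asIdeal ((N + 1) * e : ℕ)) (h.length_part_ne_top hT _)
    (sub_eq_zero.mp h1).symm
  obtain ⟨h3, h4⟩ := mono_pow ha'.1 (N + 1)
  have h5 : a ^ (N + 1) ∈ F.part P.asIdeal ((N + 1) * e : ℕ) := by
    rw [← h2]
    exact_mod_cast h3
  have h6 : F.mono e a ha'.1 ^ (N + 1) ∈ P.asIdeal := by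
    rw [h4]
    have := h5.2
    convert this using 2
    push_cast
    rfl
  exact ha ⟨ha'.1, P.2.mem_of_pow_mem _ h6⟩

/-- From every homogeneous prime `P` containing `T⁻¹`, a saturated chain of homogeneous primes
leads to the maximal homogeneous ideal; the growth of the Hilbert function of `P` is at least its
length. -/
lemma IsCommensurable.exists_relSeries (h : F.IsCommensurable (maximalIdeal R) B)
    (hI : F.I 1 ≤ maximalIdeal R) (P : PrimeSpectrum F.rees)
    (hP : P.asIdeal.IsHomogeneous F.gradedPiece) (hT : F.tInv ∈ P.asIdeal) :
    ∃ s : RelSeries {x : PrimeSpectrum F.rees × PrimeSpectrum F.rees | x.1 ⋖ x.2},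
      s.head = P ∧ s.last = F.maxIdeal hI ∧ ∀ j, EvPoly j (F.hilbertFun P) → s.length ≤ j := by
  have hN : IsNoetherianRing F.rees := h.isNoetherianRing_and_finiteType.1
  have hI' : maximalIdeal R ≤ F.I 1 := by simpa using h.pow_le 1
  induction hJ : P.asIdeal using WellFoundedGT.induction generalizing P with
  | ind J ih =>
  subst hJ
  rcases (le_maxIdeal (hI := hI) hP).eq_or_lt with heq | hlt
  · exact ⟨RelSeries.singleton _ P, rfl, heq, fun j _ => Nat.zero_le _⟩
  · obtain ⟨e, a, he, ha', ha⟩ :=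
      exists_mem_part_notMem_part (hI := hI) hI' isHomogeneous_maxIdeal hT hlt
    set x := F.mono e a ha'.1 with hx
    have hxP : x ∉ P.asIdeal := fun hc => ha ⟨_, hc⟩
    obtain ⟨Q, hQ, hQle⟩ := Ideal.exists_minimalPrimes_le
      (I := P.asIdeal ⊔ Ideal.span {x}) (J := (F.maxIdeal hI).asIdeal)
      (sup_le hlt.le ((Ideal.span_singleton_le_iff_mem _).mpr ha'.2))
    have hQp : Q.IsPrime := hQ.1.1
    have hxQ : x ∈ Q := hQ.1.2 (Ideal.mem_sup_right (Ideal.mem_span_singleton_self x))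
    have hPQ : P.asIdeal ≤ Q := le_sup_left.trans hQ.1.2
    let P' : PrimeSpectrum F.rees := ⟨Q, hQp⟩
    have hlt' : P < P' := lt_of_le_of_ne hPQ fun hc => hxP (by rw [hc]; exact hxQ)
    have hhom : Q.IsHomogeneous F.gradedPiece := by
      have hcore : (Q.homogeneousCore F.gradedPiece).toIdeal.IsPrime := hQp.homogeneousCore
      have hle := Ideal.toIdeal_homogeneousCore_le F.gradedPiece Q
      have h1 : P.asIdeal ⊔ Ideal.span {x} ≤ (Q.homogeneousCore F.gradedPiece).toIdeal := by
        refine sup_le ?_ ((Ideal.span_singleton_le_iff_mem _).mpr ?_)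
        · rw [← hP.toIdeal_homogeneousCore_eq_self]
          exact Ideal.homogeneousCore_mono _ hPQ
        · exact Ideal.mem_homogeneousCore_of_homogeneous_of_mem ⟨_, F.mono_mem_gradedPiece _⟩ hxQ
      have h2 := le_antisymm hle (hQ.2 ⟨hcore, h1⟩ hle)
      rw [← h2]
      exact (Q.homogeneousCore F.gradedPiece).isHomogeneous
    have hcov : P ⋖ P' := covBy_of_mem_minimalPrimes_sup_span hlt' hQ
    obtain ⟨s, hs1, hs2, hs3⟩ := ih Q hlt' P' hhom (hPQ hT) rfl
    refine ⟨s.cons P (by rw [hs1]; exact hcov), by simp, by simpa using hs2, fun j hj => ?_⟩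
    cases j with
    | zero => exact absurd hj (h.not_evPoly_zero hI hT hlt)
    | succ j =>
      have := hs3 j (h.evPoly_of_lt hI hhom hT hlt' hj)
      simpa using this

end IdealFiltration

namespace IdealFiltration

open LaurentPolynomial AddMonoidAlgebra

variable {R : Type u} [CommRing R]

/-! ### The height of the maximal homogeneous ideal -/

/-- The prime of the extended Rees algebra consisting of the elements with all coefficients in the
prime `p`. -/
noncomputable def coeffPrime (F : IdealFiltration R) (p : PrimeSpectrum R) :
    PrimeSpectrum F.rees :=
  ⟨RingHom.ker ((mapRingHom ℤ (Ideal.Quotient.mk p.asIdeal)).comp F.rees.val.toRingHom :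
    F.rees →+* (R ⧸ p.asIdeal)[T;T⁻¹]), RingHom.ker_isPrime _⟩

variable {F : IdealFiltration R}

lemma mem_coeffPrime {p : PrimeSpectrum R} {x : F.rees} :
    x ∈ (F.coeffPrime p).asIdeal ↔ ∀ n, x.1.coeff n ∈ p.asIdeal := by
  refine (RingHom.mem_ker (f := (mapRingHom ℤ (Ideal.Quotient.mk p.asIdeal)).comp
    F.rees.val.toRingHom)).trans ?_
  simp only [← Ideal.Quotient.eq_zero_iff_mem, ← coeff_mapRingHom]
  constructor
  · intro h n
    exact congrArg (fun z : (R ⧸ p.asIdeal)[T;T⁻¹] => z.coeff n) h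
  · intro h
    exact LaurentPolynomial.ext h

lemma coeffPrime_strictMono : StrictMono F.coeffPrime := by
  intro p q hpq
  obtain ⟨r, hr, hr'⟩ := SetLike.exists_of_lt (show p.asIdeal < q.asIdeal from hpq)
  refine lt_of_le_of_ne (fun x hx => ?_) fun heq => hr' ?_
  · rw [mem_coeffPrime] at hx ⊢
    exact fun n => hpq.le (hx n)
  · have h1 : F.mono 0 r (F.mem_zero r le_rfl) ∈ (F.coeffPrime q).asIdeal := by
      rw [mem_coeffPrime]
      intro n
      rcases eq_or_ne n 0 with rfl | hn
      · rwa [coeff_mono_same]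
      · rw [F.coeff_mono_of_ne _ hn]
        exact zero_mem _
    rw [← heq, mem_coeffPrime] at h1
    simpa [coeff_mono_same] using h1 0

variable [IsLocalRing R]

lemma coeffPrime_lt_maxIdeal (hI : F.I 1 ≤ maximalIdeal R) (p : PrimeSpectrum R) :
    F.coeffPrime p < F.maxIdeal hI := by
  refine lt_of_le_of_ne (fun x hx => ?_) fun heq => ?_
  · rw [mem_maxIdeal]
    exact le_maximalIdeal p.2.ne_top (mem_coeffPrime.mp hx 0)
  · have h1 : F.tInv ∈ (F.maxIdeal hI).asIdeal := tInv_mem_maxIdeal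
    rw [← heq, mem_coeffPrime] at h1
    have h2 := h1 (-1)
    rw [tInv, coeff_mono_same] at h2
    exact p.2.ne_top ((Ideal.eq_top_iff_one _).mpr h2)

/-- A chain of primes of `R` gives a chain of primes `coeffPrime p`, all strictly below the maximal
homogeneous ideal. -/
lemma add_one_le_height_maxIdeal (hI : F.I 1 ≤ maximalIdeal R) {d : ℕ} (hd : ringKrullDim R = d) :
    ((d + 1 : ℕ) : ℕ∞) ≤ Order.height (F.maxIdeal hI) := by
  have h1 : Order.height (closedPoint R) = d := by
    rw [← PrimeSpectrum.height_eq_orderHeight]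
    have := maximalIdeal_height_eq_ringKrullDim (R := R)
    rw [hd] at this
    exact_mod_cast this
  have h2 := Order.height_le_height_apply_of_strictMono F.coeffPrime coeffPrime_strictMono
    (closedPoint R)
  have h3 := Order.height_add_one_le (coeffPrime_lt_maxIdeal hI (closedPoint R))
  rw [h1] at h2
  push_cast
  exact (add_le_add_left h2 1).trans h3

/-- In a universally catenary local domain of dimension `d + 1`, the Hilbert function of a
homogeneous prime of height one of the extended Rees algebra has the maximal possible growth: a
saturated chain from `0` to the maximal homogeneous ideal through this prime has length at least
`d + 2`. -/
theorem IsCommensurable.not_evPoly [IsDomain R] [IsNoetherianRing R] {B : ℕ}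
    (h : F.IsCommensurable (maximalIdeal R) B) (hcat : IsUniversallyCatenaryRing R)
    (hI : F.I 1 ≤ maximalIdeal R) {d : ℕ} (hd : ringKrullDim R = (d + 1 : ℕ))
    {Q : PrimeSpectrum F.rees} (hQ : Q.asIdeal.IsHomogeneous F.gradedPiece)
    (hT : F.tInv ∈ Q.asIdeal) (hcov : ⊥ ⋖ Q) : ¬ EvPoly d (F.hilbertFun Q) := by
  intro hev
  obtain ⟨hN, hft⟩ := h.isNoetherianRing_and_finiteType
  obtain ⟨s, hs1, hs2, hs3⟩ := h.exists_relSeries hI Q hQ hT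
  have hs := hs3 d hev
  have hfin : Order.height (F.maxIdeal hI) ≠ ⊤ := by
    rw [← PrimeSpectrum.height_eq_orderHeight]
    exact Ideal.height_ne_top_of_isPrime
  obtain ⟨N, hN'⟩ := ENat.ne_top_iff_exists.mp hfin
  obtain ⟨t, ht1, ht2, ht3⟩ := exists_relSeries_covBy_of_height_eq hN'.symm
  have hle := add_one_le_height_maxIdeal hI hd
  rw [← hN'] at hle
  have hle' : d + 1 + 1 ≤ N := by exact_mod_cast hle
  have hlen := hcat F.rees (s.cons ⊥ (by rw [hs1]; exact hcov)) t (by simp [ht1])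
    (by simp [hs2, ht2])
  simp only [RelSeries.cons_length] at hlen
  omega

end IdealFiltration

/-! ### Essential valuations of Noetherian normal domains -/

/-- If the maximal ideal of a Noetherian normal local domain is the annihilator of an element
modulo a nonzero `a`, then it is principal. -/
lemma isPrincipal_maximalIdeal_of_colon {A : Type u} [CommRing A] [IsDomain A] [IsNoetherianRing A]
    [IsIntegrallyClosed A] [IsLocalRing A] {a b : A} (ha : a ≠ 0)
    (hb : ∀ y, y ∈ maximalIdeal A ↔ a ∣ y * b) : (maximalIdeal A).IsPrincipal := by
  let K := FractionRing A
  let c : K := algebraMap A K b / algebraMap A K a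
  have ha' : algebraMap A K a ≠ 0 := by simpa using ha
  let M := Submodule.map (Algebra.linearMap A K) (maximalIdeal A)
  have hab : ¬ a ∣ b := fun h => (Ideal.ne_top_iff_one _).mp (maximalIdeal.isMaximal A).ne_top
    ((hb 1).mpr (by rwa [one_mul]))
  -- multiplication by `b / a` does not preserve the maximal ideal, as `b / a` is not integral
  have hex : ∃ y ∈ maximalIdeal A, ∃ t, IsUnit t ∧ y * b = a * t := by
    by_contra! hcon
    have hstab : ∀ z ∈ M, c • z ∈ M := by
      rintro _ ⟨z, hz, rfl⟩
      obtain ⟨t, ht⟩ := (hb z).mp hz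
      refine ⟨t, (mem_maximalIdeal t).mpr (hcon z hz t · ht), ?_⟩
      rw [Algebra.linearMap_apply, Algebra.linearMap_apply, smul_eq_mul, div_mul_eq_mul_div,
        eq_div_iff ha', ← map_mul, ← map_mul, mul_comm b, ht, mul_comm]
    have hint : IsIntegral A c := by
      refine isIntegral_of_smul_mem_submodule M ?_ (Submodule.FG.map _ (IsNoetherian.noetherian _))
        c hstab
      rw [Submodule.ne_bot_iff]
      exact ⟨_, ⟨a, (hb a).mpr (dvd_mul_right a b), rfl⟩, ha'⟩
    obtain ⟨y, hy⟩ := IsIntegrallyClosed.algebraMap_eq_of_integral hint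
    refine hab ⟨y, IsFractionRing.injective A K ?_⟩
    rw [map_mul, hy, mul_div_cancel₀ _ ha']
  obtain ⟨y, hy, t, ht, hyt⟩ := hex
  refine ⟨⟨y, le_antisymm (fun z hz => ?_) ((Ideal.span_singleton_le_iff_mem _).mpr hy)⟩⟩
  obtain ⟨s, hs⟩ := (hb z).mp hz
  rw [Ideal.submodule_span_eq, Ideal.mem_span_singleton]
  have h1 : z * t = s * y := by
    have h2 : a * (z * t) = a * (s * y) := by
      linear_combination (-z) * hyt + y * hs
    exact mul_left_cancel₀ ha h2
  exact (ht.dvd_mul_right).mp (h1 ▸ dvd_mul_left y s)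

/-- `w` is a discrete valuation with center `Q` on `A` whose valuation ring is the localization of
`A` at `Q`. -/
structure IsEssentialValuation {A : Type u} [CommRing A] (Q : Ideal A) (w : Valuation A ℤᵐ⁰) :
    Prop where
  le_one : ∀ y, w y ≤ 1
  lt_one_iff : ∀ {y}, w y < 1 ↔ y ∈ Q
  ne_zero : ∀ {y}, y ≠ 0 → w y ≠ 0
  exists_uniformizer : ∃ y, w y = WithZero.exp (-1)
  exists_mul_eq : ∀ {s t}, w s ≤ w t → ∃ p q, q ∉ Q ∧ s * q = t * p

/-- In a Noetherian normal domain, the localization at an associated prime of a nonzero element is a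
discrete valuation ring, which provides an essential valuation. -/
theorem exists_isEssentialValuation {A : Type u} [CommRing A] [IsDomain A] [IsNoetherianRing A]
    [IsIntegrallyClosed A] {Q : Ideal A} [Q.IsPrime] {a b : A} (ha : a ≠ 0)
    (hb : ∀ y, y ∈ Q ↔ a ∣ y * b) : ∃ w : Valuation A ℤᵐ⁰, IsEssentialValuation Q w := by
  let S := Localization.AtPrime Q
  have hle : Q.primeCompl ≤ nonZeroDivisors A := Q.primeCompl_le_nonZeroDivisors
  have hdom : IsDomain S := IsLocalization.isDomain_localization hle
  have hN : IsNoetherianRing S := IsLocalization.isNoetherianRing Q.primeCompl S inferInstance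
  have hint : IsIntegrallyClosed S := isIntegrallyClosed_of_isLocalization S Q.primeCompl hle
  have hinj : Function.Injective (algebraMap A S) := IsLocalization.injective S hle
  have haQ : a ∈ Q := (hb a).mpr (dvd_mul_right a b)
  have hunit : ∀ q ∉ Q, IsUnit (algebraMap A S q) := fun q hq =>
    IsLocalization.map_units S (⟨q, hq⟩ : Q.primeCompl)
  have hmem : ∀ y, algebraMap A S y ∈ maximalIdeal S ↔ y ∈ Q := fun y =>
    IsLocalization.AtPrime.to_map_mem_maximal_iff S Q y
  have hfrac : ∀ z : S, ∃ p q, q ∉ Q ∧ z * algebraMap A S q = algebraMap A S p := fun z => by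
    obtain ⟨⟨p, q⟩, h⟩ := IsLocalization.surj Q.primeCompl z
    exact ⟨p, q, q.2, h⟩
  have hprinc : (maximalIdeal S).IsPrincipal := by
    refine isPrincipal_maximalIdeal_of_colon (a := algebraMap A S a) (b := algebraMap A S b)
      (fun h => ha (hinj (by rw [h, map_zero]))) fun z => ?_
    obtain ⟨p, q, hq, hz⟩ := hfrac z
    have h1 : z ∈ maximalIdeal S ↔ p ∈ Q := by
      rw [← hmem p, ← hz, Ideal.mul_unit_mem_iff_mem _ (hunit q hq)]
    rw [h1]
    constructor
    · intro hp
      obtain ⟨t, ht⟩ := (hb p).mp hp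
      rw [← (hunit q hq).dvd_mul_right]
      refine ⟨algebraMap A S t, ?_⟩
      rw [← map_mul, ← ht, map_mul, ← hz]
      ring
    · rintro ⟨t, ht⟩
      obtain ⟨p', q', hq', ht'⟩ := hfrac t
      have h2 : p * q' * b = a * (p' * q) := hinj (by
        rw [map_mul, map_mul, map_mul, map_mul, ← hz, ← ht']
        linear_combination (algebraMap A S q) * (algebraMap A S q') * ht)
      exact ((‹Q.IsPrime›).mem_or_mem ((hb (p * q')).mpr ⟨_, h2⟩)).resolve_right hq'
  have hfield : ¬ IsField S := by
    intro hf
    have h1 := (hmem a).mpr haQ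
    rw [(isField_iff_maximalIdeal_eq).mp hf, Ideal.mem_bot] at h1
    exact ha (hinj (by rw [h1, map_zero]))
  have hdvr : IsDiscreteValuationRing S := ((IsDiscreteValuationRing.TFAE S hfield).out 0 4).mpr hprinc
  let v := IsDiscreteValuationRing.maximalIdeal S
  refine ⟨v.intValuation.comap (algebraMap A S), fun y => v.intValuation_le_one _, ?_, ?_, ?_, ?_⟩
  · intro y
    rw [Valuation.comap_apply, v.intValuation_lt_one_iff_mem]
    exact hmem y
  · intro y hy
    rw [Valuation.comap_apply]
    exact v.intValuation_ne_zero _ fun h => hy (hinj (by rw [h, map_zero]))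
  · obtain ⟨z, hz⟩ := v.intValuation_exists_uniformizer
    obtain ⟨p, q, hq, hzq⟩ := hfrac z
    refine ⟨p, ?_⟩
    have h1 : v.intValuation (algebraMap A S q) = 1 := by
      rw [v.intValuation_eq_one_iff]
      exact fun h => hq ((hmem q).mp h)
    rw [Valuation.comap_apply, ← hzq, map_mul, h1, mul_one, hz]
  · intro s t hst
    rw [Valuation.comap_apply, Valuation.comap_apply] at hst
    obtain ⟨z, hz⟩ : algebraMap A S t ∣ algebraMap A S s := by
      rcases ValuationRing.dvd_total (algebraMap A S t) (algebraMap A S s) with hd | ⟨z, hz⟩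
      · exact hd
      by_cases hs : algebraMap A S s = 0
      · rw [hs]; exact dvd_zero _
      have h1 : v.intValuation z = 1 := by
        refine le_antisymm (v.intValuation_le_one z) ?_
        rw [hz, map_mul] at hst
        exact (le_mul_iff_one_le_right (zero_lt_iff.mpr (v.intValuation_ne_zero _ hs))).mp hst
      have h2 : IsUnit z := by
        by_contra hu
        exact v.intValuation_eq_one_iff.mp h1 ((mem_maximalIdeal z).mpr hu)
      rw [hz]
      exact (h2.mul_right_dvd).mpr dvd_rfl
    obtain ⟨p, q, hq, hzq⟩ := hfrac z
    refine ⟨p, q, hq, hinj ?_⟩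
    rw [map_mul, map_mul, ← hzq, hz]
    ring

namespace IsEssentialValuation

variable {A : Type u} [CommRing A] {Q : Ideal A} {w : Valuation A ℤᵐ⁰}

lemma eq_one (h : IsEssentialValuation Q w) {y : A} (hy : y ∉ Q) : w y = 1 :=
  le_antisymm (h.le_one y) (not_lt.mp fun hlt => hy (h.lt_one_iff.mp hlt))

lemma exists_eq_exp (h : IsEssentialValuation Q w) {y : A} (hy : y ≠ 0) :
    ∃ k : ℕ, w y = WithZero.exp (-(k : ℤ)) := by
  have h1 := h.le_one y
  rw [← WithZero.exp_log (h.ne_zero hy), ← WithZero.exp_zero, WithZero.exp_le_exp] at h1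
  obtain ⟨k, hk⟩ := Int.eq_ofNat_of_zero_le (show 0 ≤ -WithZero.log (w y) by omega)
  exact ⟨k, by rw [← hk, neg_neg, WithZero.exp_log (h.ne_zero hy)]⟩

lemma le_exp_neg_one (h : IsEssentialValuation Q w) {y : A} (hy : y ∈ Q) :
    w y ≤ WithZero.exp (-1) := by
  by_cases hy0 : y = 0
  · simp [hy0]
  · obtain ⟨k, hk⟩ := h.exists_eq_exp hy0
    have h1 := h.lt_one_iff.mpr hy
    rw [hk, ← WithZero.exp_zero, WithZero.exp_lt_exp] at h1
    rw [hk, WithZero.exp_le_exp]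
    omega

/-- The center of an essential valuation has height one. -/
lemma covBy [IsDomain A] {P : PrimeSpectrum A} (h : IsEssentialValuation P.asIdeal w) :
    ⊥ ⋖ P := by
  refine ⟨bot_lt_iff_ne_bot.mpr ?_, fun P' h1 h2 => ?_⟩
  · rintro rfl
    obtain ⟨y, hy⟩ := h.exists_uniformizer
    have h1 : y ∈ (⊥ : PrimeSpectrum A).asIdeal := h.lt_one_iff.mp (by
      rw [hy, ← WithZero.exp_zero, WithZero.exp_lt_exp]; norm_num)
    have h2 : y = 0 := by simpa [PrimeSpectrum.asIdeal_bot] using h1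
    rw [h2, map_zero] at hy
    exact WithZero.exp_ne_zero hy.symm
  · obtain ⟨p, hp, hp0⟩ : ∃ p ∈ P'.asIdeal, p ≠ 0 := by
      by_contra! hcon
      refine h1.ne' (PrimeSpectrum.ext ?_)
      rw [PrimeSpectrum.asIdeal_bot, eq_bot_iff]
      exact fun x hx => hcon x hx
    obtain ⟨y, hy, hy'⟩ := SetLike.exists_of_lt (show P'.asIdeal < P.asIdeal from h2)
    obtain ⟨k, hk⟩ := h.exists_eq_exp hp0
    obtain ⟨s, q, hq, hs⟩ := h.exists_mul_eq (s := y ^ k) (t := p) (by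
      rw [map_pow, hk]
      simpa using pow_le_exp_mul k (h.le_exp_neg_one hy))
    have h3 : y ^ k * q ∈ P'.asIdeal := hs ▸ P'.asIdeal.mul_mem_right _ hp
    rcases P'.2.mem_or_mem h3 with h4 | h4
    · exact hy' (P'.2.mem_of_pow_mem _ h4)
    · exact hq (h2.le h4)

end IsEssentialValuation

/-- Divisibility by `a` is detected by essential valuations at the associated primes of `a`. -/
lemma dvd_of_forall_essential {A : Type u} [CommRing A] [IsNoetherianRing A] {a : A}
    {w : Ideal A → Valuation A ℤᵐ⁰}
    (hw : ∀ Q ∈ associatedPrimesOfElement a, IsEssentialValuation Q (w Q)) {y : A}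
    (hy : ∀ Q ∈ associatedPrimesOfElement a, w Q y ≤ w Q a) : a ∣ y := by
  by_contra hcon
  have h0 : (Ideal.Quotient.mk (Ideal.span {a}) y) ≠ 0 := by
    rwa [Ne, Ideal.Quotient.eq_zero_iff_mem, Ideal.mem_span_singleton]
  obtain ⟨Q, hQ, hle⟩ := exists_le_isAssociatedPrime_of_isNoetherianRing A _ h0
  obtain ⟨p, q, hq, hpq⟩ := (hw Q hQ).exists_mul_eq (hy Q hQ)
  refine hq (hle ?_)
  rw [Submodule.mem_colon_singleton, Submodule.mem_bot]
  change Ideal.Quotient.mk (Ideal.span {a}) (q * y) = 0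
  rw [Ideal.Quotient.eq_zero_iff_mem, Ideal.mem_span_singleton]
  exact ⟨p, by rw [mul_comm, hpq]⟩

lemma mem_associatedPrimesOfElement_iff {A : Type u} [CommRing A] [IsNoetherianRing A] {a : A}
    {Q : Ideal A} : Q ∈ associatedPrimesOfElement a ↔
      Q.IsPrime ∧ ∃ b, ∀ y, y ∈ Q ↔ a ∣ y * b := by
  have key : ∀ b y : A, y ∈ Submodule.colon (⊥ : Submodule A (A ⧸ Ideal.span {a}))
      {Ideal.Quotient.mk (Ideal.span {a}) b} ↔ a ∣ y * b := fun b y => by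
    rw [Submodule.mem_colon_singleton, Submodule.mem_bot]
    change Ideal.Quotient.mk (Ideal.span {a}) (y * b) = 0 ↔ _
    rw [Ideal.Quotient.eq_zero_iff_mem, Ideal.mem_span_singleton]
  refine isAssociatedPrime_iff.trans (and_congr_right fun _ => ⟨?_, ?_⟩)
  · rintro ⟨x, hx⟩
    obtain ⟨b, rfl⟩ := Ideal.Quotient.mk_surjective x
    exact ⟨b, fun y => by rw [hx]; exact key b y⟩
  · rintro ⟨b, hb⟩
    exact ⟨Ideal.Quotient.mk _ b, Ideal.ext fun y => (hb y).trans (key b y).symm⟩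

lemma finite_associatedPrimesOfElement {A : Type u} [CommRing A] [IsNoetherianRing A] (a : A) :
    (associatedPrimesOfElement a).Finite :=
  associatedPrimes.finite A (A ⧸ Ideal.span {a})

namespace IdealFiltration

open LaurentPolynomial AddMonoidAlgebra

variable {R : Type u} [CommRing R] {F : IdealFiltration R}

/-! ### The valuative filtration of a normal extended Rees algebra -/

lemma tInv_pow_mul_mono (n : ℕ) {e : ℤ} {r : R} (hr : r ∈ F.I e) (hr' : r ∈ F.I (e - n)) :
    F.tInv ^ n * F.mono e r hr = F.mono (e - n) r hr' := by
  obtain ⟨h, hp⟩ := F.mono_pow (F.mem_zero 1 (n := -1) (by norm_num)) n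
  rw [tInv, hp, mono_mul_mono]
  apply Subtype.ext
  simp only [mono, one_pow, one_mul]
  congr 1
  ring

lemma algebraMap_eq_mono (r : R) : algebraMap R F.rees r = F.mono 0 r (F.mem_zero r le_rfl) := rfl

lemma algebraMap_eq_tInv_pow_mul (n : ℕ) {r : R} (hr : r ∈ F.I n) :
    algebraMap R F.rees r = F.tInv ^ n * F.mono n r hr := by
  rw [algebraMap_eq_mono, tInv_pow_mul_mono n hr (F.mem_zero r (by omega))]
  simp only [sub_self]

lemma coe_tInv_pow (n : ℕ) : ((F.tInv ^ n : F.rees) : R[T;T⁻¹]) = single (-(n : ℤ)) 1 := by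
  rw [SubmonoidClass.coe_pow, tInv, mono, single_pow, one_pow, nsmul_eq_mul, mul_neg_one]

lemma mem_iff_tInv_pow_dvd (n : ℕ) {r : R} :
    r ∈ F.I n ↔ F.tInv ^ n ∣ algebraMap R F.rees r := by
  refine ⟨fun hr => ⟨_, algebraMap_eq_tInv_pow_mul n hr⟩, ?_⟩
  rintro ⟨p, hp⟩
  have h1 := congrArg (fun z : F.rees => z.1.coeff 0) hp
  have h2 : (algebraMap R F.rees r).1.coeff 0 = r := F.coeff_mono_same (F.mem_zero r le_rfl)
  have h3 : (F.tInv ^ n * p).1 = single (-(n : ℤ)) (1 : R) * p.1 := by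
    rw [← coe_tInv_pow]; rfl
  have h4 : (single (-(n : ℤ)) (1 : R) * p.1).coeff 0 = p.1.coeff n := by
    rw [AddMonoidAlgebra.coeff_single_mul_eq_mul_coeff (m₂ := (n : ℤ)) (H := fun k _ => by omega),
      one_mul]
  simp only [h2, h3, h4] at h1
  rw [h1]
  exact p.2 n

lemma tInv_ne_zero [Nontrivial R] : F.tInv ≠ 0 := by
  rw [tInv, Ne, mono_eq_zero_iff]
  exact one_ne_zero

section

variable [IsLocalRing R] [IsDomain R] {hI : F.I 1 ≤ maximalIdeal R}

/-- A prime of height one containing `T⁻¹` is homogeneous. -/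
lemma isHomogeneous_of_covBy {Q : PrimeSpectrum F.rees} (hT : F.tInv ∈ Q.asIdeal) (hQ : ⊥ ⋖ Q) :
    Q.asIdeal.IsHomogeneous F.gradedPiece := by
  have hcore : (Q.asIdeal.homogeneousCore F.gradedPiece).toIdeal.IsPrime := Q.2.homogeneousCore
  have hle := Ideal.toIdeal_homogeneousCore_le F.gradedPiece Q.asIdeal
  let C : PrimeSpectrum F.rees := ⟨_, hcore⟩
  have hC : F.tInv ∈ C.asIdeal :=
    Ideal.mem_homogeneousCore_of_homogeneous_of_mem ⟨_, F.mono_mem_gradedPiece _⟩ hT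
  have h0 : C ≠ ⊥ := by
    intro hc
    rw [hc, PrimeSpectrum.asIdeal_bot, Ideal.mem_bot] at hC
    exact tInv_ne_zero hC
  have hCQ : C = Q := (hQ.eq_or_eq bot_le hle).resolve_left h0
  rw [← hCQ]
  exact (Q.asIdeal.homogeneousCore F.gradedPiece).isHomogeneous

/-- A prime of height one is not the maximal homogeneous ideal, provided that `R` is not a field. -/
lemma lt_maxIdeal_of_covBy (hR : maximalIdeal R ≠ ⊥) {Q : PrimeSpectrum F.rees}
    (hQ : ⊥ ⋖ Q) (hh : Q.asIdeal.IsHomogeneous F.gradedPiece) : Q < F.maxIdeal hI := by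
  refine lt_of_le_of_ne (le_maxIdeal hh) ?_
  rintro rfl
  refine hQ.2 (c := F.coeffPrime (closedPoint R)) ?_ (coeffPrime_lt_maxIdeal hI _)
  refine lt_of_le_of_lt bot_le (coeffPrime_strictMono (F := F) (a := ⊥) (bot_lt_iff_ne_bot.mpr ?_))
  intro h
  exact hR (by simpa [closedPoint] using congrArg PrimeSpectrum.asIdeal h)

end

/-- A homogeneous element can be moved to a degree `s ≥ 0` by multiplication with an element outside
`Q`. -/
lemma exists_mul_eq_mono [IsLocalRing R] {hI : F.I 1 ≤ maximalIdeal R}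
    (hI' : maximalIdeal R ≤ F.I 1) {Q : PrimeSpectrum F.rees}
    (hT : F.tInv ∈ Q.asIdeal) (hlt : Q < F.maxIdeal hI) {y : F.rees}
    (hy : SetLike.IsHomogeneousElem F.gradedPiece y) :
    ∃ (s : ℕ) (r : R) (hr : r ∈ F.I s), ∃ z ∉ Q.asIdeal, y * z = F.mono s r hr := by
  obtain ⟨e, a, he, ha', ha⟩ :=
    exists_mem_part_notMem_part (hI := hI) hI' isHomogeneous_maxIdeal hT hlt
  obtain ⟨n, hn⟩ := hy
  have hna : F.mono e a ha'.1 ∉ Q.asIdeal := fun hc => ha ⟨_, hc⟩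
  obtain ⟨h1, h2⟩ := mono_pow ha'.1 n.natAbs
  obtain ⟨s, hs⟩ := Int.eq_ofNat_of_zero_le (show 0 ≤ n + n.natAbs * e by
    have : (1 : ℤ) ≤ e := by exact_mod_cast he
    have : |n| ≤ |n| * e := le_mul_of_one_le_right (abs_nonneg n) this
    have := neg_abs_le n
    rw [Int.natCast_natAbs]
    linarith)
  have h3 : y * F.mono e a ha'.1 ^ n.natAbs =
      F.mono (n + n.natAbs * e) _ (F.mul_mem (y.2 n) h1) := by
    conv_lhs => rw [h2, F.eq_mono_of_mem_gradedPiece hn, comp, mono_mul_mono]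
  refine ⟨s, y.1.coeff n * a ^ n.natAbs, hs ▸ F.mul_mem (y.2 n) h1, _,
    fun hc => hna (Q.2.mem_of_pow_mem _ hc), h3.trans ?_⟩
  congr 1

lemma exists_comp_notMem {Q : Ideal F.rees} {y : F.rees} (hy : y ∉ Q) : ∃ n, F.comp n y ∉ Q := by
  by_contra! hall
  exact hy (F.sum_comp y ▸ Ideal.sum_mem _ fun n _ => hall n)

lemma tInv_mem_of_mem_associatedPrimes [IsNoetherianRing F.rees] {Q : Ideal F.rees}
    (hQ : Q ∈ associatedPrimesOfElement F.tInv) : F.tInv ∈ Q := by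
  obtain ⟨-, b, hb⟩ := mem_associatedPrimesOfElement_iff.mp hQ
  exact (hb _).mpr (dvd_mul_right _ _)

section

variable [IsDomain R] {B : ℕ}
  {w : Ideal F.rees → Valuation F.rees ℤᵐ⁰}

/-- The order of `T⁻¹` along the essential valuation `w Q`. -/
noncomputable def tInvOrder (w : Ideal F.rees → Valuation F.rees ℤᵐ⁰) (Q : Ideal F.rees) : ℕ :=
  (-WithZero.log (w Q F.tInv)).toNat

lemma val_tInv {Q : Ideal F.rees} (hw : IsEssentialValuation Q (w Q)) :
    w Q F.tInv = WithZero.exp (-(tInvOrder w Q : ℤ)) := by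
  obtain ⟨k, hk⟩ := hw.exists_eq_exp tInv_ne_zero
  rw [tInvOrder, hk, WithZero.log_exp, neg_neg, Int.toNat_natCast]

lemma tInvOrder_pos {Q : Ideal F.rees} (hw : IsEssentialValuation Q (w Q)) (hT : F.tInv ∈ Q) :
    0 < tInvOrder w Q := by
  have := hw.lt_one_iff.mpr hT
  rw [val_tInv hw, ← WithZero.exp_zero, WithZero.exp_lt_exp] at this
  omega

lemma val_algebraMap {Q : Ideal F.rees} (hw : IsEssentialValuation Q (w Q)) {s : ℕ} {r : R}
    (hr : r ∈ F.I s) : w Q (algebraMap R F.rees r) =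
      WithZero.exp (-(s * tInvOrder w Q : ℤ)) * w Q (F.mono s r hr) := by
  rw [algebraMap_eq_tInv_pow_mul s hr, map_mul, map_pow, pow_eq_exp_mul s (val_tInv hw), mul_neg]

lemma val_algebraMap_le {Q : Ideal F.rees} (hw : IsEssentialValuation Q (w Q)) {s : ℕ} {r : R}
    (hr : r ∈ F.I s) : w Q (algebraMap R F.rees r) ≤
      WithZero.exp (-(s * tInvOrder w Q : ℤ)) := by
  rw [val_algebraMap hw hr]
  exact mul_le_of_le_one_right' (hw.le_one _)

/-- The members of the filtration are described by the values at the associated primes of `T⁻¹`. -/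
lemma mem_of_forall_val_le [IsNoetherianRing F.rees]
    (hw : ∀ Q ∈ associatedPrimesOfElement F.tInv, IsEssentialValuation Q (w Q)) {s : ℕ} {r : R}
    (hr : ∀ Q ∈ associatedPrimesOfElement F.tInv, w Q (algebraMap R F.rees r) ≤
      WithZero.exp (-(s * tInvOrder w Q : ℤ))) : r ∈ F.I s := by
  rw [mem_iff_tInv_pow_dvd]
  generalize algebraMap R F.rees r = y at hr
  induction s with
  | zero => simp
  | succ s ih =>
    obtain ⟨z, rfl⟩ := ih fun Q hQ => (hr Q hQ).trans (WithZero.exp_le_exp.mpr (by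
      push_cast; nlinarith [Int.natCast_nonneg (tInvOrder w Q)]))
    rw [pow_succ]
    refine mul_dvd_mul_left _ (dvd_of_forall_essential hw fun Q hQ => ?_)
    have h := hr Q hQ
    rw [map_mul, map_pow] at h
    have h1 := le_exp_sub_of_mul_le (pow_eq_exp_mul s (val_tInv (hw Q hQ))) h
    refine h1.trans (le_of_eq ?_)
    rw [val_tInv (hw Q hQ)]
    congr 1
    push_cast
    ring

variable [IsLocalRing R] [IsNoetherianRing R]

/-- The essential valuations at the associated primes of `T⁻¹`, restricted to `R`, with the orders
of `T⁻¹` as weights. The elements required of a `ValuativeFiltration` are coefficients of homogeneous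
elements of the extended Rees algebra with suitable values, moved to degrees `≥ 0` by
`exists_mul_eq_mono`. -/
noncomputable def valuativeFiltration (h : F.IsCommensurable (maximalIdeal R) B)
    (hI : F.I 1 ≤ maximalIdeal R) (hR : maximalIdeal R ≠ ⊥)
    (hw : ∀ Q ∈ associatedPrimesOfElement F.tInv, IsEssentialValuation Q (w Q)) :
    ValuativeFiltration R (associatedPrimesOfElement F.tInv) :=
  have hN : IsNoetherianRing F.rees := h.isNoetherianRing_and_finiteType.1
  have hI' : maximalIdeal R ≤ F.I 1 := by simpa using h.pow_le 1
  have hT : ∀ Q ∈ associatedPrimesOfElement F.tInv, F.tInv ∈ Q := fun Q hQ =>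
    tInv_mem_of_mem_associatedPrimes hQ
  have hcov : ∀ Q : associatedPrimesOfElement F.tInv,
      (⊥ : PrimeSpectrum F.rees) ⋖ ⟨Q.1, Q.2.isPrime⟩ := fun Q =>
    IsEssentialValuation.covBy (P := ⟨Q.1, Q.2.isPrime⟩) (hw Q.1 Q.2)
  have hhom : ∀ Q : associatedPrimesOfElement F.tInv, Q.1.IsHomogeneous F.gradedPiece := fun Q =>
    isHomogeneous_of_covBy (Q := ⟨Q.1, Q.2.isPrime⟩) (hT Q.1 Q.2) (hcov Q)
  have hlt : ∀ Q : associatedPrimesOfElement F.tInv,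
      (⟨Q.1, Q.2.isPrime⟩ : PrimeSpectrum F.rees) < F.maxIdeal hI := fun Q =>
    lt_maxIdeal_of_covBy hR (hcov Q) (hhom Q)
  { w := fun Q => (w Q.1).comap (algebraMap R F.rees)
    a := fun Q => tInvOrder w Q.1
    B := B
    a_pos := fun Q => tInvOrder_pos (hw Q.1 Q.2) (hT Q.1 Q.2)
    ne_zero := fun Q {r} hr => (hw Q.1 Q.2).ne_zero fun h0 =>
      hr ((F.mono_eq_zero_iff (F.mem_zero r le_rfl)).mp h0)
    of_mem_pow := fun n r hr Q => val_algebraMap_le (hw Q.1 Q.2) (h.pow_le n hr)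
    mem_pow := fun n r hr => h.le_pow n (mem_of_forall_val_le hw fun Q hQ => hr ⟨Q, hQ⟩)
    exists_uniformizer := fun Q => by
      obtain ⟨y, hy⟩ := (hw Q.1 Q.2).exists_uniformizer
      have hyQ : y ∈ Q.1 := (hw Q.1 Q.2).lt_one_iff.mp (by
        rw [hy, ← WithZero.exp_zero, WithZero.exp_lt_exp]; norm_num)
      -- one of the homogeneous components of a uniformizer is a uniformizer
      obtain ⟨n, hn⟩ : ∃ n, w Q.1 (F.comp n y) = WithZero.exp (-1) := by
        by_contra! hcon
        have h1 : ∀ n, w Q.1 (F.comp n y) < WithZero.exp (-1) := fun n =>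
          lt_of_le_of_ne ((hw Q.1 Q.2).le_exp_neg_one (F.isHomogeneous_iff.mp (hhom Q) y hyQ n))
            (hcon n)
        have h2 := (w Q.1).map_sum_lt (s := y.1.coeff.support) WithZero.exp_ne_zero fun n _ => h1 n
        rw [F.sum_comp] at h2
        exact h2.ne hy
      obtain ⟨s, r, hr, z, hz, hyz⟩ := exists_mul_eq_mono hI' (hT Q.1 Q.2) (hlt Q)
        ⟨n, F.mono_mem_gradedPiece (y.2 n)⟩
      refine ⟨s, r, ?_, fun k => val_algebraMap_le (hw k.1 k.2) hr⟩
      rw [Valuation.comap_apply, val_algebraMap (hw Q.1 Q.2) hr, ← hyz, map_mul,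
        (hw Q.1 Q.2).eq_one hz, mul_one]
      change _ * w Q.1 (F.comp n y) = _
      rw [hn, ← WithZero.exp_add, sub_eq_add_neg]
    exists_separating := fun Q => by
      classical
      have hfin : Fintype (associatedPrimesOfElement F.tInv) :=
        (finite_associatedPrimesOfElement F.tInv).fintype
      have hex : ∀ k : associatedPrimesOfElement F.tInv, k ≠ Q → ∃ y : F.rees,
          SetLike.IsHomogeneousElem F.gradedPiece y ∧ y ∉ Q.1 ∧ y ∈ k.1 := by
        intro k hk
        have hle : ¬ k.1 ≤ Q.1 := fun hle => by
          have := ((hcov Q).eq_or_eq bot_le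
            (show (⟨k.1, k.2.isPrime⟩ : PrimeSpectrum F.rees) ≤ ⟨Q.1, Q.2.isPrime⟩ from hle))
          rcases this with h1 | h1
          · exact (hcov k).lt.ne' h1
          · exact hk (Subtype.ext (congrArg PrimeSpectrum.asIdeal h1))
        obtain ⟨y, hy, hy'⟩ := SetLike.not_le_iff_exists.mp hle
        obtain ⟨n, hn⟩ := exists_comp_notMem hy'
        exact ⟨_, ⟨n, F.mono_mem_gradedPiece _⟩, hn, F.isHomogeneous_iff.mp (hhom k) y hy n⟩
      choose! y hy1 hy2 hy3 using hex
      have hprod : SetLike.IsHomogeneousElem F.gradedPiece (∏ k ∈ Finset.univ.erase Q, y k) :=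
        Submonoid.prod_mem (SetLike.homogeneousSubmonoid F.gradedPiece) fun k hk =>
          hy1 k (Finset.ne_of_mem_erase hk)
      have hprodQ : ∏ k ∈ Finset.univ.erase Q, y k ∉ Q.1 := fun hc => by
        obtain ⟨k, hk, hk'⟩ := (Ideal.IsPrime.prod_mem_iff (hp := Q.2.isPrime)).mp hc
        exact hy2 k (Finset.ne_of_mem_erase hk) hk'
      obtain ⟨s, r, hr, z, hz, hyz⟩ := exists_mul_eq_mono hI' (hT Q.1 Q.2) (hlt Q) hprod
      refine ⟨s, r, ?_, fun k hk => ?_⟩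
      · rw [Valuation.comap_apply, val_algebraMap (hw Q.1 Q.2) hr, ← hyz, map_mul,
          (hw Q.1 Q.2).eq_one hz, (hw Q.1 Q.2).eq_one hprodQ, mul_one, mul_one]
      · rw [Valuation.comap_apply, val_algebraMap (hw k.1 k.2) hr, sub_eq_add_neg]
        refine mul_le_exp_add le_rfl ((hw k.1 k.2).le_exp_neg_one ?_)
        rw [← hyz]
        refine Ideal.mul_mem_right _ _ ?_
        exact Ideal.mem_of_dvd _ (Finset.dvd_prod_of_mem y
          (Finset.mem_erase.mpr ⟨hk, Finset.mem_univ k⟩)) (hy3 k hk) }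

section

variable (h : F.IsCommensurable (maximalIdeal R) B) (hI : F.I 1 ≤ maximalIdeal R)
  (hR : maximalIdeal R ≠ ⊥)
  (hw : ∀ Q ∈ associatedPrimesOfElement F.tInv, IsEssentialValuation Q (w Q))

lemma valuativeFiltration_ideal (n : ℕ) :
    (valuativeFiltration h hI hR hw).ideal n 0 = F.I n := by
  have hN : IsNoetherianRing F.rees := h.isNoetherianRing_and_finiteType.1
  ext r
  rw [ValuativeFiltration.mem_ideal_zero]
  exact ⟨fun hr => mem_of_forall_val_le hw fun Q hQ => hr ⟨Q, hQ⟩,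
    fun hr Q => val_algebraMap_le (hw Q.1 Q.2) hr⟩

/-- The two Hilbert functions attached to an associated prime of `T⁻¹` agree. -/
lemma valuativeFiltration_hilbertFun (Q : associatedPrimesOfElement F.tInv) (n : ℕ) :
    (valuativeFiltration h hI hR hw).hilbertFun Q n = F.hilbertFun ⟨Q.1, Q.2.isPrime⟩ n := by
  rw [ValuativeFiltration.hilbertFun, hilbertFun, valuativeFiltration_ideal]
  congr 2
  ext r
  rw [ValuativeFiltration.mem_specialIdeal, valuativeFiltration_ideal, mem_part]
  refine (exists_prop).symm.trans (exists_congr fun hr => ?_)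
  change w Q.1 (algebraMap R F.rees r) ≤ WithZero.exp (-(n * tInvOrder w Q.1 : ℤ) - 1) ↔ _
  rw [val_algebraMap (hw Q.1 Q.2) hr, sub_eq_add_neg, WithZero.exp_add,
    mul_le_mul_iff_right₀ (WithZero.exp_pos)]
  refine ⟨fun hle => (hw Q.1 Q.2).lt_one_iff.mp (hle.trans_lt ?_), (hw Q.1 Q.2).le_exp_neg_one⟩
  rw [← WithZero.exp_zero, WithZero.exp_lt_exp]
  norm_num

lemma valuativeFiltration_not_evPoly (hcat : IsUniversallyCatenaryRing R) {d : ℕ}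
    (hd : ringKrullDim R = (d + 1 : ℕ)) (Q : associatedPrimesOfElement F.tInv) :
    ¬ EvPoly d ((valuativeFiltration h hI hR hw).hilbertFun Q) := by
  have hN : IsNoetherianRing F.rees := h.isNoetherianRing_and_finiteType.1
  have hT := tInv_mem_of_mem_associatedPrimes Q.2
  have hcov := IsEssentialValuation.covBy (P := ⟨Q.1, Q.2.isPrime⟩) (hw Q.1 Q.2)
  rw [funext (valuativeFiltration_hilbertFun h hI hR hw Q)]
  exact h.not_evPoly hcat hI hd (isHomogeneous_of_covBy hT hcov) hT hcov

end

end

end IdealFiltration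

section

open LaurentPolynomial AddMonoidAlgebra

/-! ### Laurent polynomials as rational functions -/

section LaurentToRatFunc

variable (R : Type u) [CommRing R] (K : Type v) [Field K] [Algebra R K]

/-- The map from Laurent polynomials over `R` to rational functions over `K`. -/
noncomputable def laurentToRatFunc : R[T;T⁻¹] →ₐ[R] RatFunc K :=
  AddMonoidAlgebra.lift R (RatFunc K) ℤ
    { toFun := fun n => RatFunc.X ^ n.toAdd
      map_one' := by simp
      map_mul' := fun m n => by rw [toAdd_mul, zpow_add₀ RatFunc.X_ne_zero] }

variable {R}

lemma laurentToRatFunc_single (n : ℤ) (r : R) :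
    laurentToRatFunc R K (single n r) = RatFunc.C (algebraMap R K r) * RatFunc.X ^ n := by
  rw [laurentToRatFunc, AddMonoidAlgebra.lift_single, Algebra.smul_def]
  congr 1

lemma laurentToRatFunc_map (p : R[T;T⁻¹]) :
    laurentToRatFunc K K (mapRingHom ℤ (algebraMap R K) p) = laurentToRatFunc R K p := by
  induction p using AddMonoidAlgebra.induction_linear with
  | zero => simp
  | add p q hp hq => rw [map_add, map_add, map_add, hp, hq]
  | single n r =>
    rw [mapRingHom_single, laurentToRatFunc_single, laurentToRatFunc_single, Algebra.algebraMap_self,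
      RingHom.id_apply]

lemma laurentToRatFunc_toLaurent (f : Polynomial K) :
    laurentToRatFunc K K (Polynomial.toLaurent f) = algebraMap (Polynomial K) (RatFunc K) f := by
  induction f using Polynomial.induction_on' with
  | add p q hp hq => rw [map_add, map_add, map_add, hp, hq]
  | monomial n a =>
    rw [Polynomial.toLaurent_C_mul_T, ← LaurentPolynomial.single_eq_C_mul_T,
      laurentToRatFunc_single, ← Polynomial.C_mul_X_pow_eq_monomial, map_mul, map_pow,
      RatFunc.algebraMap_C, RatFunc.algebraMap_X, zpow_natCast]
    rfl

lemma laurentToRatFunc_injective_field : Function.Injective (laurentToRatFunc K K) := by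
  rw [injective_iff_map_eq_zero]
  intro p hp
  obtain ⟨n, f, hf⟩ := p.exists_T_pow
  have h1 := laurentToRatFunc_toLaurent K f
  rw [hf, map_mul, hp, zero_mul] at h1
  have h2 : f = 0 := (map_eq_zero_iff _ (RatFunc.algebraMap_injective K)).mp h1.symm
  rw [h2, map_zero] at hf
  exact (isUnit_T (R := K) n).mul_left_eq_zero.mp hf.symm

lemma mapRingHom_injective [FaithfulSMul R K] :
    Function.Injective (mapRingHom ℤ (algebraMap R K)) := by
  intro p q hpq
  refine LaurentPolynomial.ext fun n => FaithfulSMul.algebraMap_injective R K ?_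
  rw [← coeff_mapRingHom, ← coeff_mapRingHom, hpq]

lemma laurentToRatFunc_injective [FaithfulSMul R K] : Function.Injective (laurentToRatFunc R K) :=
  fun p q hpq => mapRingHom_injective K (laurentToRatFunc_injective_field K (by
    rw [laurentToRatFunc_map, laurentToRatFunc_map, hpq]))

/-- The Laurent polynomials over a field are integrally closed in the field of rational functions. -/
lemma exists_of_isIntegralElem_laurent {y : RatFunc K}
    (hy : (laurentToRatFunc K K : K[T;T⁻¹] →+* RatFunc K).IsIntegralElem y) :
    ∃ p, laurentToRatFunc K K p = y := by
  let _ : Algebra K[T;T⁻¹] (RatFunc K) := (laurentToRatFunc K K : K[T;T⁻¹] →+* RatFunc K).toAlgebra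
  have : IsScalarTower (Polynomial K) K[T;T⁻¹] (RatFunc K) :=
    IsScalarTower.of_algebraMap_eq fun f => (laurentToRatFunc_toLaurent K f).symm
  have hM : Submonoid.powers (Polynomial.X : Polynomial K) ≤ nonZeroDivisors (Polynomial K) :=
    powers_le_nonZeroDivisors_of_noZeroDivisors Polynomial.X_ne_zero
  have : IsFractionRing K[T;T⁻¹] (RatFunc K) :=
    IsFractionRing.isFractionRing_of_isDomain_of_isLocalization
      (Submonoid.powers (Polynomial.X : Polynomial K)) K[T;T⁻¹] (RatFunc K)
  have : IsIntegrallyClosed K[T;T⁻¹] := isIntegrallyClosed_of_isLocalization K[T;T⁻¹] _ hM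
  exact IsIntegrallyClosed.algebraMap_eq_of_integral (R := K[T;T⁻¹]) hy

end LaurentToRatFunc

/-! ### Lowest coefficients of Laurent polynomials -/

section Lowest

variable {K : Type v} [CommRing K]

lemma coeff_add_mul_of_forall_lt {p q : K[T;T⁻¹]} {m n : ℤ} (hp : ∀ k < m, p.coeff k = 0)
    (hq : ∀ k < n, q.coeff k = 0) :
    (∀ k < m + n, (p * q).coeff k = 0) ∧ (p * q).coeff (m + n) = p.coeff m * q.coeff n := by
  classical
  constructor
  · intro k hk
    rw [AddMonoidAlgebra.coeff_mul]
    refine Finset.sum_eq_zero fun i _ => Finset.sum_eq_zero fun j _ => ?_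
    dsimp only
    split_ifs with h
    · rcases lt_or_ge i m with hi | hi
      · rw [hp i hi, zero_mul]
      · rw [hq j (by omega), mul_zero]
    · rfl
  · rw [AddMonoidAlgebra.coeff_mul, Finsupp.sum, Finset.sum_eq_single m]
    · rw [Finsupp.sum, Finset.sum_eq_single n]
      · simp
      · intro j _ hj
        rw [if_neg (by omega)]
      · intro h
        rw [Finsupp.notMem_support_iff] at h
        simp [h]
    · intro i _ hi
      refine Finset.sum_eq_zero fun j _ => ?_
      dsimp only
      split_ifs with h
      · rcases lt_or_ge i m with hi' | hi'
        · rw [hp i hi', zero_mul]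
        · rw [hq j (by omega), mul_zero]
      · rfl
    · intro h
      rw [Finsupp.notMem_support_iff] at h
      simp [h]

lemma coeff_nsmul_pow_of_forall_lt {p : K[T;T⁻¹]} {m : ℤ} (hp : ∀ k < m, p.coeff k = 0) (n : ℕ) :
    (∀ k < n * m, (p ^ n).coeff k = 0) ∧ (p ^ n).coeff (n * m) = p.coeff m ^ n := by
  induction n with
  | zero =>
    constructor
    · intro k hk
      rw [pow_zero, AddMonoidAlgebra.one_def, AddMonoidAlgebra.coeff_single,
        Finsupp.single_eq_of_ne (by simpa using hk.ne)]
    · rw [pow_zero, pow_zero, AddMonoidAlgebra.one_def, AddMonoidAlgebra.coeff_single]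
      simp
  | succ n ih =>
    have h := coeff_add_mul_of_forall_lt ih.1 hp
    rw [← pow_succ, ih.2, ← pow_succ] at h
    rwa [show ((n + 1 : ℕ) : ℤ) * m = n * m + m by push_cast; ring]

lemma exists_forall_lt_coeff_eq_zero {p : K[T;T⁻¹]} (hp : p ≠ 0) :
    ∃ m, p.coeff m ≠ 0 ∧ ∀ k < m, p.coeff k = 0 := by
  have hs : p.coeff.support.Nonempty := by
    rw [Finsupp.support_nonempty_iff]
    exact fun h => hp (LaurentPolynomial.ext fun n => by rw [h]; rfl)
  refine ⟨p.coeff.support.min' hs, Finsupp.mem_support_iff.mp (Finset.min'_mem _ _), fun k hk => ?_⟩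
  by_contra hne
  exact absurd (Finset.min'_le _ _ (Finsupp.mem_support_iff.mpr hne)) (not_le.mpr hk)

end Lowest

/-! ### The normalized extended Rees algebra -/

lemma isIntegralElem_of_pow_add_sum_eq_zero {A B : Type*} [CommRing A] [CommRing B] {f : A →+* B}
    {y : B} {t : ℕ} (c : ℕ → A) (h : y ^ t + ∑ j ∈ Finset.range t, f (c j) * y ^ j = 0) :
    f.IsIntegralElem y := by
  refine ⟨Polynomial.X ^ t + ∑ j : Fin t, Polynomial.C (c j) * Polynomial.X ^ (j : ℕ),
    Polynomial.monic_X_pow_add (Polynomial.degree_sum_fin_lt _), ?_⟩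
  rw [Finset.sum_range] at h
  rw [Polynomial.eval₂_add, Polynomial.eval₂_X_pow, Polynomial.eval₂_finsetSum, ← h]
  simp only [Polynomial.eval₂_mul, Polynomial.eval₂_C, Polynomial.eval₂_X_pow]

section Normalized

variable {R : Type u} [CommRing R] (K : Type v) [Field K] [Algebra R K] (J : Ideal R)

lemma extendedReesAlgebra_eq_map :
    extendedReesAlgebra K J = (adicFiltration J).rees.map (laurentToRatFunc R K) := by
  rw [IdealFiltration.rees_adicFiltration J (Ideal.span_eq J), AlgHom.map_adjoin, Set.image_insert_eq,
    Set.image_image, extendedReesAlgebra]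
  simp only [laurentToRatFunc_single, map_one, one_mul, zpow_neg, zpow_one]

variable {K J}

lemma mem_extendedReesAlgebra {y : RatFunc K} :
    y ∈ extendedReesAlgebra K J ↔ ∃ s ∈ (adicFiltration J).rees, laurentToRatFunc R K s = y := by
  rw [extendedReesAlgebra_eq_map, Subalgebra.mem_map]

lemma mem_normalized_of_mem {y : RatFunc K} (hy : y ∈ extendedReesAlgebra K J) :
    y ∈ normalizedExtendedReesAlgebra K J :=
  (normalizedExtendedReesAlgebra K J).algebraMap_mem ⟨y, hy⟩

lemma isNoetherianRing_extendedReesAlgebra [IsNoetherianRing R] :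
    IsNoetherianRing (extendedReesAlgebra K J) := by
  rw [extendedReesAlgebra_eq_map]
  have hfg : Algebra.FiniteType R (adicFiltration J).rees :=
    (adicFiltration J).rees.fg_iff_finiteType.mp (IdealFiltration.rees_adicFiltration_fg J)
  have hS : IsNoetherianRing (adicFiltration J).rees := Algebra.FiniteType.isNoetherianRing R _
  refine isNoetherianRing_of_surjective (adicFiltration J).rees _
    (((laurentToRatFunc R K).comp (adicFiltration J).rees.val).codRestrict
      ((adicFiltration J).rees.map (laurentToRatFunc R K)) fun s => ⟨s, s.2, rfl⟩).toRingHom ?_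
  rintro ⟨_, s, hs, rfl⟩
  exact ⟨⟨s, hs⟩, rfl⟩

lemma exists_monic_of_mem_normalized {y : RatFunc K}
    (hy : y ∈ normalizedExtendedReesAlgebra K J) : ∃ (t : ℕ) (s : ℕ → R[T;T⁻¹]),
      (∀ j, s j ∈ (adicFiltration J).rees) ∧
        y ^ t + ∑ j ∈ Finset.range t, laurentToRatFunc R K (s j) * y ^ j = 0 := by
  obtain ⟨P, hP, hPy⟩ := hy
  have hc : ∀ j, ∃ s ∈ (adicFiltration J).rees, laurentToRatFunc R K s = (P.coeff j : RatFunc K) :=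
    fun j => mem_extendedReesAlgebra.mp (P.coeff j).2
  choose s hs hs' using hc
  refine ⟨P.natDegree, s, hs, ?_⟩
  rw [Polynomial.eval₂_eq_sum_range, Finset.sum_range_succ, hP.coeff_natDegree, map_one, one_mul,
    add_comm] at hPy
  simp only [hs']
  exact hPy

/-- Elements of the normalized extended Rees algebra are Laurent polynomials over `K`. -/
lemma exists_laurent_of_mem_normalized {y : RatFunc K}
    (hy : y ∈ normalizedExtendedReesAlgebra K J) : ∃ p, laurentToRatFunc K K p = y := by
  obtain ⟨t, s, -, h⟩ := exists_monic_of_mem_normalized hy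
  apply exists_of_isIntegralElem_laurent
  refine isIntegralElem_of_pow_add_sum_eq_zero (t := t)
    (fun j => mapRingHom ℤ (algebraMap R K) (s j)) ?_
  rw [← h]
  congr 1
  exact Finset.sum_congr rfl fun j _ => congrArg (· * y ^ j) (laurentToRatFunc_map K (s j))

/-- A homogeneous element `x T ^ n` of the normalized extended Rees algebra has coefficient in the
integral closure of the corresponding power. -/
lemma exists_eq_of_C_mul_X_zpow_mem [IsDomain R] [IsIntegrallyClosed R] [IsFractionRing R K] {x : K}
    {n : ℤ} (hx : RatFunc.C x * RatFunc.X ^ n ∈ normalizedExtendedReesAlgebra K J) :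
    ∃ r : R, algebraMap R K r = x ∧ r ∈ idealIntegralClosure (J ^ n.toNat) := by
  obtain ⟨t, s, hs, h⟩ := exists_monic_of_mem_normalized hx
  have hx' : RatFunc.C x * RatFunc.X ^ n = laurentToRatFunc K K (single n x) := by
    rw [laurentToRatFunc_single]; rfl
  have hs' : ∀ j, laurentToRatFunc R K (s j) =
      laurentToRatFunc K K (mapRingHom ℤ (algebraMap R K) (s j)) := fun j =>
    (laurentToRatFunc_map K (s j)).symm
  simp only [hx', hs', ← map_pow, ← map_mul, ← map_sum, ← map_add] at h
  have h1 := (map_eq_zero_iff _ (laurentToRatFunc_injective_field K)).mp h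
  -- compare coefficients in degree `t * n`
  have h2 := congrArg (fun p : K[T;T⁻¹] => p.coeff (t * n)) h1
  have hcoeff : ∀ j, (mapRingHom ℤ (algebraMap R K) (s j) * single n x ^ j).coeff (t * n) =
      algebraMap R K ((s j).coeff ((t - j) * n)) * x ^ j := by
    intro j
    rw [single_pow, AddMonoidAlgebra.coeff_mul_single_eq_coeff_mul (m₂ := ((t : ℤ) - j) * n),
      coeff_mapRingHom]
    intro k _
    rw [nsmul_eq_mul, sub_mul]
    constructor <;> intro hk <;> linarith
  have h3 : x ^ t + ∑ j ∈ Finset.range t, algebraMap R K ((s j).coeff ((t - j) * n)) * x ^ j = 0 := by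
    simp only [AddMonoidAlgebra.coeff_add, Finsupp.add_apply, AddMonoidAlgebra.coeff_sum,
      Finsupp.finsetSum_apply, hcoeff] at h2
    rw [single_pow, AddMonoidAlgebra.coeff_single, nsmul_eq_mul, Finsupp.single_eq_same] at h2
    simpa using h2
  have hint : IsIntegral R x :=
    isIntegralElem_of_pow_add_sum_eq_zero (fun j => (s j).coeff ((t - j) * n)) h3
  obtain ⟨r, rfl⟩ := IsIntegrallyClosed.algebraMap_eq_of_integral hint
  refine ⟨r, rfl, ?_⟩
  have ht : 1 ≤ t := by
    by_contra! h0
    obtain rfl : t = 0 := by omega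
    simp at h3
  refine ⟨t, ht, fun i => (s (t - i)).coeff (i * n), fun i hi => ?_, ?_⟩
  · have h4 := hs (t - i) (i * n)
    change _ ∈ J ^ (i * n).toNat at h4
    rw [← pow_mul]
    rcases le_or_gt 0 n with hn | hn
    · obtain ⟨k, rfl⟩ := Int.eq_ofNat_of_zero_le hn
      rw [show ((i : ℤ) * (k : ℤ)).toNat = k * i by rw [← Nat.cast_mul, Int.toNat_natCast, mul_comm]]
        at h4
      simpa using h4
    · rw [Int.toNat_of_nonpos hn.le, zero_mul, pow_zero, Ideal.one_eq_top]
      trivial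
  · apply FaithfulSMul.algebraMap_injective R K
    rw [map_zero, ← h3, map_add, map_pow, map_sum]
    congr 1
    refine Finset.sum_nbij' (fun i => t - i) (fun j => t - j) ?_ ?_ ?_ ?_ ?_
    · intro i hi
      rw [Finset.mem_Icc] at hi
      rw [Finset.mem_range]
      omega
    · intro j hj
      rw [Finset.mem_range] at hj
      rw [Finset.mem_Icc]
      omega
    · intro i hi
      rw [Finset.mem_Icc] at hi
      omega
    · intro j hj
      rw [Finset.mem_range] at hj
      omega
    · intro i hi
      rw [Finset.mem_Icc] at hi
      rw [map_mul, map_pow, show (t : ℤ) - ((t - i : ℕ) : ℤ) = i by omega]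

end Normalized

section Normalized

variable {R : Type u} [CommRing R] {K : Type v} [Field K] [Algebra R K] {J : Ideal R}

/-! ### The grading of the normalized extended Rees algebra -/

/-- Every Laurent polynomial over `K` is a quotient of elements of the extended Rees algebra. -/
lemma exists_denominator [IsDomain R] [IsFractionRing R K] (p : K[T;T⁻¹]) :
    ∃ s ∈ (adicFiltration J).rees, s ≠ 0 ∧ ∃ s' ∈ (adicFiltration J).rees,
      mapRingHom ℤ (algebraMap R K) s * p = mapRingHom ℤ (algebraMap R K) s' := by
  induction p using AddMonoidAlgebra.induction_linear with
  | zero => exact ⟨1, one_mem _, one_ne_zero, 0, zero_mem _, by simp⟩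
  | add p q hp hq =>
    obtain ⟨s, hs, hs0, s', hs', h⟩ := hp
    obtain ⟨t, ht, ht0, t', ht', h'⟩ := hq
    refine ⟨s * t, mul_mem hs ht, mul_ne_zero hs0 ht0, t * s' + s * t',
      add_mem (mul_mem ht hs') (mul_mem hs ht'), ?_⟩
    rw [map_mul, map_add, map_mul, map_mul, ← h, ← h']
    ring
  | single n x =>
    obtain ⟨a, b, hb, rfl⟩ := IsFractionRing.div_surjective R x
    have hb0 : b ≠ 0 := nonZeroDivisors.ne_zero hb
    have hbK : algebraMap R K b ≠ 0 := by simpa using hb0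
    refine ⟨single (-(n.toNat : ℤ)) b, (IdealFiltration.single_mem_rees _).mpr
      (IdealFiltration.mem_zero _ _ (by omega)), ?_, single (-(n.toNat : ℤ) + n) a,
      (IdealFiltration.single_mem_rees _).mpr (IdealFiltration.mem_zero _ _ (by omega)), ?_⟩
    · exact fun h => hb0 (single_eq_zero.mp h)
    · rw [mapRingHom_single, mapRingHom_single, single_mul_single, mul_div_cancel₀ _ hbK]

/-- Elements of the normalized extended Rees algebra are almost integral over the extended Rees
algebra. -/
lemma exists_forall_pow_of_mem_normalized [IsDomain R] [IsFractionRing R K] {p : K[T;T⁻¹]}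
    (hp : laurentToRatFunc K K p ∈ normalizedExtendedReesAlgebra K J) :
    ∃ s ∈ (adicFiltration J).rees, s ≠ 0 ∧ ∀ k : ℕ, ∃ s' ∈ (adicFiltration J).rees,
      mapRingHom ℤ (algebraMap R K) s * p ^ k = mapRingHom ℤ (algebraMap R K) s' := by
  have hp' : IsIntegral (extendedReesAlgebra K J) (laurentToRatFunc K K p) := hp
  obtain ⟨t, ht, ht0, t', ht', htt'⟩ := exists_denominator (J := J) p
  have hmem : ∀ s ∈ (adicFiltration J).rees, laurentToRatFunc R K s ∈ extendedReesAlgebra K J :=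
    fun s hs => mem_extendedReesAlgebra.mpr ⟨s, hs, rfl⟩
  obtain ⟨⟨c, hc⟩, hc0, h⟩ := hp'.isAlmostIntegral_of_exists_smul_mem_range
    ⟨⟨_, hmem t ht⟩, mem_nonZeroDivisors_of_ne_zero fun h0 => ht0 (laurentToRatFunc_injective K
      ((congrArg Subtype.val h0).trans (map_zero _).symm)), ⟨⟨_, hmem t' ht'⟩, by
      rw [Algebra.smul_def]
      change laurentToRatFunc R K t' = laurentToRatFunc R K t * _
      rw [← laurentToRatFunc_map K t', ← laurentToRatFunc_map K t, ← map_mul, htt']⟩⟩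
  obtain ⟨s, hs, rfl⟩ := mem_extendedReesAlgebra.mp hc
  refine ⟨s, hs, ?_, fun k => ?_⟩
  · rintro rfl
    exact nonZeroDivisors.ne_zero hc0 (Subtype.ext (map_zero _))
  · obtain ⟨⟨z, hz⟩, hzk⟩ := h k
    obtain ⟨s', hs', rfl⟩ := mem_extendedReesAlgebra.mp hz
    refine ⟨s', hs', laurentToRatFunc_injective_field K ?_⟩
    rw [Algebra.smul_def] at hzk
    rw [map_mul, map_pow, laurentToRatFunc_map, laurentToRatFunc_map]
    exact hzk.symm

/-- As the extended Rees algebra is Noetherian, almost integral elements are integral. -/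
lemma mem_normalized_of_forall_pow [IsNoetherianRing R] [IsDomain R] [IsFractionRing R K]
    {p : K[T;T⁻¹]} {s : R[T;T⁻¹]} (hs : s ∈ (adicFiltration J).rees) (hs0 : s ≠ 0)
    (h : ∀ k : ℕ, ∃ s' ∈ (adicFiltration J).rees,
      mapRingHom ℤ (algebraMap R K) s * p ^ k = mapRingHom ℤ (algebraMap R K) s') :
    laurentToRatFunc K K p ∈ normalizedExtendedReesAlgebra K J := by
  have hN : IsNoetherianRing (extendedReesAlgebra K J) := isNoetherianRing_extendedReesAlgebra
  refine IsAlmostIntegral.isIntegral (R := extendedReesAlgebra K J)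
    ⟨⟨_, mem_extendedReesAlgebra.mpr ⟨s, hs, rfl⟩⟩, mem_nonZeroDivisors_of_ne_zero fun h0 =>
      hs0 (laurentToRatFunc_injective K ((congrArg Subtype.val h0).trans (map_zero _).symm)),
      fun k => ?_⟩
  obtain ⟨s', hs', hk⟩ := h k
  refine ⟨⟨_, mem_extendedReesAlgebra.mpr ⟨s', hs', rfl⟩⟩, ?_⟩
  rw [Algebra.smul_def]
  change laurentToRatFunc R K s' = laurentToRatFunc R K s * _
  rw [← laurentToRatFunc_map K s', ← laurentToRatFunc_map K s, ← map_pow,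
    ← map_mul, hk]

variable [IsNoetherianRing R] [IsDomain R] [IsFractionRing R K]

/-- The lowest term of an element of the normalized extended Rees algebra is almost integral over
the extended Rees algebra, hence integral. -/
lemma lowest_mem_normalized {p : K[T;T⁻¹]}
    (hp : laurentToRatFunc K K p ∈ normalizedExtendedReesAlgebra K J) {n : ℤ}
    (hn : ∀ k < n, p.coeff k = 0) :
    laurentToRatFunc K K (single n (p.coeff n)) ∈ normalizedExtendedReesAlgebra K J := by
  obtain ⟨s, hs, hs0, h⟩ := exists_forall_pow_of_mem_normalized hp
  obtain ⟨m, hm, hmlt⟩ := exists_forall_lt_coeff_eq_zero hs0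
  refine mem_normalized_of_forall_pow (s := single m (s.coeff m))
    ((IdealFiltration.single_mem_rees _).mpr (hs m)) (fun h0 => hm (single_eq_zero.mp h0))
    fun k => ?_
  obtain ⟨s', hs', hk⟩ := h k
  refine ⟨single (m + k * n) (s'.coeff (m + k * n)),
    (IdealFiltration.single_mem_rees _).mpr (hs' _), ?_⟩
  have h1 := coeff_nsmul_pow_of_forall_lt hn k
  have h2 := (coeff_add_mul_of_forall_lt (p := mapRingHom ℤ (algebraMap R K) s) (m := m)
    (fun j hj => by rw [coeff_mapRingHom, hmlt j hj, map_zero]) h1.1).2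
  rw [hk, coeff_mapRingHom, coeff_mapRingHom, h1.2] at h2
  rw [mapRingHom_single, mapRingHom_single, single_pow, single_mul_single, nsmul_eq_mul, h2]

/-- The normalized extended Rees algebra is graded. -/
lemma single_coeff_mem_normalized {p : K[T;T⁻¹]}
    (hp : laurentToRatFunc K K p ∈ normalizedExtendedReesAlgebra K J) (n : ℤ) :
    laurentToRatFunc K K (single n (p.coeff n)) ∈ normalizedExtendedReesAlgebra K J := by
  induction hc : p.coeff.support.card using Nat.strong_induction_on generalizing p with
  | _ c ih =>
  by_cases hp0 : p = 0
  · rw [hp0]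
    simp
  obtain ⟨m, hm, hmlt⟩ := exists_forall_lt_coeff_eq_zero hp0
  have hlow := lowest_mem_normalized hp hmlt
  rcases eq_or_ne n m with rfl | hnm
  · exact hlow
  have hq : (p - single m (p.coeff m)).coeff = p.coeff.erase m := by
    ext k
    rw [AddMonoidAlgebra.coeff_sub, Finsupp.sub_apply, AddMonoidAlgebra.coeff_single]
    rcases eq_or_ne k m with rfl | hk
    · simp
    · rw [Finsupp.single_eq_of_ne hk, Finsupp.erase_ne hk, sub_zero]
  have h1 := ih _ (by
    rw [hq, Finsupp.support_erase, ← hc]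
    exact Finset.card_erase_lt_of_mem (Finsupp.mem_support_iff.mpr hm))
    (p := p - single m (p.coeff m)) (by rw [map_sub]; exact sub_mem hp hlow) rfl
  rwa [hq, Finsupp.erase_ne hnm] at h1

end Normalized

lemma comap_mem_associatedPrimesOfElement_iff {A : Type u} {A' : Type v} [CommRing A]
    [CommRing A'] [IsNoetherianRing A] (e : A ≃+* A') {a : A} {Q : Ideal A'} :
    Q.comap e ∈ associatedPrimesOfElement a ↔ Q ∈ associatedPrimesOfElement (e a) := by
  have hN : IsNoetherianRing A' := isNoetherianRing_of_ringEquiv _ e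
  rw [mem_associatedPrimesOfElement_iff, mem_associatedPrimesOfElement_iff]
  constructor
  · rintro ⟨hp, b, hb⟩
    have hp' : Q.IsPrime := by
      have h := Ideal.comap_isPrime e.symm (Q.comap e)
      rwa [show (Q.comap e).comap e.symm = Q by
        ext y
        rw [Ideal.mem_comap, Ideal.mem_comap, e.apply_symm_apply]] at h
    refine ⟨hp', e b, fun y => ?_⟩
    have h := hb (e.symm y)
    rw [Ideal.mem_comap, RingEquiv.apply_symm_apply, ← map_dvd_iff e, map_mul,
      RingEquiv.apply_symm_apply] at h
    exact h
  · rintro ⟨hp, b, hb⟩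
    refine ⟨Ideal.comap_isPrime e Q, e.symm b, fun y => ?_⟩
    rw [Ideal.mem_comap, hb, ← map_dvd_iff e, map_mul, RingEquiv.apply_symm_apply]

/-! ### The filtration defined by the normalized extended Rees algebra -/

section NormalizedFiltration

variable {R : Type u} [CommRing R] (K : Type v) [Field K] [Algebra R K] (J : Ideal R)

/-- The filtration whose extended Rees algebra is the normalization of `R[J T, T⁻¹]`; in degrees
`n ≥ 0` its members are the integral closures of the powers of `J`. -/
noncomputable def normalizedFiltration : IdealFiltration R where
  I n :=
    { carrier := {r | laurentToRatFunc R K (single n r) ∈ normalizedExtendedReesAlgebra K J}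
      zero_mem' := by
        change laurentToRatFunc R K (single n 0) ∈ normalizedExtendedReesAlgebra K J
        rw [single_zero, map_zero]
        exact zero_mem _
      add_mem' := fun {x y} hx hy => by
        change laurentToRatFunc R K (single n (x + y)) ∈ normalizedExtendedReesAlgebra K J
        rw [single_add, map_add]
        exact add_mem hx hy
      smul_mem' := fun r x hx => by
        change laurentToRatFunc R K (single n (r * x)) ∈ normalizedExtendedReesAlgebra K J
        have h : (single n (r * x) : R[T;T⁻¹]) = single 0 r * single n x := by
          rw [single_mul_single, zero_add]
        rw [h, map_mul]
        exact mul_mem (mem_normalized_of_mem (mem_extendedReesAlgebra.mpr ⟨_,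
          (IdealFiltration.single_mem_rees _).mpr (IdealFiltration.mem_zero _ r le_rfl), rfl⟩)) hx }
  eq_top n hn := by
    rw [eq_top_iff]
    intro r _
    exact mem_normalized_of_mem (mem_extendedReesAlgebra.mpr ⟨_,
      (IdealFiltration.single_mem_rees _).mpr (IdealFiltration.mem_zero _ r hn), rfl⟩)
  mul_mem {m n x y} hx hy := by
    change laurentToRatFunc R K (single (m + n) (x * y)) ∈ normalizedExtendedReesAlgebra K J
    rw [← single_mul_single, map_mul]
    exact mul_mem hx hy

variable {K J}

lemma mem_normalizedFiltration {n : ℤ} {r : R} : r ∈ (normalizedFiltration K J).I n ↔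
    laurentToRatFunc R K (single n r) ∈ normalizedExtendedReesAlgebra K J := Iff.rfl

lemma pow_le_normalizedFiltration (n : ℕ) : J ^ n ≤ (normalizedFiltration K J).I n :=
  fun r hr => mem_normalized_of_mem (mem_extendedReesAlgebra.mpr ⟨_,
    (IdealFiltration.single_mem_rees _).mpr (show r ∈ J ^ (n : ℤ).toNat by simpa using hr), rfl⟩)

lemma laurentToRatFunc_mem_normalized {p : R[T;T⁻¹]} (hp : p ∈ (normalizedFiltration K J).rees) :
    laurentToRatFunc R K p ∈ normalizedExtendedReesAlgebra K J := by
  rw [← AddMonoidAlgebra.sum_coeff_single p, Finsupp.sum, map_sum]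
  exact sum_mem fun n _ => hp n

variable (K J) in
/-- The comparison map from the extended Rees algebra of `normalizedFiltration`. -/
noncomputable def toNormalized :
    (normalizedFiltration K J).rees →+* normalizedExtendedReesAlgebra K J :=
  RingHom.codRestrict
    ((laurentToRatFunc R K : R[T;T⁻¹] →+* RatFunc K).comp
      (normalizedFiltration K J).rees.val.toRingHom)
    (normalizedExtendedReesAlgebra K J) fun p => laurentToRatFunc_mem_normalized p.2

lemma coe_toNormalized (p : (normalizedFiltration K J).rees) :
    (toNormalized K J p : RatFunc K) = laurentToRatFunc R K p.1 := rfl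

variable [IsDomain R] [IsIntegrallyClosed R] [IsFractionRing R K]

lemma mem_idealIntegralClosure_of_mem_normalizedFiltration {n : ℕ} {r : R}
    (hr : r ∈ (normalizedFiltration K J).I n) : r ∈ idealIntegralClosure (J ^ n) := by
  rw [mem_normalizedFiltration, laurentToRatFunc_single] at hr
  obtain ⟨r', hr', h⟩ := exists_eq_of_C_mul_X_zpow_mem hr
  rw [FaithfulSMul.algebraMap_injective R K hr'] at h
  simpa using h

variable [IsNoetherianRing R]

/-- Surjectivity holds because the normalized extended Rees algebra is graded and its homogeneous
elements have coefficients in the normal domain `R`. -/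
lemma toNormalized_bijective : Function.Bijective (toNormalized K J) := by
  constructor
  · intro p q hpq
    exact Subtype.ext (laurentToRatFunc_injective K (congrArg Subtype.val hpq))
  · rintro ⟨y, hy⟩
    obtain ⟨p, rfl⟩ := exists_laurent_of_mem_normalized hy
    have h : ∀ n, ∃ r, algebraMap R K r = p.coeff n ∧ r ∈ (normalizedFiltration K J).I n := by
      intro n
      have h1 := single_coeff_mem_normalized hy n
      have h2 := h1
      rw [laurentToRatFunc_single] at h2
      obtain ⟨r, hr, -⟩ := exists_eq_of_C_mul_X_zpow_mem h2
      refine ⟨r, hr, ?_⟩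
      rw [mem_normalizedFiltration, ← laurentToRatFunc_map, mapRingHom_single, hr]
      exact h1
    choose r hr hr' using h
    refine ⟨⟨∑ n ∈ p.coeff.support, single n (r n),
      sum_mem fun n _ => (IdealFiltration.single_mem_rees _).mpr (hr' n)⟩, Subtype.ext ?_⟩
    rw [coe_toNormalized, ← laurentToRatFunc_map, map_sum]
    simp only [mapRingHom_single, hr]
    exact congrArg _ (AddMonoidAlgebra.sum_coeff_single p)

variable (K J) in
/-- The normalized extended Rees algebra is the extended Rees algebra of a filtration. -/
noncomputable def normalizedEquiv :
    (normalizedFiltration K J).rees ≃+* normalizedExtendedReesAlgebra K J :=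
  RingEquiv.ofBijective (toNormalized K J) toNormalized_bijective

lemma coe_normalizedEquiv_mono {n : ℤ} {r : R} (hr : r ∈ (normalizedFiltration K J).I n) :
    (normalizedEquiv K J ((normalizedFiltration K J).mono n r hr) : RatFunc K) =
      RatFunc.C (algebraMap R K r) * RatFunc.X ^ n :=
  laurentToRatFunc_single K n r

lemma normalizedEquiv_tInv :
    normalizedEquiv K J (normalizedFiltration K J).tInv = reesTInv K J := by
  apply Subtype.ext
  rw [IdealFiltration.tInv, coe_normalizedEquiv_mono, map_one, map_one, one_mul, zpow_neg, zpow_one]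
  rfl

lemma isIntegrallyClosed_rees_normalizedFiltration :
    IsIntegrallyClosed (normalizedFiltration K J).rees := by
  let N := normalizedExtendedReesAlgebra K J
  have h : IsIntegrallyClosed N := by
    rw [isIntegrallyClosed_iff (FractionRing N)]
    intro z hz
    let g : FractionRing N →ₐ[N] RatFunc K :=
      IsFractionRing.liftAlgHom (g := Algebra.ofId N (RatFunc K)) Subtype.val_injective
    have h1 : IsIntegral N (g z) := hz.map g
    have h3 : Algebra.IsIntegral (extendedReesAlgebra K J) N :=
      inferInstanceAs (Algebra.IsIntegral _ (integralClosure (extendedReesAlgebra K J) (RatFunc K)))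
    have h2 : IsIntegral (extendedReesAlgebra K J) (g z) := isIntegral_trans _ h1
    refine ⟨⟨g z, h2⟩, g.toRingHom.injective ?_⟩
    change g (algebraMap N _ _) = g z
    rw [g.commutes]
    rfl
  exact IsIntegrallyClosed.of_equiv (normalizedEquiv K J).symm

/-- The exceptional primes are the associated primes of `T⁻¹` in the extended Rees algebra of
`normalizedFiltration`. -/
lemma mem_exceptionalPrimes_iff [IsNoetherianRing (normalizedFiltration K J).rees]
    {Q : Ideal (normalizedExtendedReesAlgebra K J)} : Q ∈ exceptionalPrimes K J ↔
      Q.comap (normalizedEquiv K J) ∈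
        associatedPrimesOfElement (normalizedFiltration K J).tInv := by
  rw [comap_mem_associatedPrimesOfElement_iff, normalizedEquiv_tInv]
  rfl

end NormalizedFiltration

end

/-! ### Rees valuations -/

lemma idealIntegralClosure_subset_of_isPrime {R : Type u} [CommRing R] {I p : Ideal R} [p.IsPrime]
    (h : I ≤ p) : idealIntegralClosure I ⊆ p := by
  rintro x ⟨t, ht, a, ha, hx⟩
  refine (‹p.IsPrime›).mem_of_pow_mem t ?_
  rw [eq_neg_of_add_eq_zero_left hx]
  refine neg_mem (sum_mem fun i hi => Ideal.mul_mem_right _ _ (h ?_))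
  exact Ideal.pow_le_self (by rw [Finset.mem_Icc] at hi; omega) (ha i hi)

namespace IdealFiltration

variable {R : Type u} [CommRing R] {F : IdealFiltration R}

/-- If the members of `F` are contained in the integral closures of the powers of the maximal ideal
`𝔪`, then a homogeneous prime `Q` that is not maximal does not contain `𝔪 T`: otherwise `Q` would
contain all elements of positive degree, by their equations of integral dependence. -/
lemma exists_mono_one_notMem [IsLocalRing R] {hI : F.I 1 ≤ maximalIdeal R}
    (hI' : maximalIdeal R ≤ F.I 1)
    (hint : ∀ n : ℕ, ∀ r ∈ F.I n, r ∈ idealIntegralClosure (maximalIdeal R ^ n))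
    {Q : PrimeSpectrum F.rees} (hT : F.tInv ∈ Q.asIdeal) (hlt : Q < F.maxIdeal hI) :
    ∃ (x : R) (hx : x ∈ F.I 1), F.mono 1 x hx ∉ Q.asIdeal := by
  by_contra! hcon
  have hpow : ∀ n : ℕ, maximalIdeal R ^ (n + 1) ≤ F.part Q.asIdeal (n + 1 : ℕ) := by
    intro n
    induction n with
    | zero =>
      intro r hr
      rw [zero_add, pow_one] at hr
      exact ⟨hI' hr, hcon r (hI' hr)⟩
    | succ n ih =>
      rw [pow_succ', Ideal.mul_le]
      intro x hx y hy
      have := mul_mem_part (hI' hx) (ih hy)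
      rw [add_comm] at this
      exact_mod_cast this
  obtain ⟨e, a, he, ha', ha⟩ :=
    exists_mem_part_notMem_part (hI := hI) hI' isHomogeneous_maxIdeal hT hlt
  obtain ⟨t, -, c, hc, h⟩ := hint e a ha'.1
  obtain ⟨h1, h2⟩ := mono_pow ha'.1 t
  refine ha ⟨ha'.1, Q.2.mem_of_pow_mem t ?_⟩
  rw [h2]
  have h3 : a ^ t ∈ F.part Q.asIdeal (t * e) := by
    rw [eq_neg_of_add_eq_zero_left h]
    refine neg_mem (sum_mem fun i hi => ?_)
    have hi' := Finset.mem_Icc.mp hi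
    have h4 := hc i hi
    rw [← pow_mul] at h4
    have h5 : c i ∈ F.part Q.asIdeal (e * i : ℕ) := by
      obtain ⟨k, hk⟩ := Nat.exists_eq_succ_of_ne_zero (Nat.mul_pos he hi'.1).ne'
      rw [hk] at h4 ⊢
      exact hpow k h4
    obtain ⟨h6, -⟩ := mono_pow ha'.1 (t - i)
    have h7 := mul_mem_part h6 h5
    rw [mul_comm (c i), show (t : ℤ) * e = (t - i : ℕ) * e + (e * i : ℕ) by push_cast [hi'.2]; ring]
    exact h7
  exact h3.2

variable [IsDomain R] (K : Type v) [Field K] [Algebra R K] [IsFractionRing R K]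
  {Q : Ideal F.rees} {w : Valuation F.rees ℤᵐ⁰}

/-- The restriction to the fraction field of `R` of an essential valuation of the extended Rees
algebra. -/
noncomputable def baseValuation (hw : IsEssentialValuation Q w) : Valuation K ℤᵐ⁰ :=
  (w.comap (algebraMap R F.rees)).extendToLocalization (S := nonZeroDivisors R)
    (fun _ hr h0 => hw.ne_zero ((F.mono_eq_zero_iff (F.mem_zero _ le_rfl)).not.mpr
      (nonZeroDivisors.ne_zero hr)) h0) K

variable {K}

lemma baseValuation_algebraMap (hw : IsEssentialValuation Q w) (r : R) :
    baseValuation K hw (algebraMap R K r) = w (algebraMap R F.rees r) :=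
  Valuation.extendToLocalization_apply_map_apply _ _ _ _

lemma baseValuation_div_le_one_iff (hw : IsEssentialValuation Q w) {r s : R} (hs : s ≠ 0) :
    baseValuation K hw (algebraMap R K r / algebraMap R K s) ≤ 1 ↔
      w (algebraMap R F.rees r) ≤ w (algebraMap R F.rees s) := by
  rw [map_div₀, baseValuation_algebraMap, baseValuation_algebraMap]
  exact div_le_one₀ (zero_lt_iff.mpr
    (hw.ne_zero ((F.mono_eq_zero_iff (F.mem_zero _ le_rfl)).not.mpr hs)))

/-- The valuation ring of `baseValuation` is the degree zero part of the homogeneous localization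
at `Q`. -/
lemma baseValuation_le_one_iff (hw : IsEssentialValuation Q w) {x : K} :
    baseValuation K hw x ≤ 1 ↔ ∃ (n : ℤ) (a b : R) (_ : a ∈ F.I n) (hb : b ∈ F.I n),
      F.mono n b hb ∉ Q ∧ x = algebraMap R K a / algebraMap R K b := by
  have hinj : ∀ {r : R}, algebraMap R F.rees r = 0 → r = 0 := fun {r} h =>
    (F.mono_eq_zero_iff (F.mem_zero r le_rfl)).mp h
  constructor
  · intro hx
    obtain ⟨r, s, hs, rfl⟩ := IsFractionRing.div_surjective R x
    have hs0 := nonZeroDivisors.ne_zero hs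
    rw [baseValuation_div_le_one_iff hw hs0] at hx
    obtain ⟨p, q, hq, hpq⟩ := hw.exists_mul_eq hx
    obtain ⟨n, hn⟩ := exists_comp_notMem hq
    refine ⟨n, p.1.coeff n, q.1.coeff n, p.2 n, q.2 n, hn, ?_⟩
    have hq0 : q.1.coeff n ≠ 0 := fun h0 => hn (by
      unfold comp
      rw [(F.mono_eq_zero_iff _).mpr h0]
      exact zero_mem Q)
    have h1 : r * q.1.coeff n = s * p.1.coeff n := by
      have h := congrArg (fun z : F.rees => z.1.coeff n) hpq
      have h2 : ∀ (r : R) (z : F.rees), (algebraMap R F.rees r * z).1.coeff n = r * z.1.coeff n :=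
        fun r z => by
          rw [← Algebra.smul_def]
          exact AddMonoidAlgebra.coeff_smul_apply _ _ _
      simpa only [h2] using h
    rw [div_eq_div_iff (by simpa using hs0) (by simpa using hq0), ← map_mul, ← map_mul, h1, mul_comm]
  · rintro ⟨n, a, b, ha, hb, hbQ, rfl⟩
    have hb0 : b ≠ 0 := by
      rintro rfl
      rw [mono_zero] at hbQ
      exact hbQ (zero_mem Q)
    rw [baseValuation_div_le_one_iff hw hb0]
    have h1 : algebraMap R F.rees a * F.mono n b hb = algebraMap R F.rees b * F.mono n a ha := by
      rw [algebraMap_eq_mono, algebraMap_eq_mono, mono_mul_mono, mono_mul_mono]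
      simp only [mul_comm]
    have h2 := congrArg w h1
    rw [map_mul, map_mul, hw.eq_one hbQ, mul_one] at h2
    rw [h2]
    exact mul_le_of_le_one_right' (hw.le_one _)

/-- An element `r T ^ s` of value one, divided by the `s`-th power of an element `x T` of value zero,
gives an element of `K` of value one. -/
lemma baseValuation_surjective (hw : IsEssentialValuation Q w) {s : ℕ} {r x : R} (hr : r ∈ F.I s)
    (hrs : w (F.mono s r hr) = WithZero.exp (-1)) (hx : x ∈ F.I 1) (hxQ : F.mono 1 x hx ∉ Q) :
    Function.Surjective (baseValuation K hw) := by
  have h1 : baseValuation K hw (algebraMap R K r / algebraMap R K x ^ s) = WithZero.exp (-1) := by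
    obtain ⟨h2, h3⟩ := mono_pow hx s
    have h4 : algebraMap R F.rees r * F.mono 1 x hx ^ s =
        algebraMap R F.rees (x ^ s) * F.mono s r hr := by
      rw [h3, algebraMap_eq_mono, algebraMap_eq_mono, mono_mul_mono, mono_mul_mono]
      simp only [mul_comm (x ^ s) r, mul_one]
    have h5 := congrArg w h4
    rw [map_mul, map_mul, map_pow w, hw.eq_one hxQ, one_pow, mul_one, hrs] at h5
    have hx0 : x ^ s ≠ 0 := by
      refine pow_ne_zero _ ?_
      rintro rfl
      rw [mono_zero] at hxQ
      exact hxQ (zero_mem Q)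
    rw [← map_pow, map_div₀, baseValuation_algebraMap, baseValuation_algebraMap, h5]
    exact mul_div_cancel_left₀ _
      (hw.ne_zero ((F.mono_eq_zero_iff (F.mem_zero _ le_rfl)).not.mpr hx0))
  intro z
  by_cases hz : z = 0
  · exact ⟨0, by rw [hz, map_zero]⟩
  · refine ⟨(algebraMap R K r / algebraMap R K x ^ s) ^ (-WithZero.log z), ?_⟩
    rw [map_zpow₀, h1, ← WithZero.exp_zsmul]
    simp [WithZero.exp_log hz]

end IdealFiltration

/-- Two valuations with value group `ℤ` and the same valuation ring are equal. -/
lemma Valuation.eq_of_surjective_of_le_one_iff {K : Type v} [Field K] {μ ν : Valuation K ℤᵐ⁰}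
    (hμ : Function.Surjective μ) (hν : Function.Surjective ν) (h : ∀ x, μ x ≤ 1 ↔ ν x ≤ 1) :
    μ = ν := by
  have heq : μ.IsEquiv ν := Valuation.isEquiv_iff_val_le_one.mpr fun {x} => h x
  obtain ⟨π, hπ⟩ := hμ (WithZero.exp (-1))
  obtain ⟨y, hy⟩ := hν (WithZero.exp (-1))
  have hlt : ∀ z : ℤᵐ⁰, z < 1 → z ≤ WithZero.exp (-1) := by
    intro z hz
    by_cases hz0 : z = 0
    · simp [hz0]
    · rw [← WithZero.exp_log hz0, ← WithZero.exp_zero, WithZero.exp_lt_exp] at hz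
      rw [← WithZero.exp_log hz0, WithZero.exp_le_exp]
      omega
  have hone : WithZero.exp (-1 : ℤ) < 1 := by
    rw [← WithZero.exp_zero, WithZero.exp_lt_exp]; norm_num
  have h1 : ν π = WithZero.exp (-1) := by
    refine le_antisymm (hlt _ ?_) ?_
    · rw [← heq.lt_one_iff_lt_one, hπ]
      exact hone
    · rw [← hy, ← heq.le_iff_le, hπ]
      refine hlt _ ?_
      rw [heq.lt_one_iff_lt_one, hy]
      exact hone
  ext z
  by_cases hz : z = 0
  · rw [hz, map_zero, map_zero]
  · have hz' : μ z ≠ 0 := (Valuation.ne_zero_iff _).mpr hz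
    have h2 : μ z = μ (π ^ (-WithZero.log (μ z))) := by
      rw [map_zpow₀, hπ, ← WithZero.exp_zsmul]
      simp [WithZero.exp_log hz']
    have h3 : ν z = ν (π ^ (-WithZero.log (μ z))) := heq.eq_iff.mp h2
    rw [h2, h3, map_zpow₀, map_zpow₀, hπ, h1]

open IdealFiltration

section

variable {R : Type u} [CommRing R] [IsDomain R] [IsIntegrallyClosed R] {K : Type v}
  [Field K] [Algebra R K] [IsFractionRing R K] {J : Ideal R}

lemma isCommensurable_normalizedFiltration [IsLocalRing R] {B : ℕ}
    (hB : ∀ n : ℕ, idealIntegralClosure (maximalIdeal R ^ (n + B)) ⊆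
      (maximalIdeal R ^ n : Ideal R)) :
    (normalizedFiltration K (maximalIdeal R)).IsCommensurable (maximalIdeal R) B where
  pow_le := pow_le_normalizedFiltration
  le_pow n _ hr := hB n (mem_idealIntegralClosure_of_mem_normalizedFiltration hr)

lemma normalizedFiltration_one_le [IsLocalRing R] :
    (normalizedFiltration K (maximalIdeal R)).I 1 ≤ maximalIdeal R := by
  intro r hr
  have h := mem_idealIntegralClosure_of_mem_normalizedFiltration
    (show r ∈ (normalizedFiltration K (maximalIdeal R)).I (1 : ℕ) by exact_mod_cast hr)
  rw [pow_one] at h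
  exact idealIntegralClosure_subset_of_isPrime le_rfl h

variable [IsNoetherianRing R]

lemma mem_reesHomogeneousLocalization_iff {Q : Ideal (normalizedExtendedReesAlgebra K J)} {x : K} :
    x ∈ reesHomogeneousLocalization J Q ↔
      ∃ (n : ℤ) (a b : R) (_ : a ∈ (normalizedFiltration K J).I n)
        (hb : b ∈ (normalizedFiltration K J).I n),
        (normalizedFiltration K J).mono n b hb ∉ Q.comap (normalizedEquiv K J) ∧
          x = algebraMap R K a / algebraMap R K b := by
  have key : ∀ {n : ℤ} {a : R}, a ∈ (normalizedFiltration K J).I n ↔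
      RatFunc.C (algebraMap R K a) * RatFunc.X ^ n ∈ normalizedExtendedReesAlgebra K J :=
    fun {n a} => by rw [mem_normalizedFiltration, laurentToRatFunc_single]
  have key2 : ∀ {n : ℤ} {b : R} (hb : b ∈ (normalizedFiltration K J).I n),
      (normalizedFiltration K J).mono n b hb ∈ Q.comap (normalizedEquiv K J) ↔
        (⟨RatFunc.C (algebraMap R K b) * RatFunc.X ^ n, key.mp hb⟩ :
          normalizedExtendedReesAlgebra K J) ∈ Q := fun {n b} hb => by
    rw [Ideal.mem_comap]
    have : normalizedEquiv K J ((normalizedFiltration K J).mono n b hb) =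
      (⟨RatFunc.C (algebraMap R K b) * RatFunc.X ^ n, key.mp hb⟩ :
          normalizedExtendedReesAlgebra K J) := Subtype.ext (coe_normalizedEquiv_mono hb)
    rw [this]
  constructor
  · rintro ⟨n, a, b, ha, hb, hbQ, rfl⟩
    obtain ⟨a, rfl, -⟩ := exists_eq_of_C_mul_X_zpow_mem ha
    obtain ⟨b, rfl, -⟩ := exists_eq_of_C_mul_X_zpow_mem hb
    exact ⟨n, a, b, key.mpr ha, key.mpr hb, fun hc => hbQ ((key2 _).mp hc), rfl⟩
  · rintro ⟨n, a, b, ha, hb, hbQ, rfl⟩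
    exact ⟨n, _, _, key.mp ha, key.mp hb, fun hc => hbQ ((key2 hb).mpr hc), rfl⟩

variable {B : ℕ} [IsLocalRing R]

variable {w : Ideal (normalizedFiltration K (maximalIdeal R)).rees →
    Valuation (normalizedFiltration K (maximalIdeal R)).rees ℤᵐ⁰}

/-- The essential valuations at the exceptional primes restrict to the Rees valuations. -/
lemma isReesValuation_baseValuation
    (hcomm : (normalizedFiltration K (maximalIdeal R)).IsCommensurable (maximalIdeal R) B)
    (hR : maximalIdeal R ≠ ⊥)
    (hw : ∀ Q ∈ associatedPrimesOfElement (normalizedFiltration K (maximalIdeal R)).tInv,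
      IsEssentialValuation Q (w Q))
    (Q : associatedPrimesOfElement (normalizedFiltration K (maximalIdeal R)).tInv) :
    IsReesValuation (maximalIdeal R) (baseValuation K (hw Q.1 Q.2)) := by
  let F := normalizedFiltration K (maximalIdeal R)
  have hN : IsNoetherianRing F.rees := hcomm.isNoetherianRing_and_finiteType.1
  have hI' : maximalIdeal R ≤ F.I 1 := by simpa using hcomm.pow_le 1
  have hT := tInv_mem_of_mem_associatedPrimes Q.2
  have hcov := IsEssentialValuation.covBy (P := ⟨Q.1, Q.2.isPrime⟩) (hw Q.1 Q.2)
  have hlt := lt_maxIdeal_of_covBy (hI := normalizedFiltration_one_le) hR hcov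
    (isHomogeneous_of_covBy hT hcov)
  obtain ⟨x, hx, hxQ⟩ := exists_mono_one_notMem hI'
    (fun n r hr => mem_idealIntegralClosure_of_mem_normalizedFiltration hr) hT hlt
  obtain ⟨s, r, hr, hrs⟩ : ∃ (s : ℕ) (r : R) (hr : r ∈ F.I s),
      w Q.1 (F.mono s r hr) = WithZero.exp (-1) := by
    obtain ⟨s, r, hr, hrk⟩ := (valuativeFiltration hcomm normalizedFiltration_one_le hR
      hw).exists_uniformizer Q
    have hrI : r ∈ F.I s := mem_of_forall_val_le hw fun k hk => hrk ⟨k, hk⟩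
    refine ⟨s, r, hrI, ?_⟩
    have h1 : w Q.1 (algebraMap R F.rees r) = WithZero.exp (-(s * tInvOrder w Q.1 : ℤ) - 1) := hr
    rw [val_algebraMap (hw Q.1 Q.2) hrI, sub_eq_add_neg, WithZero.exp_add] at h1
    exact mul_left_cancel₀ WithZero.exp_ne_zero h1
  refine ⟨baseValuation_surjective (hw Q.1 Q.2) hr hrs hx hxQ,
    Q.1.comap (normalizedEquiv K (maximalIdeal R)).symm, ?_, ?_⟩
  · rw [mem_exceptionalPrimes_iff]
    convert Q.2
    ext y
    rw [Ideal.mem_comap, Ideal.mem_comap, RingEquiv.symm_apply_apply]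
  · ext y
    rw [Set.mem_ofPred_eq, baseValuation_le_one_iff, mem_reesHomogeneousLocalization_iff]
    simp only [Ideal.mem_comap, RingEquiv.symm_apply_apply]

/-- Every Rees valuation is the restriction of the essential valuation at its exceptional prime. -/
lemma exists_eq_baseValuation
    (hcomm : (normalizedFiltration K (maximalIdeal R)).IsCommensurable (maximalIdeal R) B)
    (hR : maximalIdeal R ≠ ⊥)
    (hw : ∀ Q ∈ associatedPrimesOfElement (normalizedFiltration K (maximalIdeal R)).tInv,
      IsEssentialValuation Q (w Q))
    {ν : Valuation K ℤᵐ⁰} (hν : IsReesValuation (maximalIdeal R) ν) :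
    ∃ Q : associatedPrimesOfElement (normalizedFiltration K (maximalIdeal R)).tInv,
      ν = baseValuation K (hw Q.1 Q.2) := by
  have hN : IsNoetherianRing (normalizedFiltration K (maximalIdeal R)).rees :=
    hcomm.isNoetherianRing_and_finiteType.1
  obtain ⟨hsurj, Q', hQ', heq⟩ := hν
  let Q : associatedPrimesOfElement (normalizedFiltration K (maximalIdeal R)).tInv :=
    ⟨_, mem_exceptionalPrimes_iff.mp hQ'⟩
  refine ⟨Q, Valuation.eq_of_surjective_of_le_one_iff hsurj
    (isReesValuation_baseValuation hcomm hR hw Q).1 fun x => ?_⟩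
  rw [baseValuation_le_one_iff]
  have h1 : ν x ≤ 1 ↔ x ∈ reesHomogeneousLocalization (maximalIdeal R) Q' := by
    rw [← heq]; rfl
  rw [h1, mem_reesHomogeneousLocalization_iff]

end

/-! ### Multiplicities and orders -/

section Multiplicity

variable {R : Type u} [CommRing R]

lemma length_toNat_smul_top (I : Ideal R) :
    ((Module.length R (R ⧸ (I • ⊤ : Submodule R R))).toNat : ℝ) = (colength I : ℤ) := by
  rw [smul_eq_mul, Ideal.mul_top]
  rfl

lemma length_toNat_quotient_smul_top (I J : Ideal R) :
    ((Module.length R ((R ⧸ J) ⧸ (I • ⊤ : Submodule R (R ⧸ J)))).toNat : ℝ) =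
      (colength (J ⊔ I) : ℤ) := by
  have h1 : (I • ⊤ : Submodule R (R ⧸ J)) = Submodule.map J.mkQ (J ⊔ I) := by
    have h2 : (⊤ : Submodule R (R ⧸ J)) = Submodule.map J.mkQ ⊤ := by
      rw [Submodule.map_top, Submodule.range_mkQ]
    rw [h2, ← Submodule.map_smul'', smul_eq_mul, Ideal.mul_top, Submodule.map_sup, Submodule.mkQ_map_self,
      bot_sup_eq]
  rw [h1, (Submodule.quotientQuotientEquivQuotient J (J ⊔ I) le_sup_left).length_eq]
  rfl

lemma tendsto_factorial_mul_div {g : ℕ → ℤ} {d : ℕ} {L : ℝ}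
    (h : Tendsto (fun n : ℕ => ((g n : ℤ) : ℝ) / (n : ℝ) ^ d) atTop (𝓝 (L / d !))) :
    Tendsto (fun n : ℕ => (d ! : ℝ) * ((g n : ℤ) : ℝ) / (n : ℝ) ^ d) atTop (𝓝 L) := by
  have h1 := h.const_mul (d ! : ℝ)
  rw [mul_div_cancel₀ _ (by exact_mod_cast d.factorial_ne_zero)] at h1
  simpa only [mul_div_assoc] using h1

lemma hilbertSamuelMultiplicity_self {I : Ideal R} {d : ℕ} (hd : ringKrullDim R = d) {L : ℝ}
    (h : Tendsto (fun n : ℕ => ((colength (I ^ n) : ℤ) : ℝ) / (n : ℝ) ^ d) atTop (𝓝 (L / d !))) :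
    hilbertSamuelMultiplicity I R = L := by
  have h1 : ((Module.supportDim R R).unbotD 0).toNat = d := by
    rw [Module.supportDim_self_eq_ringKrullDim, hd]
    rfl
  simp only [hilbertSamuelMultiplicity, h1, length_toNat_smul_top]
  exact (tendsto_factorial_mul_div h).limUnder_eq

lemma hilbertSamuelMultiplicity_quotient {I J : Ideal R} {d : ℕ} (hd : ringKrullDim (R ⧸ J) = d)
    {L : ℝ} (h : Tendsto (fun n : ℕ => ((colength (J ⊔ I ^ n) : ℤ) : ℝ) / (n : ℝ) ^ d) atTop
      (𝓝 (L / d !))) :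
    hilbertSamuelMultiplicity I (R ⧸ J) = L := by
  have h1 : ((Module.supportDim R (R ⧸ J)).unbotD 0).toNat = d := by
    rw [Module.supportDim_quotient_eq_ringKrullDim, hd]
    rfl
  simp only [hilbertSamuelMultiplicity, h1, length_toNat_quotient_smul_top]
  exact (tendsto_factorial_mul_div h).limUnder_eq

lemma mem_pow_idealOrder_and_notMem [IsDomain R] [IsNoetherianRing R] {I : Ideal R} (hI : I ≠ ⊤)
    {f : R} (hf : f ≠ 0) : f ∈ I ^ idealOrder I f ∧ f ∉ I ^ (idealOrder I f + 1) := by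
  obtain ⟨N, hN⟩ : ∃ N, f ∉ I ^ N := by
    by_contra! hcon
    have h : f ∈ ⨅ n, I ^ n := Ideal.mem_iInf.mpr hcon
    rw [Ideal.iInf_pow_eq_bot_of_isDomain I hI] at h
    exact hf h
  have hbdd : BddAbove {n : ℕ | f ∈ I ^ n} := ⟨N, fun n hn => by
    by_contra! hlt
    exact hN (Ideal.pow_le_pow_right hlt.le hn)⟩
  refine ⟨Nat.sSup_mem ⟨0, by simp⟩ hbdd, fun h => ?_⟩
  have := le_csSup hbdd (show idealOrder I f + 1 ∈ {n : ℕ | f ∈ I ^ n} from h)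
  rw [idealOrder] at this
  omega

lemma ringKrullDim_quotient_span_singleton [IsDomain R] [IsNoetherianRing R] [IsLocalRing R]
    {d : ℕ} (hd : ringKrullDim R = (d + 1 : ℕ)) {f : R} (hf : f ∈ maximalIdeal R) (hf0 : f ≠ 0) :
    ringKrullDim (R ⧸ Ideal.span {f}) = d := by
  have h := ringKrullDim_quotient_span_singleton_succ_eq_ringKrullDim_of_mem_nonZeroDivisors
    (mem_nonZeroDivisors_of_ne_zero hf0) hf
  rw [hd] at h
  generalize ringKrullDim (R ⧸ Ideal.span {f}) = x at h ⊢
  induction x using WithBot.recBotCoe with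
  | bot =>
    rw [WithBot.bot_add] at h
    exact absurd h.symm WithBot.coe_ne_bot
  | coe y =>
    have h1 : y + 1 = (d : ℕ∞) + 1 := by exact_mod_cast h
    rw [(ENat.add_left_injective_of_ne_top ENat.one_ne_top) h1]
    rfl

lemma exists_ringKrullDim_eq_succ [IsDomain R] [IsNoetherianRing R] [IsLocalRing R]
    (hR : maximalIdeal R ≠ ⊥) : ∃ d : ℕ, ringKrullDim R = (d + 1 : ℕ) := by
  have h := maximalIdeal_height_eq_ringKrullDim (R := R)
  obtain ⟨n, hn⟩ := ENat.ne_top_iff_exists.mp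
    (Ideal.height_ne_top_of_isPrime (I := maximalIdeal R))
  cases n with
  | zero => exact absurd (Ideal.height_eq_zero_iff_eq_bot.mp hn.symm) hR
  | succ d => exact ⟨d, by rw [← h, ← hn]; rfl⟩

end Multiplicity

/-! ### The formula for multiplicities in terms of Rees valuations -/

open IdealFiltration

/-- The valuative filtration defined by the Rees valuations of the maximal ideal. -/
lemma exists_valuativeFiltration {R : Type u} [CommRing R] [IsDomain R] [IsLocalRing R]
    [IsIntegrallyClosed R] [IsNoetherianRing R] (hcat : IsUniversallyCatenaryRing R) {K : Type v}
    [Field K] [Algebra R K] [IsFractionRing R K] {B : ℕ}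
    (hB : ∀ n : ℕ, idealIntegralClosure (maximalIdeal R ^ (n + B)) ⊆
      (maximalIdeal R ^ n : Ideal R)) {d : ℕ} (hd : ringKrullDim R = (d + 1 : ℕ))
    (hR : maximalIdeal R ≠ ⊥) :
    ∃ (ι : Type u) (_ : Fintype ι) (D : ValuativeFiltration R ι) (ν : ι → Valuation K ℤᵐ⁰),
      D.B = B ∧ (∀ i, ¬ EvPoly d (D.hilbertFun i)) ∧ (∀ i r, D.w i r = ν i (algebraMap R K r)) ∧
        (∀ i, IsReesValuation (maximalIdeal R) (ν i)) ∧
        ∀ μ : Valuation K ℤᵐ⁰, IsReesValuation (maximalIdeal R) μ → ∃ i, μ = ν i := by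
  have hcomm := isCommensurable_normalizedFiltration (K := K) hB
  have hI := normalizedFiltration_one_le (R := R) (K := K)
  have hN := hcomm.isNoetherianRing_and_finiteType.1
  have hint := isIntegrallyClosed_rees_normalizedFiltration (K := K) (J := maximalIdeal R)
  have hex : ∀ Q ∈ associatedPrimesOfElement (normalizedFiltration K (maximalIdeal R)).tInv,
      ∃ w : Valuation (normalizedFiltration K (maximalIdeal R)).rees ℤᵐ⁰,
        IsEssentialValuation Q w := by
    intro Q hQ
    obtain ⟨hp, b, hb⟩ := mem_associatedPrimesOfElement_iff.mp hQ
    exact exists_isEssentialValuation tInv_ne_zero hb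
  classical
  have hne : Nonempty (Valuation (normalizedFiltration K (maximalIdeal R)).rees ℤᵐ⁰) := ⟨1⟩
  choose! w hw using hex
  exact ⟨associatedPrimesOfElement (normalizedFiltration K (maximalIdeal R)).tInv,
    (finite_associatedPrimesOfElement _).fintype, valuativeFiltration hcomm hI hR hw,
    fun Q => baseValuation K (hw Q.1 Q.2), rfl,
    valuativeFiltration_not_evPoly hcomm hI hR hw hcat hd,
    fun Q r => (baseValuation_algebraMap (hw Q.1 Q.2) r).symm,
    isReesValuation_baseValuation hcomm hR hw, fun μ hμ => exists_eq_baseValuation hcomm hR hw hμ⟩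

/-- The multiplicities of `R` and of its hypersurface rings are the sums of the orders of `𝔪` and
of the equation along the Rees valuations, with the same positive weights. -/
lemma exists_degrees {R : Type u} [CommRing R] [IsDomain R] [IsLocalRing R]
    [IsIntegrallyClosed R] [IsNoetherianRing R] (hcat : IsUniversallyCatenaryRing R) {K : Type v}
    [Field K] [Algebra R K] [IsFractionRing R K] {B : ℕ}
    (hB : ∀ n : ℕ, idealIntegralClosure (maximalIdeal R ^ (n + B)) ⊆
      (maximalIdeal R ^ n : Ideal R)) (hR : maximalIdeal R ≠ ⊥) :
    ∃ (ι : Type u) (_ : Fintype ι) (ν : ι → Valuation K ℤᵐ⁰) (a : ι → ℕ) (δ : ι → ℤ),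
      (∀ i, 1 ≤ a i) ∧ (∀ i, 1 ≤ δ i) ∧ (∀ i, IsReesValuation (maximalIdeal R) (ν i)) ∧
      (∀ μ : Valuation K ℤᵐ⁰, IsReesValuation (maximalIdeal R) μ → ∃ i, μ = ν i) ∧
      hilbertSamuelMultiplicity (maximalIdeal R) R = ∑ i, (δ i : ℝ) * a i ∧
      ∀ f : R, f ≠ 0 →
        (∀ i, 0 ≤ addValue (ν i) f) ∧
        (∀ n : ℕ, f ∈ maximalIdeal R ^ n → ∀ i, (n : ℤ) * a i ≤ addValue (ν i) f) ∧
        (∀ n : ℕ, f ∉ maximalIdeal R ^ n → ∃ i, addValue (ν i) f < ((n + B : ℕ) : ℤ) * a i) ∧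
        (f ∈ maximalIdeal R → hilbertSamuelMultiplicity (maximalIdeal R) (R ⧸ Ideal.span {f}) =
          ∑ i, (δ i : ℝ) * addValue (ν i) f) := by
  classical
  obtain ⟨d, hd⟩ := exists_ringKrullDim_eq_succ hR
  obtain ⟨ι, hfin, D, ν, rfl, hev, hDν, hν, hν'⟩ := exists_valuativeFiltration (K := K) hcat hB hd hR
  choose δ hδ1 hδ using fun i => D.exists_degree hd i (hev i)
  refine ⟨ι, hfin, ν, D.a, δ, D.a_pos, hδ1, hν, hν', ?_, fun f hf0 => ?_⟩
  · exact hilbertSamuelMultiplicity_self hd (D.tendsto_colength_pow hδ)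
  · have hval : ∀ i, D.w i f = WithZero.exp (-(addValue (ν i) f)) := fun i => by
      have h0 : ν i (algebraMap R K f) ≠ 0 := by rw [← hDν]; exact D.ne_zero i hf0
      rw [addValue, neg_neg, WithZero.exp_log h0, hDν]
    have hnonneg : ∀ i, 0 ≤ addValue (ν i) f := fun i => by
      have h := D.w_le_one i f
      rw [hval, ← WithZero.exp_zero, WithZero.exp_le_exp] at h
      omega
    refine ⟨hnonneg, fun n hn i => ?_, fun n hn => ?_, fun hf => ?_⟩
    · have h := D.of_mem_pow n f hn i
      rw [hval, WithZero.exp_le_exp] at h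
      omega
    · by_contra! hcon
      refine hn (D.mem_pow n f fun i => ?_)
      rw [hval, WithZero.exp_le_exp]
      exact neg_le_neg (hcon i)
    · have h := D.tendsto_colength_span_sup hδ (f := f) (c := fun i => (addValue (ν i) f).toNat)
        fun i => by rw [hval, Int.toNat_of_nonneg (hnonneg i)]
      have h2 : ∀ i, (((addValue (ν i) f).toNat : ℕ) : ℝ) = (addValue (ν i) f : ℝ) := fun i => by
        exact_mod_cast congrArg (Int.cast (R := ℝ)) (Int.toNat_of_nonneg (hnonneg i))
      simp only [h2] at h
      exact hilbertSamuelMultiplicity_quotient (ringKrullDim_quotient_span_singleton hd hf hf0) h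

/-- The inequality behind the bound for `e(R / f)`: here `D` is the sum of the degrees of the Rees
valuations, and `D + a - 1` is a lower bound for `e(R)`. -/
lemma mul_sub_one_le_mul_sq {D a n B : ℝ} (hD : 1 ≤ D) (ha : 1 ≤ a) (hn : 1 ≤ n) (hB : 1 ≤ B) :
    D * ((n + 1 + B) * a - 1) ≤ 2 * B * n * (D + a - 1) ^ 2 := by
  have h1 : n + B ≤ 2 * (B * n) := by nlinarith
  have h2 : 1 ≤ B * n := by nlinarith
  obtain ⟨x, rfl⟩ : ∃ x, D = 1 + x := ⟨D - 1, by ring⟩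
  obtain ⟨y, rfl⟩ : ∃ y, a = 1 + y := ⟨a - 1, by ring⟩
  have hx : 0 ≤ x := by linarith
  have hy : 0 ≤ y := by linarith
  have hxy := mul_nonneg hx hy
  calc (1 + x) * ((n + 1 + B) * (1 + y) - 1)
      ≤ (1 + x) * ((2 * (B * n) + 1) * (1 + y) - 1) :=
        mul_le_mul_of_nonneg_left (by nlinarith [mul_nonneg (sub_nonneg.mpr h1) hy])
          (by linarith)
    _ ≤ 2 * B * n * (1 + x + (1 + y) - 1) ^ 2 := by
        nlinarith [mul_nonneg (sub_nonneg.mpr h2) hxy, mul_nonneg (sub_nonneg.mpr h2) hy,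
          mul_nonneg (sub_nonneg.mpr h2) hx, mul_nonneg (zero_le_one.trans h2) (sq_nonneg x),
          mul_nonneg (zero_le_one.trans h2) (sq_nonneg y)]

end

theorem mainTheorem8 {R : Type u} [CommRing R] [IsDomain R] [IsLocalRing R] [IsIntegrallyClosed R]
    (hR : IsExcellentRing R) {K : Type v} [Field K] [Algebra R K] [IsFractionRing R K]
    (B : ℕ)
    (hB : ∀ n : ℕ, idealIntegralClosure (IsLocalRing.maximalIdeal R ^ (n + B)) ⊆
      (IsLocalRing.maximalIdeal R ^ n : Ideal R)) :
    (∀ C : ℕ,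
      (∀ f ∈ IsLocalRing.maximalIdeal R, f ≠ 0 →
        hilbertSamuelMultiplicity (IsLocalRing.maximalIdeal R) (R ⧸ Ideal.span {f}) ≤
          (C : ℝ) * (idealOrder (IsLocalRing.maximalIdeal R) f : ℝ)) →
      ∀ ν₁ ν₂ : Valuation K ℤᵐ⁰,
        IsReesValuation (IsLocalRing.maximalIdeal R) ν₁ →
        IsReesValuation (IsLocalRing.maximalIdeal R) ν₂ → ν₁ ≠ ν₂ →
        ∀ f ∈ IsLocalRing.maximalIdeal R, f ≠ 0 →
          addValue ν₁ f ≤ ((C : ℤ) - 1) * addValue ν₂ f) ∧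
    (1 ≤ B → ∀ E : ℕ,
      (∀ ν₁ ν₂ : Valuation K ℤᵐ⁰,
        IsReesValuation (IsLocalRing.maximalIdeal R) ν₁ →
        IsReesValuation (IsLocalRing.maximalIdeal R) ν₂ →
        ∀ g ∈ IsLocalRing.maximalIdeal R, g ≠ 0 →
          addValue ν₁ g ≤ (E : ℤ) * addValue ν₂ g) →
      ∀ f ∈ IsLocalRing.maximalIdeal R, f ≠ 0 →
        hilbertSamuelMultiplicity (IsLocalRing.maximalIdeal R) (R ⧸ Ideal.span {f}) ≤
          2 * (B : ℝ) * (E : ℝ) *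
            hilbertSamuelMultiplicity (IsLocalRing.maximalIdeal R) R ^ 2 *
            (idealOrder (IsLocalRing.maximalIdeal R) f : ℝ)) := by
  have hN := hR.isNoetherianRing
  have key : ∀ f ∈ IsLocalRing.maximalIdeal R, f ≠ 0 → IsLocalRing.maximalIdeal R ≠ ⊥ :=
    fun f hf hf0 hbot => hf0 (by rwa [hbot, Ideal.mem_bot] at hf)
  have htop : IsLocalRing.maximalIdeal R ≠ ⊤ := (IsLocalRing.maximalIdeal.isMaximal R).ne_top
  constructor
  · intro C hC ν₁ ν₂ hν₁ hν₂ hne f hf hf0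
    obtain ⟨ι, hι, ν, a, δ, ha, hδ, hν, hν', -, hfor⟩ :=
      exists_degrees (K := K) hR.isUniversallyCatenaryRing hB (key f hf hf0)
    obtain ⟨i₁, rfl⟩ := hν' ν₁ hν₁
    obtain ⟨i₂, rfl⟩ := hν' ν₂ hν₂
    have hi : i₁ ≠ i₂ := fun h => hne (by rw [h])
    obtain ⟨hnonneg, hge, -, hmult⟩ := hfor f hf0
    have hbound := hC f hf hf0
    rw [hmult hf] at hbound
    have hord := hge _ (mem_pow_idealOrder_and_notMem htop hf0).1 i₂
    have hsum : addValue (ν i₁) f + addValue (ν i₂) f ≤ ∑ i, δ i * addValue (ν i) f := by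
      classical
      calc addValue (ν i₁) f + addValue (ν i₂) f
          ≤ δ i₁ * addValue (ν i₁) f + δ i₂ * addValue (ν i₂) f :=
            add_le_add (le_mul_of_one_le_left (hnonneg _) (hδ _))
              (le_mul_of_one_le_left (hnonneg _) (hδ _))
        _ = ∑ i ∈ {i₁, i₂}, δ i * addValue (ν i) f :=
            (Finset.sum_pair (f := fun i => δ i * addValue (ν i) f) hi).symm
        _ ≤ ∑ i, δ i * addValue (ν i) f :=
            Finset.sum_le_sum_of_subset_of_nonneg (Finset.subset_univ _) fun i _ _ =>
              mul_nonneg (zero_le_one.trans (hδ i)) (hnonneg i)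
    have hbound' : ∑ i, δ i * addValue (ν i) f ≤
        (C : ℤ) * idealOrder (IsLocalRing.maximalIdeal R) f := by exact_mod_cast hbound
    have h1 : (idealOrder (IsLocalRing.maximalIdeal R) f : ℤ) ≤ addValue (ν i₂) f := by
      refine le_trans (le_mul_of_one_le_right (Int.natCast_nonneg _) ?_) hord
      exact_mod_cast ha i₂
    have h2 := mul_le_mul_of_nonneg_left h1 (Int.natCast_nonneg C)
    linarith
  · intro hB1 E hE f hf hf0
    obtain ⟨ι, hι, ν, a, δ, ha, hδ, hν, hν', hself, hfor⟩ :=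
      exists_degrees (K := K) hR.isUniversallyCatenaryRing hB (key f hf hf0)
    obtain ⟨hnonneg, hge, hlt, hmult⟩ := hfor f hf0
    obtain ⟨hmem, hnotMem⟩ := mem_pow_idealOrder_and_notMem htop hf0
    set n := idealOrder (IsLocalRing.maximalIdeal R) f with hn
    have hn1 : 1 ≤ n := by
      by_contra! h0
      obtain h0 : n = 0 := by omega
      rw [h0, zero_add, pow_one] at hnotMem
      exact hnotMem hf
    obtain ⟨j, hj⟩ := hlt (n + 1) hnotMem
    rw [hmult hf, hself]
    have hδ' : ∀ i, (1 : ℝ) ≤ δ i := fun i => by exact_mod_cast hδ i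
    have ha' : ∀ i, (1 : ℝ) ≤ a i := fun i => by exact_mod_cast ha i
    -- all values of `f` are bounded by the one at `ν j`
    have h1 : ∑ i, (δ i : ℝ) * addValue (ν i) f ≤ E * ((∑ i, (δ i : ℝ)) * addValue (ν j) f) := by
      rw [Finset.sum_mul, Finset.mul_sum]
      refine Finset.sum_le_sum fun i _ => ?_
      have h : (addValue (ν i) f : ℝ) ≤ E * addValue (ν j) f := by
        exact_mod_cast hE (ν i) (ν j) (hν i) (hν j) f hf hf0
      calc (δ i : ℝ) * addValue (ν i) f ≤ δ i * (E * addValue (ν j) f) :=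
            mul_le_mul_of_nonneg_left h (zero_le_one.trans (hδ' i))
        _ = E * (δ i * addValue (ν j) f) := by ring
    have h2 : (addValue (ν j) f : ℝ) ≤ ((n : ℝ) + 1 + B) * a j - 1 := by
      have h : addValue (ν j) f ≤ ((n + 1 + B : ℕ) : ℤ) * a j - 1 := by omega
      exact_mod_cast h
    have h3 : 1 ≤ ∑ i, (δ i : ℝ) :=
      (hδ' j).trans (Finset.single_le_sum (f := fun i => (δ i : ℝ))
        (fun i _ => zero_le_one.trans (hδ' i)) (Finset.mem_univ j))
    have h4 : ∑ i, (δ i : ℝ) + a j - 1 ≤ ∑ i, (δ i : ℝ) * a i := by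
      have h : (δ j : ℝ) * (a j - 1) ≤ ∑ i, (δ i : ℝ) * (a i - 1) :=
        Finset.single_le_sum (f := fun i => (δ i : ℝ) * (a i - 1))
          (fun i _ => mul_nonneg (zero_le_one.trans (hδ' i)) (sub_nonneg.mpr (ha' i)))
          (Finset.mem_univ j)
      have h' : ∑ i, (δ i : ℝ) * (a i - 1) = ∑ i, (δ i : ℝ) * a i - ∑ i, (δ i : ℝ) := by
        rw [← Finset.sum_sub_distrib]
        exact Finset.sum_congr rfl fun i _ => by ring
      have h'' := mul_le_mul_of_nonneg_right (hδ' j) (sub_nonneg.mpr (ha' j))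
      linarith
    have h5 := mul_sub_one_le_mul_sq h3 (ha' j) (n := n) (B := B) (by exact_mod_cast hn1)
      (by exact_mod_cast hB1)
    have h6 : (∑ i, (δ i : ℝ) + a j - 1) ^ 2 ≤ (∑ i, (δ i : ℝ) * a i) ^ 2 :=
      pow_le_pow_left₀ (by linarith [ha' j]) h4 2
    calc ∑ i, (δ i : ℝ) * addValue (ν i) f
        ≤ E * ((∑ i, (δ i : ℝ)) * addValue (ν j) f) := h1
      _ ≤ E * ((∑ i, (δ i : ℝ)) * (((n : ℝ) + 1 + B) * a j - 1)) := by gcongr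
      _ ≤ E * (2 * B * n * (∑ i, (δ i : ℝ) + a j - 1) ^ 2) := by gcongr
      _ ≤ E * (2 * B * n * (∑ i, (δ i : ℝ) * a i) ^ 2) := by gcongr
      _ = 2 * B * E * (∑ i, (δ i : ℝ) * a i) ^ 2 * n := by ring
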